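/- Let $C$ be a smooth, irreducible, complex projective curve of genus $2$ and let $r\ge 3$. Let $F$ be a semistable vector bundle on $C$ of rank $r-1$ and degree $r$, i.e. $[F]\in\mathcal U_C(r-1,r)$, the moduli space of semistable vector bundles of rank $r-1$ and degree $r$ on $C$. Let $v\in\operatorname{Ext}^1(F,\mathcal O_C)$ be nonzero and let $$0\to\mathcal O_C\to E_v\xrightarrow{\ \varphi\ }F\to 0$$ be an extension with class $v$. Let $i\colon G\hookrightarrow E_v$ be a proper subbundle (so $E_v/G$ is a nonzero vector bundle) with slope $\deg G/\operatorname{rk}G=1$. Then $G$ is semistable, and one of the following holds: * $1\le\operatorname{rk}G\le r-2$ and $\varphi\circ i\colon G\to F$ makes $G$ a maximal subbundle of $F$, that is, $\varphi\circ i$ is injective with locally free cokernel, $G\neq F$ has slope $1$, and no subbundle of $F$ of rank $\operatorname{rk}G$ has larger degree; * $\operatorname{rk}G=r-1$ and $\varphi\circ i\colon G\to F$ makes $G$ an elementary transformation of $F$, that is, there are a point $p\in C$ and an exact sequence $$0\to G\xrightarrow{\ \varphi\circ i\ }F\to\mathbb C_p\to 0,$$ where $\mathbb C_p$ is the skyscraper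 sheaf at $p$ with fibre $\mathbb C$. -/

import Mathlib

open CategoryTheory CategoryTheory.Limits CategoryTheory.Abelian AlgebraicGeometry

noncomputable section

/-- A smooth irreducible projective curve over `ℂ`: an integral scheme that is smooth of relative
dimension one and proper over `Spec ℂ` (a proper curve is projective). -/
structure SmoothProjectiveCurve where
  X : Scheme.{0}
  str : X ⟶ Spec (CommRingCat.of ℂ)
  isIntegral : IsIntegral X
  smooth : SmoothOfRelativeDimension 1 str
  proper : IsProper str

namespace SmoothProjectiveCurve

/-- The module structure on stalks from Mathlib, in a form that can be applied to `𝒪`-modules. -/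
abbrev stalkModuleAux {X : TopCat.{0}} {R : X.Presheaf CommRingCat.{0}}
    (M : PresheafOfModules.{0} (R ⋙ forget₂ CommRingCat RingCat)) (x : X) :
    Module (R.stalk x) ↑(TopCat.Presheaf.stalk M.presheaf x) :=
  inferInstance

variable (C : SmoothProjectiveCurve)

instance : IsIntegral C.X := C.isIntegral

instance : IsProper C.str := C.proper

instance : IsLocallyNoetherian C.X :=
  LocallyOfFiniteType.isLocallyNoetherian C.str

/-! ### The genus -/

/-- The stalks of the structure sheaf (in particular the function field) are `ℂ`-algebras. -/
instance stalkAlgebra (x : C.X) : Algebra ℂ (C.X.presheaf.stalk x) :=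
  ((Scheme.ΓSpecIso (CommRingCat.of ℂ)).inv ≫ C.str.appTop ≫
    C.X.presheaf.germ ⊤ x trivial).hom.toAlgebra

/-- The global regular differentials `H⁰(C, Ω_C)`: the rational differentials that lie, for every
point `x`, in the `𝒪_x`-module generated by the differentials of the elements of `𝒪_x`. -/
def regularDifferentials :
    Submodule ℂ (KaehlerDifferential ℂ (C.X.presheaf.stalk (genericPoint C.X))) :=
  ⨅ x : C.X, Submodule.span ℂ
    {ω | ∃ f g : C.X.presheaf.stalk x,
      ω = (algebraMap (C.X.presheaf.stalk x) C.X.functionField f) •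
        KaehlerDifferential.D ℂ (C.X.presheaf.stalk (genericPoint C.X))
          (algebraMap (C.X.presheaf.stalk x) C.X.functionField g)}

/-- The genus of `C`, the dimension of `H⁰(C, Ω_C)`. -/
def genus : ℕ := Module.finrank ℂ C.regularDifferentials

/-! ### Vector bundles, rank, degree and slope -/

/-- The structure sheaf as a sheaf of modules. -/
def structureSheaf : C.X.Modules := SheafOfModules.unit C.X.ringCatSheaf

/-- The stalk of a sheaf of modules at `x` is a module over the local ring `𝒪_x`. -/
instance stalkModule (M : C.X.Modules) (x : C.X) :
    Module (C.X.presheaf.stalk x) ↑(TopCat.Presheaf.stalk M.presheaf x) :=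
  stalkModuleAux (R := C.X.presheaf) M.val x

instance : HasExt.{1} C.X.Modules := HasExt.standard _

variable {C}

/-- A vector bundle: a sheaf of modules that is locally free of finite rank. -/
def IsVectorBundle (M : C.X.Modules) : Prop :=
  ∀ x : C.X, ∃ U : C.X.Opens, x ∈ U ∧ ∃ n : ℕ,
    Nonempty (M.restrict U.ι ≅ SheafOfModules.free (R := (U : Scheme.{0}).ringCatSheaf) (Fin n))

/-- The rank: the dimension of the generic stalk over the function field. -/
def rank (M : C.X.Modules) : ℕ :=
  Module.finrank (C.X.presheaf.stalk (genericPoint C.X))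
    ↑(TopCat.Presheaf.stalk M.presheaf (genericPoint C.X))

/-- The map from the stalk at `x` to the generic stalk. -/
def toGenericStalk (M : C.X.Modules) (x : C.X) :
    ↑(TopCat.Presheaf.stalk M.presheaf x) →
      ↑(TopCat.Presheaf.stalk M.presheaf (genericPoint C.X)) :=
  M.presheaf.stalkSpecializes ((genericPoint_spec C.X).specializes trivial)

open Classical in
/-- Let `b` be a frame of the generic stalk of `M`. This is the order of vanishing at `x` of the
rational section `b₁ ∧ ⋯ ∧ bₙ` of the line bundle `det M`: if `c` is a frame of the stalk `M_x`, then
`c₁ ∧ ⋯ ∧ cₙ = d • (b₁ ∧ ⋯ ∧ bₙ)` where `d` is the determinant of `c` in terms of `b`,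
so the order is `-ord_x d`. -/
def frameOrder (M : C.X.Modules) {n : ℕ}
    (b : Module.Basis (Fin n) (C.X.presheaf.stalk (genericPoint C.X))
      ↑(TopCat.Presheaf.stalk M.presheaf (genericPoint C.X))) (x : C.X) : ℤ :=
  if h : Nonempty (Module.Basis (Fin n) (C.X.presheaf.stalk x)
      ↑(TopCat.Presheaf.stalk M.presheaf x)) then
    - Scheme.ord (b.det fun i => toGenericStalk M x (h.some i)) x
  else 0

open Classical in
/-- The degree of a vector bundle: the degree of the divisor of a nonzero rational section of its
determinant line bundle (every closed point of `C` has residue field `ℂ`, so it has degree one).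
The rational section is `b₁ ∧ ⋯ ∧ bₙ` for some frame `b` of the generic stalk. -/
def degree (M : C.X.Modules) : ℤ :=
  if h : Nonempty (Module.Basis (Fin (rank M)) (C.X.presheaf.stalk (genericPoint C.X))
      ↑(TopCat.Presheaf.stalk M.presheaf (genericPoint C.X))) then
    ∑ᶠ x : C.X, frameOrder M h.some x
  else 0

/-- The slope `deg M / rk M` of a nonzero vector bundle (and `0` for the zero bundle). -/
def slope (M : C.X.Modules) : ℚ := (degree M : ℚ) / (rank M : ℚ)

/-- A nonzero vector bundle is semistable if no nonzero subsheaf has larger slope. The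
(quasi-coherent) subsheaves of a vector bundle on a smooth curve are vector bundles. -/
def IsSemistable (M : C.X.Modules) : Prop :=
  IsVectorBundle M ∧ 0 < rank M ∧
    ∀ (S : C.X.Modules) (j : S ⟶ M), IsVectorBundle S → Mono j → 0 < rank S → slope S ≤ slope M

/-! ### Subbundles and elementary transformations -/

/-- `i : G ⟶ M` makes `G` a subbundle of `M`: an injective map of sheaves whose quotient is again
a vector bundle. -/
def IsSubbundle {G M : C.X.Modules} (i : G ⟶ M) : Prop :=
  IsVectorBundle G ∧ Mono i ∧ IsVectorBundle (cokernel i)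

/-- A subbundle different from the whole bundle. -/
def IsProperSubbundle {G M : C.X.Modules} (i : G ⟶ M) : Prop :=
  IsSubbundle i ∧ ¬ IsIso i

/-- A maximal subbundle: a proper subbundle of slope one; moreover no subbundle of the same rank
has larger degree. -/
def IsMaximalSubbundle {G M : C.X.Modules} (i : G ⟶ M) : Prop :=
  IsProperSubbundle i ∧ slope G = 1 ∧
    ∀ (H : C.X.Modules) (k : H ⟶ M), IsSubbundle k → rank H = rank G → degree H ≤ degree G

variable (C) in
/-- The skyscraper sheaf `ℂ_p`: the push-forward of the structure sheaf of `Spec κ(p)`. -/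
def skyscraper (p : C.X) : C.X.Modules :=
  (Scheme.Modules.pushforward (C.X.fromSpecResidueField p)).obj
    (SheafOfModules.unit (Spec (C.X.residueField p)).ringCatSheaf)

/-- `j : G ⟶ M` makes `G` an elementary transformation of `M` at a closed point `p`: there is an
exact sequence `0 ⟶ G ⟶ M ⟶ ℂ_p ⟶ 0` with first map `j`. -/
def IsElementaryTransformation {G M : C.X.Modules} (j : G ⟶ M) : Prop :=
  ∃ p : C.X, IsClosed {p} ∧ ∃ (γ : M ⟶ C.skyscraper p) (w : j ≫ γ = 0),
    (ShortComplex.mk j γ w).ShortExact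

end SmoothProjectiveCurve

end

/-! The heart of the matter is a bound for subsheaves of `E` (`degree_le_rank`): a vector bundle `S`
of rank less than `r` that embeds in `E` has degree at most its rank, and equality forces `S → E →
F` to be injective.

If `S → F` is injective and `rk S < r - 1`, semistability of `F` gives `deg S ≤ rk S · r / (r - 1) <
rk S + 1`. If `S → F` is injective and `rk S = r - 1`, a degree of at least `r = deg F` would make
it an isomorphism, and its inverse would split the extension, against `v ≠ 0`. If it is not
injective, its kernel is a rank one subsheaf of the structure sheaf, of degree at most `0`, and the
image has rank `rk S - 1`, so `deg S ≤ rk S - 1`.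

A subbundle `G` of slope one attains the bound, so it embeds in `F`; the same bound for its
subsheaves makes it semistable. If `rk G < r - 1`, then `G` has the largest degree among subsheaves
of `F` of its rank, hence it equals its saturation and the cokernel is locally free
(`isVectorBundle_cokernel_of_degree_le`). If `rk G = r - 1`, the degrees differ by one, so the
determinant of `G → F` vanishes at a single point, to first order, and the cokernel is the residue
field there (`isElementaryTransformation_of_degree`).

Most of the work establishes the calculus of degrees. The degree is defined by arbitrary choices of
bases; independence of them (`IsVectorBundle.degree_eq`) needs that principal divisors have degree
zero (`finsum_ord_eq_zero`). For this, points of `C` are matched with valuation rings of the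
function field by the valuative criterion, and the zeros of a transcendental `f` are counted as `[K
: ℂ(f)]`, a number shared by `f` and `f⁻¹`. Additivity in exact sequences (`degree_eq_add`) and the
determinant formula `degree_sub_degree` then follow from linear algebra on stalks. -/

open TopologicalSpace Opposite

noncomputable section

namespace SmoothProjectiveCurve

variable {C : SmoothProjectiveCurve}

/-! ### Germs and stalk maps of sheaves of modules -/

/-- The germ at `x` of a section of a sheaf of modules. -/
def germ (M : C.X.Modules) {U : C.X.Opens} {x : C.X} (hx : x ∈ U) :
    Γ(M, U) →+ ↑(TopCat.Presheaf.stalk M.presheaf x) :=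
  (TopCat.Presheaf.germ M.presheaf U x hx).hom

/-- The germ at `x` of a regular function. -/
def ringGerm {U : C.X.Opens} {x : C.X} (hx : x ∈ U) : Γ(C.X, U) →+* C.X.presheaf.stalk x :=
  (C.X.presheaf.germ U x hx).hom

/-- Restriction of sections of a sheaf of modules. -/
def res (M : C.X.Modules) {V U : C.X.Opens} (h : V ≤ U) : Γ(M, U) →+ Γ(M, V) :=
  (M.presheaf.map (homOfLE h).op).hom

/-- Restriction of regular functions. -/
def ringRes {V U : C.X.Opens} (h : V ≤ U) : Γ(C.X, U) →+* Γ(C.X, V) :=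
  (C.X.presheaf.map (homOfLE h).op).hom

/-- The map on sections. -/
def sec {M N : C.X.Modules} (φ : M ⟶ N) (U : C.X.Opens) : Γ(M, U) →+ Γ(N, U) := (φ.app U).hom

lemma sec_smul {M N : C.X.Modules} (φ : M ⟶ N) {U : C.X.Opens} (a : Γ(C.X, U)) (m : Γ(M, U)) :
    sec φ U (a • m) = a • sec φ U m :=
  φ.app_smul a m

lemma sec_comp {M N P : C.X.Modules} (φ : M ⟶ N) (ψ : N ⟶ P) (U : C.X.Opens) (m : Γ(M, U)) :
    sec (φ ≫ ψ) U m = sec ψ U (sec φ U m) := rfl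

lemma sec_zero {M N : C.X.Modules} (U : C.X.Opens) (m : Γ(M, U)) :
    sec (0 : M ⟶ N) U m = 0 := rfl

lemma sec_res {M N : C.X.Modules} (φ : M ⟶ N) {V U : C.X.Opens} (h : V ≤ U) (m : Γ(M, U)) :
    sec φ V (res M h m) = res N h (sec φ U m) :=
  congr($(φ.mapPresheaf.naturality (homOfLE h).op) m)

lemma res_smul (M : C.X.Modules) {V U : C.X.Opens} (h : V ≤ U) (a : Γ(C.X, U)) (m : Γ(M, U)) :
    res M h (a • m) = ringRes h a • res M h m :=
  M.map_smul (homOfLE h) a m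

lemma germ_smul (M : C.X.Modules) {U : C.X.Opens} {x : C.X} (hx : x ∈ U) (a : Γ(C.X, U))
    (m : Γ(M, U)) : germ M hx (a • m) = ringGerm hx a • germ M hx m :=
  PresheafOfModules.germ_smul (R := C.X.presheaf) M.val x U hx a m

lemma germ_res (M : C.X.Modules) {V U : C.X.Opens} (h : V ≤ U) {x : C.X} (hx : x ∈ V)
    (m : Γ(M, U)) : germ M hx (res M h m) = germ M (h hx) m :=
  TopCat.Presheaf.germ_res_apply M.presheaf (homOfLE h) x hx m

lemma ringGerm_res {V U : C.X.Opens} (h : V ≤ U) {x : C.X} (hx : x ∈ V)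
    (m : Γ(C.X, U)) : ringGerm hx (ringRes h m) = ringGerm (h hx) m :=
  TopCat.Presheaf.germ_res_apply C.X.presheaf (homOfLE h) x hx m

lemma exists_germ_eq (M : C.X.Modules) {x : C.X} (m : ↑(TopCat.Presheaf.stalk M.presheaf x)) :
    ∃ (U : C.X.Opens) (hx : x ∈ U) (s : Γ(M, U)), germ M hx s = m :=
  TopCat.Presheaf.exists_germ_eq M.presheaf m

lemma exists_ringGerm_eq {x : C.X} (m : C.X.presheaf.stalk x) :
    ∃ (U : C.X.Opens) (hx : x ∈ U) (s : Γ(C.X, U)), ringGerm hx s = m :=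
  TopCat.Presheaf.exists_germ_eq C.X.presheaf m

lemma exists_res_eq_zero (M : C.X.Modules) {U : C.X.Opens} {x : C.X} (hx : x ∈ U) (m : Γ(M, U))
    (h : germ M hx m = 0) : ∃ (V : C.X.Opens) (_ : x ∈ V) (hVU : V ≤ U), res M hVU m = 0 := by
  obtain ⟨W, hxW, i, j, e⟩ := TopCat.Presheaf.germ_eq M.presheaf x hx hx m 0
    (h.trans (map_zero (germ M hx)).symm)
  exact ⟨W, hxW, i.le, e.trans (map_zero (M.presheaf.map j.op).hom)⟩

/-- The sheaf of abelian groups underlying a sheaf of modules. -/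
def abSheaf (M : C.X.Modules) : TopCat.Sheaf Ab C.X := ⟨M.presheaf, M.isSheaf⟩

lemma sec_ext (M : C.X.Modules) {U : C.X.Opens} (s t : Γ(M, U))
    (h : ∀ (x : C.X) (hx : x ∈ U), germ M hx s = germ M hx t) : s = t :=
  TopCat.Presheaf.section_ext (abSheaf M) U s t h

/-- The map on stalks. -/
def stalkMap {M N : C.X.Modules} (φ : M ⟶ N) (x : C.X) :
    ↑(TopCat.Presheaf.stalk M.presheaf x) →ₗ[C.X.presheaf.stalk x]
      ↑(TopCat.Presheaf.stalk N.presheaf x) where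
  toFun := ((TopCat.Presheaf.stalkFunctor Ab x).map φ.mapPresheaf).hom
  map_add' := map_add _
  map_smul' a m := by
    obtain ⟨U, hx, s, rfl⟩ := exists_germ_eq M m
    obtain ⟨V, hxV, b, rfl⟩ := exists_ringGerm_eq a
    have key : ∀ (W : C.X.Opens) (hxW : x ∈ W) (t : Γ(M, W)),
        ((TopCat.Presheaf.stalkFunctor Ab x).map φ.mapPresheaf).hom (germ M hxW t) =
          germ N hxW (sec φ W t) := fun W hxW t ↦
      TopCat.Presheaf.stalkFunctor_map_germ_apply W x hxW φ.mapPresheaf t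
    have hW : x ∈ U ⊓ V := ⟨hx, hxV⟩
    rw [← germ_res M inf_le_left hW, ← ringGerm_res inf_le_right hW, ← germ_smul, key, key,
      sec_smul, germ_smul]
    rfl

lemma stalkMap_germ {M N : C.X.Modules} (φ : M ⟶ N) {U : C.X.Opens} {x : C.X} (hx : x ∈ U)
    (m : Γ(M, U)) : stalkMap φ x (germ M hx m) = germ N hx (sec φ U m) :=
  TopCat.Presheaf.stalkFunctor_map_germ_apply U x hx φ.mapPresheaf m

lemma stalkMap_comp {M N P : C.X.Modules} (φ : M ⟶ N) (ψ : N ⟶ P) (x : C.X)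
    (m : ↑(TopCat.Presheaf.stalk M.presheaf x)) :
    stalkMap (φ ≫ ψ) x m = stalkMap ψ x (stalkMap φ x m) := by
  obtain ⟨U, hx, s, rfl⟩ := exists_germ_eq M m
  simp only [stalkMap_germ, sec_comp]

lemma stalkMap_zero {M N : C.X.Modules} (x : C.X)
    (m : ↑(TopCat.Presheaf.stalk M.presheaf x)) : stalkMap (0 : M ⟶ N) x m = 0 := by
  obtain ⟨U, hx, s, rfl⟩ := exists_germ_eq M m
  simp only [stalkMap_germ, sec_zero, map_zero]

lemma hom_ext_of_stalkMap {M N : C.X.Modules} (φ ψ : M ⟶ N)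
    (h : ∀ x m, stalkMap φ x m = stalkMap ψ x m) : φ = ψ := by
  apply Scheme.Modules.hom_ext
  intro U
  ext m
  apply sec_ext
  intro x hx
  have := h x (germ M hx m)
  rwa [stalkMap_germ, stalkMap_germ] at this

/-! ### Subsheaves given by submodules of the stalks -/

section Subsheaf

lemma mem_of_eq_of_mem {R A : Type*} [Ring R] [AddCommGroup A] [Module R A] {p : Submodule R A}
    {a b : A} (h : a = b) (hb : b ∈ p) : a ∈ p := h ▸ hb

variable (M : C.X.Modules)
  (N : ∀ x : C.X, Submodule (C.X.presheaf.stalk x) ↑(TopCat.Presheaf.stalk M.presheaf x))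

/-- The sections whose germs lie in given submodules of the stalks, as a presheaf of
submodules. -/
def subPresheaf : PresheafOfModules.Submodule M.val where
  obj U :=
    { carrier := {s : Γ(M, U.unop) | ∀ (x : C.X) (hx : x ∈ U.unop), germ M hx s ∈ N x}
      add_mem' := fun {a b} ha hb x hx ↦
        mem_of_eq_of_mem (map_add (germ M hx) a b) ((N x).add_mem (ha x hx) (hb x hx))
      zero_mem' := fun x hx ↦ mem_of_eq_of_mem (map_zero (germ M hx)) (N x).zero_mem
      smul_mem' := fun a s hs x hx ↦
        mem_of_eq_of_mem (germ_smul M hx a s) ((N x).smul_mem (ringGerm hx a) (hs x hx)) }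
  map f s hs x hx :=
    mem_of_eq_of_mem (germ_res M f.unop.le hx s) (hs x (f.unop.le hx))

lemma isSheaf_subPresheaf :
    TopCat.Presheaf.IsSheaf (X := C.X) (subPresheaf M N).toPresheafOfModules.presheaf := by
  rw [TopCat.Presheaf.isSheaf_iff_isSheaf_comp (forget Ab)]
  apply TopCat.Presheaf.isSheaf_of_isSheafUniqueGluing_types
  intro ι U sf hsf
  have hcomp : TopCat.Presheaf.IsCompatible (abSheaf M).1 U (fun i ↦ (sf i).1) := by
    intro i j
    exact congrArg Subtype.val (hsf i j)
  obtain ⟨s, hs, huniq⟩ := (abSheaf M).existsUnique_gluing U (fun i ↦ (sf i).1) hcomp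
  refine ⟨⟨s, fun x hx ↦ ?_⟩, fun i ↦ Subtype.ext (hs i), fun t ht ↦ Subtype.ext (huniq _ fun i ↦
    congrArg Subtype.val (ht i))⟩
  obtain ⟨i, hi⟩ := Opens.mem_iSup.mp hx
  have h := (sf i).2 x hi
  have e : res M (le_iSup U i) s = (sf i).1 := hs i
  exact mem_of_eq_of_mem ((germ_res M (le_iSup U i) hi s).symm.trans (congrArg (germ M hi) e)) h

/-- The subsheaf of sections whose germs lie in given submodules of the stalks. -/
def subsheaf : C.X.Modules where
  val := (subPresheaf M N).toPresheafOfModules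
  isSheaf := isSheaf_subPresheaf M N

/-- The inclusion of a subsheaf. -/
def subsheafι : subsheaf M N ⟶ M := ⟨(subPresheaf M N).ι⟩

lemma germ_sec_subsheafι_mem {U : C.X.Opens} (s : Γ(subsheaf M N, U)) {x : C.X} (hx : x ∈ U) :
    germ M hx (sec (subsheafι M N) U s) ∈ N x := s.2 x hx

lemma exists_sec_subsheafι_eq {U : C.X.Opens} (s : Γ(M, U))
    (h : ∀ (x : C.X) (hx : x ∈ U), germ M hx s ∈ N x) :
    ∃ t, sec (subsheafι M N) U t = s := ⟨⟨s, h⟩, rfl⟩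

end Subsheaf

/-! ### Monomorphisms, epimorphisms and exactness -/

lemma mono_of_sec_injective {M N : C.X.Modules} (φ : M ⟶ N)
    (h : ∀ U, Function.Injective (sec φ U)) : Mono φ where
  right_cancellation g₁ g₂ e := by
    apply Scheme.Modules.hom_ext
    intro U
    ext m
    exact h U congr(sec $e U m)

instance mono_subsheafι (M : C.X.Modules)
    (N : ∀ x : C.X, Submodule (C.X.presheaf.stalk x) ↑(TopCat.Presheaf.stalk M.presheaf x)) :
    Mono (subsheafι M N) :=
  mono_of_sec_injective _ fun _ _ _ h ↦ Subtype.ext h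

/-- The test object is the subsheaf of sections whose germs are killed by `φ`: its inclusion
composes to zero with `φ`, so it is zero. -/
lemma sec_injective {M N : C.X.Modules} (φ : M ⟶ N) [Mono φ] (U : C.X.Opens) :
    Function.Injective (sec φ U) := by
  let K := subsheaf M fun x ↦ LinearMap.ker (stalkMap φ x)
  have h0 : subsheafι M (fun x ↦ LinearMap.ker (stalkMap φ x)) = 0 := by
    rw [← cancel_mono φ, zero_comp]
    apply Scheme.Modules.hom_ext
    intro V
    ext m
    apply sec_ext
    intro x hx
    have := germ_sec_subsheafι_mem M _ m hx
    rw [LinearMap.mem_ker, stalkMap_germ] at this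
    exact this.trans (map_zero _).symm
  rw [injective_iff_map_eq_zero]
  intro m hm
  obtain ⟨t, rfl⟩ := exists_sec_subsheafι_eq M (fun x ↦ LinearMap.ker (stalkMap φ x)) m
    fun x hx ↦ by rw [LinearMap.mem_ker, stalkMap_germ, hm, map_zero]
  rw [h0, sec_zero]

lemma stalkMap_injective {M N : C.X.Modules} (φ : M ⟶ N) [Mono φ] (x : C.X) :
    Function.Injective (stalkMap φ x) := by
  rw [injective_iff_map_eq_zero]
  intro m hm
  obtain ⟨U, hx, s, rfl⟩ := exists_germ_eq M m
  rw [stalkMap_germ] at hm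
  obtain ⟨V, hxV, hVU, h⟩ := exists_res_eq_zero N hx _ hm
  rw [← sec_res] at h
  rw [← germ_res M hVU hxV, sec_injective φ V (h.trans (map_zero _).symm), map_zero]

lemma mono_of_stalkMap_injective {M N : C.X.Modules} (φ : M ⟶ N)
    (h : ∀ x, Function.Injective (stalkMap φ x)) : Mono φ := by
  refine mono_of_sec_injective φ fun U s t e ↦ sec_ext M s t fun x hx ↦ h x ?_
  rw [stalkMap_germ, stalkMap_germ, e]

lemma epi_of_stalkMap_surjective {M N : C.X.Modules} (φ : M ⟶ N)
    (h : ∀ x, Function.Surjective (stalkMap φ x)) : Epi φ where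
  left_cancellation g₁ g₂ e := by
    refine hom_ext_of_stalkMap _ _ fun x m ↦ ?_
    obtain ⟨m, rfl⟩ := h x m
    rw [← stalkMap_comp, ← stalkMap_comp, e]

/-- Factor a morphism through a monomorphism. -/
lemma exists_lift_of_sec {M N P : C.X.Modules} (φ : M ⟶ N) [Mono φ] (k : P ⟶ N)
    (h : ∀ U (p : Γ(P, U)), ∃ m, sec φ U m = sec k U p) : ∃ l : P ⟶ M, l ≫ φ = k := by
  choose f hf using h
  have inj := sec_injective φ
  let app : ∀ U : (C.X.Opens)ᵒᵖ, P.presheaf.obj U →+ M.presheaf.obj U := fun U ↦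
    { toFun := f U.unop
      map_zero' := inj _ (by rw [hf]; exact (map_zero (sec k U.unop)).trans (map_zero _).symm)
      map_add' := fun a b ↦ inj _ (by
        rw [hf, map_add (sec φ U.unop), hf, hf]; exact map_add (sec k U.unop) a b) }
  let l : P.val ⟶ M.val := PresheafOfModules.homMk
    { app := fun U ↦ AddCommGrpCat.ofHom (app U)
      naturality := fun U V i ↦ by
        ext p
        refine inj V.unop ?_
        refine (hf V.unop _).trans ?_
        refine (sec_res k i.unop.le p).trans ?_
        refine (congrArg (res N i.unop.le) (hf U.unop p).symm).trans ?_
        exact (sec_res φ i.unop.le _).symm }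
    (fun U a p ↦ inj U.unop (by
      refine (hf U.unop _).trans ?_
      refine (sec_smul k _ _).trans ?_
      refine (congrArg (fun z : Γ(N, U.unop) ↦ (show Γ(C.X, U.unop) from a) • z)
        (hf U.unop p).symm).trans ?_
      exact (sec_smul φ _ _).symm))
  refine ⟨⟨l⟩, ?_⟩
  apply Scheme.Modules.hom_ext
  intro U
  ext p
  exact hf U p

lemma exists_lift_of_subsheaf {M P : C.X.Modules}
    (N : ∀ x : C.X, Submodule (C.X.presheaf.stalk x) ↑(TopCat.Presheaf.stalk M.presheaf x))
    (k : P ⟶ M) (h : ∀ x p, stalkMap k x p ∈ N x) : ∃ l, l ≫ subsheafι M N = k := by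
  refine exists_lift_of_sec _ _ fun U p ↦ exists_sec_subsheafι_eq _ _ _ fun x hx ↦ ?_
  rw [← stalkMap_germ]
  exact h x _

/-- `φ` factors through the subsheaf of its stalkwise image. The inclusion of that subsheaf is both
mono and epi, hence an isomorphism. -/
lemma stalkMap_surjective {M N : C.X.Modules} (φ : M ⟶ N) [Epi φ] (x : C.X) :
    Function.Surjective (stalkMap φ x) := by
  obtain ⟨l, hl⟩ := exists_lift_of_subsheaf (fun x ↦ LinearMap.range (stalkMap φ x)) φ
    fun x p ↦ ⟨p, rfl⟩
  have : Epi (subsheafι N fun x ↦ LinearMap.range (stalkMap φ x)) := by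
    have : Epi (l ≫ subsheafι N fun x ↦ LinearMap.range (stalkMap φ x)) := by
      rw [hl]; infer_instance
    exact epi_of_epi l _
  have : IsIso (subsheafι N fun x ↦ LinearMap.range (stalkMap φ x)) := isIso_of_mono_of_epi _
  intro n
  obtain ⟨U, hx, s, rfl⟩ := exists_germ_eq N n
  have hs : sec (subsheafι N fun x ↦ LinearMap.range (stalkMap φ x)) U
      (sec (inv (subsheafι N fun x ↦ LinearMap.range (stalkMap φ x))) U s) = s := by
    rw [← sec_comp, IsIso.inv_hom_id]; rfl
  have := germ_sec_subsheafι_mem N _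
    (sec (inv (subsheafι N fun x ↦ LinearMap.range (stalkMap φ x))) U s) hx
  rwa [hs] at this

lemma isIso_of_stalkMap_bijective {M N : C.X.Modules} (φ : M ⟶ N)
    (h : ∀ x, Function.Bijective (stalkMap φ x)) : IsIso φ := by
  have := mono_of_stalkMap_injective φ fun x ↦ (h x).1
  have := epi_of_stalkMap_surjective φ fun x ↦ (h x).2
  exact isIso_of_mono_of_epi φ

/-- A section all of whose germs lie in the image of a monomorphism lies in the image. -/
lemma exists_sec_eq_of_germ {M N : C.X.Modules} (φ : M ⟶ N) [Mono φ] {U : C.X.Opens}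
    (s : Γ(N, U)) (h : ∀ (x : C.X) (hx : x ∈ U), germ N hx s ∈ LinearMap.range (stalkMap φ x)) :
    ∃ t, sec φ U t = s := by
  obtain ⟨l, hl⟩ := exists_lift_of_subsheaf (fun x ↦ LinearMap.range (stalkMap φ x)) φ
    fun x p ↦ ⟨p, rfl⟩
  have : IsIso l := by
    refine isIso_of_stalkMap_bijective l fun x ↦ ⟨?_, fun m ↦ ?_⟩
    · have : Mono (l ≫ subsheafι N fun x ↦ LinearMap.range (stalkMap φ x)) := by
        rw [hl]; infer_instance
      have : Mono l := mono_of_mono l (subsheafι N fun x ↦ LinearMap.range (stalkMap φ x))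
      exact stalkMap_injective l x
    · obtain ⟨U, hx, s, rfl⟩ := exists_germ_eq _ m
      obtain ⟨n, hn⟩ := germ_sec_subsheafι_mem N _ s hx
      refine ⟨n, stalkMap_injective (subsheafι N fun x ↦ LinearMap.range (stalkMap φ x)) x ?_⟩
      rw [← stalkMap_comp, hl, hn, stalkMap_germ]
  obtain ⟨t, rfl⟩ := exists_sec_subsheafι_eq N _ s h
  refine ⟨sec (inv l) U t, ?_⟩
  calc sec φ U (sec (inv l) U t)
      = sec (inv l ≫ l ≫ subsheafι N fun x ↦ LinearMap.range (stalkMap φ x)) U t := by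
        rw [hl]; rfl
    _ = _ := by rw [IsIso.inv_hom_id_assoc]

lemma exists_lift_of_stalkMap {M N P : C.X.Modules} (φ : M ⟶ N) [Mono φ] (k : P ⟶ N)
    (h : ∀ x p, stalkMap k x p ∈ LinearMap.range (stalkMap φ x)) : ∃ l : P ⟶ M, l ≫ φ = k := by
  refine exists_lift_of_sec φ k fun U p ↦ exists_sec_eq_of_germ φ _ fun x hx ↦ ?_
  rw [← stalkMap_germ]
  exact h x _

/-- Exactness at the middle of the sequence of stalks of a short exact sequence. -/
lemma range_stalkMap_eq_ker {S : ShortComplex C.X.Modules} (hS : S.ShortExact) (x : C.X) :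
    LinearMap.range (stalkMap S.f x) = LinearMap.ker (stalkMap S.g x) := by
  have := hS.mono_f
  apply le_antisymm
  · rintro _ ⟨m, rfl⟩
    rw [LinearMap.mem_ker, ← stalkMap_comp, S.zero, stalkMap_zero]
  · intro m hm
    -- Exactness lifts the stalkwise kernel subsheaf through `S.f`; a germ in the kernel is
    -- represented, after shrinking, by a section of this subsheaf.
    obtain ⟨l, hl⟩ : ∃ l, l ≫ S.f = subsheafι S.X₂ fun y ↦ LinearMap.ker (stalkMap S.g y) := by
      have h0 : subsheafι S.X₂ (fun y ↦ LinearMap.ker (stalkMap S.g y)) ≫ S.g = 0 := by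
        refine hom_ext_of_stalkMap _ _ fun y n ↦ ?_
        obtain ⟨U, hy, s, rfl⟩ := exists_germ_eq _ n
        rw [stalkMap_comp, stalkMap_zero, stalkMap_germ]
        exact germ_sec_subsheafι_mem _ _ s hy
      exact ⟨hS.exact.lift _ h0, hS.exact.lift_f _ h0⟩
    obtain ⟨U, hx, s, rfl⟩ := exists_germ_eq _ m
    rw [LinearMap.mem_ker, stalkMap_germ] at hm
    obtain ⟨V, hxV, hVU, h⟩ := exists_res_eq_zero _ hx _ hm
    obtain ⟨t, ht⟩ := exists_sec_subsheafι_eq S.X₂ (fun y ↦ LinearMap.ker (stalkMap S.g y))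
      (res _ hVU s) fun y hy ↦ by rw [LinearMap.mem_ker, stalkMap_germ, sec_res, h, map_zero]
    refine ⟨germ _ hxV (sec l V t), ?_⟩
    rw [stalkMap_germ, ← sec_comp, hl, ht, germ_res]

/-- A complex of sheaves of modules with exact stalks is short exact. -/
lemma shortExact_of_stalkMap {S : ShortComplex C.X.Modules}
    (h₁ : ∀ x, Function.Injective (stalkMap S.f x))
    (h₂ : ∀ x, LinearMap.ker (stalkMap S.g x) ≤ LinearMap.range (stalkMap S.f x))
    (h₃ : ∀ x, Function.Surjective (stalkMap S.g x)) : S.ShortExact := by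
  have := mono_of_stalkMap_injective S.f h₁
  have := epi_of_stalkMap_surjective S.g h₃
  have lift : ∀ {Z : C.X.Modules} (k : Z ⟶ S.X₂), k ≫ S.g = 0 → ∃ l, l ≫ S.f = k := by
    intro Z k hk
    refine exists_lift_of_stalkMap S.f k fun x p ↦ h₂ x ?_
    rw [LinearMap.mem_ker, ← stalkMap_comp, hk, stalkMap_zero]
  refine { exact := S.exact_of_f_is_kernel (KernelFork.IsLimit.ofι' S.f S.zero fun k hk ↦
    ⟨(lift k hk).choose, (lift k hk).choose_spec⟩) }

lemma shortExact_cokernel {G M : C.X.Modules} (i : G ⟶ M) [Mono i] :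
    (ShortComplex.mk i (cokernel.π i) (cokernel.condition i)).ShortExact where
  exact := ShortComplex.exact_cokernel i

end SmoothProjectiveCurve

/-! ### Free sheaves of modules -/

namespace AlgebraicGeometry.Scheme

/-- The structure sheaf as a sheaf of modules. -/
abbrev unitModule (Y : Scheme.{0}) : Y.Modules := SheafOfModules.unit Y.ringCatSheaf

/-- The free sheaf of modules of rank `n`. -/
abbrev freeModule (Y : Scheme.{0}) (n : ℕ) : Y.Modules :=
  SheafOfModules.free (R := Y.ringCatSheaf) (Fin n)

variable (Y : Scheme.{0}) {n : ℕ}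

/-- The inclusion of a summand of a free sheaf of modules. -/
def freeι (i : Fin n) : Y.unitModule ⟶ Y.freeModule n :=
  SheafOfModules.ιFree (R := Y.ringCatSheaf) i

variable {Y} in
/-- A morphism from a free sheaf of modules. -/
def freeDesc {M : Y.Modules} (f : Fin n → (Y.unitModule ⟶ M)) : Y.freeModule n ⟶ M :=
  Cofan.IsColimit.desc (SheafOfModules.isColimitFreeCofan (R := Y.ringCatSheaf) (Fin n)) f

variable {Y} in
lemma freeι_freeDesc {M : Y.Modules} (f : Fin n → (Y.unitModule ⟶ M)) (i : Fin n) :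
    Y.freeι i ≫ freeDesc f = f i :=
  Cofan.IsColimit.fac (SheafOfModules.isColimitFreeCofan (R := Y.ringCatSheaf) (Fin n)) f i

variable {Y} in
lemma free_hom_ext {M : Y.Modules} {f g : Y.freeModule n ⟶ M}
    (h : ∀ i, Y.freeι i ≫ f = Y.freeι i ≫ g) : f = g :=
  Cofan.IsColimit.hom_ext (SheafOfModules.isColimitFreeCofan (R := Y.ringCatSheaf) (Fin n)) _ _ h

/-- The projection to a summand of a free sheaf of modules. -/
def freeπ (i : Fin n) : Y.freeModule n ⟶ Y.unitModule :=
  freeDesc fun j ↦ if j = i then 𝟙 _ else 0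

lemma freeι_freeπ (i j : Fin n) : Y.freeι i ≫ Y.freeπ j = if i = j then 𝟙 _ else 0 :=
  freeι_freeDesc _ _

lemma sum_freeπ_freeι : ∑ i : Fin n, Y.freeπ i ≫ Y.freeι i = 𝟙 (Y.freeModule n) := by
  refine free_hom_ext fun j ↦ ?_
  simp only [Preadditive.comp_sum, ← Category.assoc, freeι_freeπ, Category.comp_id]
  rw [Finset.sum_eq_single j]
  · simp
  · intro i _ hij
    simp [hij.symm]
  · simp

lemma sum_app {M N : Y.Modules} {ι : Type*} (s : Finset ι) (f : ι → (M ⟶ N)) (U : Y.Opens)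
    (m : Γ(M, U)) : (∑ i ∈ s, f i).app U m = ∑ i ∈ s, (f i).app U m := by
  classical
  induction s using Finset.induction_on with
  | empty => simp
  | insert a s ha ih =>
    rw [Finset.sum_insert ha, Finset.sum_insert ha, ← ih]
    rfl

/-- The sections of a free sheaf of modules. -/
lemma exists_eq_sum_freeι (U : Y.Opens) (m : Γ(Y.freeModule n, U)) :
    ∃ a : Fin n → Γ(Y.unitModule, U), m = ∑ i, (Y.freeι i).app U (a i) := by
  refine ⟨fun i ↦ (Y.freeπ i).app U m, ?_⟩
  have := Y.sum_app Finset.univ (fun i : Fin n ↦ Y.freeπ i ≫ Y.freeι i) U m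
  rw [sum_freeπ_freeι] at this
  exact this

lemma sum_freeι_injective (U : Y.Opens) (a : Fin n → Γ(Y.unitModule, U))
    (h : ∑ i, (Y.freeι i).app U (a i) = 0) : a = 0 := by
  funext j
  have h2 := congrArg ((Y.freeπ j).app U) h
  rw [map_sum, map_zero] at h2
  have key : ∀ i, (Y.freeπ j).app U ((Y.freeι i).app U (a i)) = if i = j then a i else 0 := by
    intro i
    have : (Y.freeπ j).app U ((Y.freeι i).app U (a i)) = (Y.freeι i ≫ Y.freeπ j).app U (a i) := rfl
    rw [this, freeι_freeπ]
    split_ifs <;> rfl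
  simpa [key] using h2

lemma freeι_app_eq_smul (i : Fin n) (W : Y.Opens) (a : Γ(Y, W)) :
    (Y.freeι i).app W a = a • (Y.freeModule n).presheaf.map (homOfLE le_top : W ⟶ ⊤).op
      ((Y.freeι i).app ⊤ (1 : Γ(Y, ⊤))) := by
  have h2 : (Y.freeModule n).presheaf.map (homOfLE le_top : W ⟶ ⊤).op
      ((Y.freeι i).app ⊤ (1 : Γ(Y, ⊤))) = (Y.freeι i).app W (1 : Γ(Y, W)) :=
    congr($((Y.freeι i).mapPresheaf.naturality (homOfLE le_top : W ⟶ ⊤).op)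
      (1 : Γ(Y, ⊤))).symm.trans (congrArg ((Y.freeι i).app W)
        (map_one (Y.presheaf.map (homOfLE le_top : W ⟶ ⊤).op).hom))
  have h3 : (Y.freeι i).app W (a • (show Γ(Y.unitModule, W) from (1 : Γ(Y, W)))) =
      a • (Y.freeι i).app W (1 : Γ(Y, W)) := Modules.Hom.app_smul ..
  rw [h2, ← h3]
  exact congrArg _ (mul_one (show Γ(Y, W) from a)).symm

/-- The morphism from the structure sheaf given by a global section. -/
lemma exists_unit_hom {M : Y.Modules} (s : Γ(M, ⊤)) :
    ∃ f : Y.unitModule ⟶ M, ∀ (U : Y.Opens) (a : Γ(Y, U)),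
      f.app U a = a • M.presheaf.map (homOfLE le_top : U ⟶ ⊤).op s := by
  let t : SheafOfModules.sections (R := Y.ringCatSheaf) M :=
    PresheafOfModules.sectionsMk (M := M.val)
      (fun U ↦ (M.presheaf.map (homOfLE le_top : U.unop ⟶ ⊤).op s : Γ(M, U.unop)))
      (fun U V f ↦ by
        change (M.presheaf.map _ ≫ M.presheaf.map f) s = _
        rw [← Functor.map_comp]
        rfl)
  refine ⟨(SheafOfModules.unitHomEquiv (R := Y.ringCatSheaf) M).symm t, fun U a ↦ ?_⟩
  have h1 : ((SheafOfModules.unitHomEquiv (R := Y.ringCatSheaf) M).symm t).val.app (op U)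
      (1 : Γ(Y, U)) = t.1 (op U) := by
    refine (SheafOfModules.unitHomEquiv_apply_coe (R := Y.ringCatSheaf) M _ (op U)).symm.trans ?_
    rw [Equiv.apply_symm_apply]
  have h2 := Modules.Hom.app_smul ((SheafOfModules.unitHomEquiv (R := Y.ringCatSheaf) M).symm t) a
    (show Γ(Y.unitModule, U) from (1 : Γ(Y, U)))
  have h3 : a • (show Γ(Y.unitModule, U) from (1 : Γ(Y, U))) = a := mul_one a
  rw [h3] at h2
  exact h2.trans (congrArg (a • ·) h1)

end AlgebraicGeometry.Scheme

namespace SmoothProjectiveCurve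

variable {C : SmoothProjectiveCurve}

/-! ### Frames -/

lemma genericPoint_mem {U : C.X.Opens} {x : C.X} (hx : x ∈ U) : genericPoint C.X ∈ U :=
  ((genericPoint_spec C.X).mem_open_set_iff U.isOpen).mpr ⟨x, trivial, hx⟩

/-- The specialization map to the generic stalk, as a semilinear map. -/
def toGen (M : C.X.Modules) (x : C.X) :
    ↑(TopCat.Presheaf.stalk M.presheaf x) →ₛₗ[algebraMap (C.X.presheaf.stalk x) C.X.functionField]
      ↑(TopCat.Presheaf.stalk M.presheaf (genericPoint C.X)) where
  toFun := toGenericStalk M x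
  map_add' := map_add
    (M.presheaf.stalkSpecializes ((genericPoint_spec C.X).specializes trivial)).hom
  map_smul' a m := by
    obtain ⟨U, hx, s, rfl⟩ := exists_germ_eq M m
    obtain ⟨V, hxV, b, rfl⟩ := exists_ringGerm_eq a
    have hW : x ∈ U ⊓ V := ⟨hx, hxV⟩
    have key : ∀ (W : C.X.Opens) (hxW : x ∈ W) (t : Γ(M, W)),
        toGenericStalk M x (germ M hxW t) = germ M (genericPoint_mem hxW) t := fun W hxW t ↦
      congr($(TopCat.Presheaf.germ_stalkSpecializes M.presheaf hxW
        ((genericPoint_spec C.X).specializes trivial)) t)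
    have key2 : ∀ (W : C.X.Opens) (hxW : x ∈ W) (t : Γ(C.X, W)),
        algebraMap (C.X.presheaf.stalk x) C.X.functionField (ringGerm hxW t) =
          ringGerm (genericPoint_mem hxW) t := fun W hxW t ↦
      congr($(TopCat.Presheaf.germ_stalkSpecializes C.X.presheaf hxW
        ((genericPoint_spec C.X).specializes trivial)) t)
    rw [← germ_res M inf_le_left hW, ← ringGerm_res inf_le_right hW, ← germ_smul, key, key, key2,
      germ_smul]

lemma toGen_germ (M : C.X.Modules) {U : C.X.Opens} {x : C.X} (hx : x ∈ U) (s : Γ(M, U)) :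
    toGen M x (germ M hx s) = germ M (genericPoint_mem hx) s :=
  congr($(TopCat.Presheaf.germ_stalkSpecializes M.presheaf hx
        ((genericPoint_spec C.X).specializes trivial)) s)

lemma stalkMap_toGen {M N : C.X.Modules} (φ : M ⟶ N) (x : C.X)
    (m : ↑(TopCat.Presheaf.stalk M.presheaf x)) :
    stalkMap φ _ (toGen M x m) = toGen N x (stalkMap φ x m) := by
  obtain ⟨U, hx, s, rfl⟩ := exists_germ_eq M m
  rw [toGen_germ, stalkMap_germ, stalkMap_germ, toGen_germ]

/-- Sections form a frame of `M` over `U` if their germs at the points of `U` form bases. -/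
def IsFrame (M : C.X.Modules) {ι : Type*} {U : C.X.Opens} (s : ι → Γ(M, U)) : Prop :=
  ∀ (y : C.X) (hy : y ∈ U), LinearIndependent (C.X.presheaf.stalk y) (fun i ↦ germ M hy (s i)) ∧
    Submodule.span (C.X.presheaf.stalk y) (Set.range fun i ↦ germ M hy (s i)) = ⊤

/-- The basis of the stalk given by a frame. -/
def IsFrame.basis {M : C.X.Modules} {ι : Type*} {U : C.X.Opens} {s : ι → Γ(M, U)}
    (hs : IsFrame M s) {y : C.X} (hy : y ∈ U) :
    Module.Basis ι (C.X.presheaf.stalk y) ↑(TopCat.Presheaf.stalk M.presheaf y) :=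
  .mk (hs y hy).1 (hs y hy).2.ge

lemma IsFrame.basis_apply {M : C.X.Modules} {ι : Type*} {U : C.X.Opens} {s : ι → Γ(M, U)}
    (hs : IsFrame M s) {y : C.X} (hy : y ∈ U) (i : ι) : hs.basis hy i = germ M hy (s i) :=
  Module.Basis.mk_apply ..

lemma IsFrame.res {M : C.X.Modules} {ι : Type*} {U V : C.X.Opens} {s : ι → Γ(M, U)}
    (hs : IsFrame M s) (h : V ≤ U) : IsFrame M fun i ↦ res M h (s i) := by
  intro y hy
  simp only [germ_res]
  exact hs y (h hy)

lemma IsFrame.reindex {M : C.X.Modules} {ι κ : Type*} {U : C.X.Opens} {s : ι → Γ(M, U)}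
    (hs : IsFrame M s) (e : κ ≃ ι) : IsFrame M fun i ↦ s (e i) := by
  intro y hy
  refine ⟨(hs y hy).1.comp e e.injective, ?_⟩
  rw [← (hs y hy).2]
  congr 1
  exact e.surjective.range_comp fun i ↦ germ M hy (s i)

lemma ring_ext {U : C.X.Opens} (a b : Γ(C.X, U))
    (h : ∀ (x : C.X) (hx : x ∈ U), ringGerm hx a = ringGerm hx b) : a = b :=
  TopCat.Presheaf.section_ext C.X.sheaf U a b h

lemma germ_sum_smul (M : C.X.Modules) {ι : Type*} [Fintype ι] {U : C.X.Opens} (s : ι → Γ(M, U))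
    (a : ι → Γ(C.X, U)) {y : C.X} (hy : y ∈ U) :
    germ M hy (∑ i, a i • s i) = ∑ i, ringGerm hy (a i) • germ M hy (s i) := by
  simp only [map_sum, germ_smul]

lemma IsFrame.eq_zero {M : C.X.Modules} {ι : Type*} [Fintype ι] {U : C.X.Opens} {s : ι → Γ(M, U)}
    (hs : IsFrame M s) (a : ι → Γ(C.X, U)) (h : ∑ i, a i • s i = 0) : a = 0 := by
  funext i
  refine ring_ext _ _ fun y hy ↦ ?_
  have h2 := congrArg (germ M hy) h
  rw [germ_sum_smul, map_zero] at h2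
  rw [Fintype.linearIndependent_iff.mp (hs y hy).1 _ h2 i]
  exact (map_zero (ringGerm hy)).symm

/-- Finitely many germs of functions come from functions on a common neighbourhood. -/
lemma exists_ringGerm_eq_of_finite {κ : Type*} [Finite κ] {U : C.X.Opens} {x : C.X} (hx : x ∈ U)
    (a : κ → C.X.presheaf.stalk x) :
    ∃ (V : C.X.Opens) (_ : V ≤ U) (hV : x ∈ V) (b : κ → Γ(C.X, V)),
      ∀ k, ringGerm hV (b k) = a k := by
  cases nonempty_fintype κ
  choose W hW s hs using fun k ↦ exists_ringGerm_eq (a k)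
  let V : C.X.Opens := ⟨U ∩ ⋂ k, W k, U.isOpen.inter (isOpen_iInter_of_finite fun k ↦ (W k).isOpen)⟩
  have hVW : ∀ k, V ≤ W k := fun k y hy ↦ Set.mem_iInter.mp hy.2 k
  have hxV : x ∈ V := ⟨hx, Set.mem_iInter.mpr hW⟩
  refine ⟨V, fun y hy ↦ hy.1, hxV, fun k ↦ ringRes (hVW k) (s k), fun k ↦ ?_⟩
  rw [ringGerm_res, hs]

/-- Coefficients exist on germs and spread out to neighbourhoods; uniqueness on overlaps
(`IsFrame.eq_zero`) lets them glue. -/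
lemma IsFrame.exists_coeff {M : C.X.Modules} {ι : Type*} [Fintype ι] {U : C.X.Opens}
    {s : ι → Γ(M, U)} (hs : IsFrame M s) (m : Γ(M, U)) :
    ∃ a : ι → Γ(C.X, U), m = ∑ i, a i • s i := by
  have loc : ∀ x : U, ∃ (V : C.X.Opens) (hVU : V ≤ U) (_ : x.1 ∈ V) (b : ι → Γ(C.X, V)),
      SmoothProjectiveCurve.res M hVU m = ∑ i, b i • SmoothProjectiveCurve.res M hVU (s i) := by
    rintro ⟨x, hx⟩
    obtain ⟨V, hVU, hV, b, hb⟩ := exists_ringGerm_eq_of_finite hx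
      (fun i ↦ (hs.basis hx).repr (germ M hx m) i)
    have h0 : germ M hV (SmoothProjectiveCurve.res M hVU m -
        ∑ i, b i • SmoothProjectiveCurve.res M hVU (s i)) = 0 := by
      rw [map_sub, germ_sum_smul, sub_eq_zero]
      simp only [germ_res, hb, ← hs.basis_apply hx]
      exact ((hs.basis hx).sum_repr _).symm
    obtain ⟨W, hxW, hWV, h⟩ := exists_res_eq_zero M hV _ h0
    refine ⟨W, hWV.trans hVU, hxW, fun i ↦ ringRes hWV (b i), ?_⟩
    rw [map_sub, sub_eq_zero, map_sum] at h
    simp only [res_smul] at h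
    refine sec_ext _ _ _ fun y hy ↦ ?_
    have := congrArg (germ M hy) h
    rw [map_sum] at this ⊢
    simpa only [germ_smul, germ_res] using this
  choose V hVU hxV b hb using loc
  have cover : U ≤ iSup V := fun x hx ↦ Opens.mem_iSup.mpr ⟨⟨x, hx⟩, hxV _⟩
  have glue : ∀ i, ∃ a : Γ(C.X, U), ∀ x, ringRes (hVU x) a = b x i := by
    intro i
    have hcomp : TopCat.Presheaf.IsCompatible C.X.sheaf.1 V (fun x ↦ b x i) := by
      intro x y
      have : (fun i ↦ ringRes (inf_le_left : V x ⊓ V y ≤ _) (b x i) -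
          ringRes (inf_le_right : V x ⊓ V y ≤ _) (b y i)) = 0 := by
        refine (hs.res (inf_le_left.trans (hVU x) : V x ⊓ V y ≤ U)).eq_zero _ ?_
        refine sec_ext _ _ _ fun z hz ↦ ?_
        rw [germ_sum_smul, map_zero]
        simp only [map_sub, germ_res, ringGerm_res, sub_smul, Finset.sum_sub_distrib]
        have h1 := congrArg (germ M hz.1) (hb x)
        have h2 := congrArg (germ M hz.2) (hb y)
        rw [germ_sum_smul] at h1 h2
        simp only [germ_res] at h1 h2
        rw [← h1, ← h2, sub_self]
      exact sub_eq_zero.mp (congrFun this i)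
    obtain ⟨a, ha, -⟩ := C.X.sheaf.existsUnique_gluing' V U (fun x ↦ homOfLE (hVU x)) cover _ hcomp
    exact ⟨a, ha⟩
  choose a ha using glue
  refine ⟨a, sec_ext _ _ _ fun y hy ↦ ?_⟩
  have := congrArg (germ M (hxV ⟨y, hy⟩)) (hb ⟨y, hy⟩)
  rw [germ_sum_smul] at this ⊢
  simp only [germ_res, ← ha, ringGerm_res] at this
  exact this

/-- A basis of the stalk at a point of a vector bundle extends to a frame. -/
lemma IsFrame.exists_of_basis {M : C.X.Modules} {κ ι : Type*} [Finite κ] [Fintype ι]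
    {U : C.X.Opens} {s : κ → Γ(M, U)} (hs : IsFrame M s) {x : C.X} (hx : x ∈ U)
    (c : Module.Basis ι (C.X.presheaf.stalk x) ↑(TopCat.Presheaf.stalk M.presheaf x)) :
    ∃ (V : C.X.Opens) (_ : V ≤ U) (hV : x ∈ V) (t : ι → Γ(M, V)), IsFrame M t ∧
      ∀ i, germ M hV (t i) = c i := by
  classical
  let e : ι ≃ κ := c.indexEquiv (hs.basis hx)
  have hs' := hs.reindex e
  obtain ⟨V, hVU, hV, A, hA⟩ := exists_ringGerm_eq_of_finite hx
    fun k : ι × ι ↦ (hs'.basis hx).toMatrix c k.1 k.2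
  let B : Matrix ι ι Γ(C.X, V) := Matrix.of fun i j ↦ A (i, j)
  let t : ι → Γ(M, V) := fun j ↦ ∑ i, A (i, j) • SmoothProjectiveCurve.res M hVU (s (e i))
  have ht : ∀ j (y : C.X) (hy : y ∈ V), germ M hy (t j) =
      ∑ i, ringGerm hy (A (i, j)) • hs'.basis (hVU hy) i := by
    intro j y hy
    simp only [t, germ_sum_smul, germ_res, hs'.basis_apply]
  have hBx : ∀ (y : C.X) (hy : y ∈ V), (hs'.basis (hVU hy)).det (fun j ↦ germ M hy (t j)) =
      ringGerm hy B.det := by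
    intro y hy
    rw [RingHom.map_det, Module.Basis.det_apply]
    congr 1
    ext i j
    rw [Module.Basis.toMatrix_apply, ht, map_sum]
    simp [Finsupp.single_apply, B]
  have htx : ∀ j, germ M hV (t j) = c j := by
    intro j
    rw [ht]
    simp only [hA, Module.Basis.toMatrix_apply]
    exact (hs'.basis hx).sum_repr (c j)
  -- The transition determinant is a unit at `x`. On the open set where it stays a unit, the
  -- sections form a basis at every point.
  have hx2 : x ∈ C.X.basicOpen B.det := by
    rw [Scheme.mem_basicOpen _ _ _ hV]
    change IsUnit (ringGerm hV B.det)
    rw [← hBx, funext htx]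
    exact (hs'.basis hx).isUnit_det c
  refine ⟨C.X.basicOpen B.det, (C.X.basicOpen_le _).trans hVU, hx2,
    fun j ↦ SmoothProjectiveCurve.res M (C.X.basicOpen_le _) (t j), ?_, fun j ↦ ?_⟩
  · intro y hy
    simp only [germ_res]
    rw [Module.Basis.is_basis_iff_det (hs'.basis (hVU (C.X.basicOpen_le _ hy))), hBx]
    exact (Scheme.mem_basicOpen _ _ _ (C.X.basicOpen_le _ hy)).mp hy
  · rw [germ_res, htx]

/-! ### Vector bundles and frames -/

lemma smul_restrict (M : C.X.Modules) (U : C.X.Opens) (W : (U : Scheme.{0}).Opens)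
    (a : Γ(C.X, U.ι ''ᵁ W)) (m : Γ(M.restrict U.ι, W)) :
    (show Γ((U : Scheme.{0}), W) from a) • m = (a • (show Γ(M, U.ι ''ᵁ W) from m) :) := by
  have h := Scheme.Modules.smul_restrictAppIso_hom_apply (f := U.ι) M W a m
  rw [Scheme.Opens.ι_appIso] at h
  exact h

/-- The frame is the image of the standard basis under a trivialisation. Germs are represented by
sections over small open subsets, where the trivialisation is bijective on sections; no comparison
of stalks of `M` with stalks of its restriction is needed. -/
lemma IsVectorBundle.exists_frame {M : C.X.Modules} (hM : IsVectorBundle M) (x : C.X) :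
    ∃ (U : C.X.Opens) (_ : x ∈ U) (n : ℕ) (s : Fin n → Γ(M, U)), IsFrame M s := by
  obtain ⟨U, hx, n, ⟨e⟩⟩ := hM x
  let Y : Scheme.{0} := U
  let e' : Y.freeModule n ≅ M.restrict U.ι := e.symm
  let s : Fin n → Γ(M, U.ι ''ᵁ ⊤) := fun i ↦
    (e'.hom.app ⊤) ((Y.freeι i).app ⊤ (1 : Γ(Y, ⊤)))
  have main : ∀ (W : Y.Opens) (a : Fin n → Γ(C.X, U.ι ''ᵁ W)),
      (e'.hom.app W (∑ i, (Y.freeι i).app W (show Γ(Y, W) from a i)) : Γ(M, U.ι ''ᵁ W)) =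
        ∑ i, a i • res M (U.ι.image_mono le_top) (s i) := by
    intro W a
    rw [map_sum]
    refine Finset.sum_congr rfl fun i _ ↦ ?_
    rw [Y.freeι_app_eq_smul, Scheme.Modules.Hom.app_smul, smul_restrict]
    congr 1
    exact congr($(e'.hom.mapPresheaf.naturality (homOfLE le_top : W ⟶ ⊤).op)
      ((Y.freeι i).app ⊤ (1 : Γ(Y, ⊤))))
  have small : ∀ (V : C.X.Opens) (y : C.X), y ∈ U.ι ''ᵁ ⊤ → y ∈ V →
      ∃ W : Y.Opens, U.ι ''ᵁ W ≤ V ∧ y ∈ U.ι ''ᵁ W := by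
    rintro V _ ⟨y, -, rfl⟩ hV
    exact ⟨U.ι ⁻¹ᵁ V, U.ι.image_preimage_le V, ⟨y, hV, rfl⟩⟩
  refine ⟨U.ι ''ᵁ ⊤, ?_, n, s, fun y hy ↦ ⟨?_, ?_⟩⟩
  · simpa using hx
  · rw [Fintype.linearIndependent_iff]
    intro g hg
    obtain ⟨V, hVU, hV, b, hb⟩ := exists_ringGerm_eq_of_finite hy g
    have h0 : germ M hV (∑ i, b i • res M hVU (s i)) = 0 := by
      rw [germ_sum_smul]
      simpa only [germ_res, hb] using hg
    obtain ⟨V', hV', hV'V, h⟩ := exists_res_eq_zero M hV _ h0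
    obtain ⟨W, hWV, hyW⟩ := small V' y hy hV'
    have h1 : ∑ i, ringRes (hWV.trans hV'V) (b i) •
        res M (U.ι.image_mono le_top : U.ι ''ᵁ W ≤ U.ι ''ᵁ ⊤) (s i) = 0 := by
      refine sec_ext _ _ _ fun z hz ↦ ?_
      have := congrArg (germ M (hWV hz)) h
      rw [germ_res, germ_sum_smul, map_zero] at this
      rw [germ_sum_smul, map_zero]
      simpa only [germ_res, ringGerm_res] using this
    rw [← main] at h1
    have h2 := (injective_iff_map_eq_zero (e'.hom.app W).hom).mp
      ((ConcreteCategory.bijective_of_isIso (e'.hom.app W)).1) _ h1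
    have h3 := Y.sum_freeι_injective W _ h2
    intro i
    rw [← hb, ← ringGerm_res (hWV.trans hV'V) hyW]
    exact (congrArg (ringGerm hyW) (congrFun h3 i)).trans (map_zero (ringGerm hyW))
  · rw [eq_top_iff]
    rintro m -
    obtain ⟨V, hV, m, rfl⟩ := exists_germ_eq M m
    obtain ⟨W, hWV, hyW⟩ := small V y hy hV
    obtain ⟨p, hp⟩ := (ConcreteCategory.bijective_of_isIso (e'.hom.app W)).2
      (show Γ(M.restrict U.ι, W) from res M hWV m)
    obtain ⟨a, rfl⟩ : ∃ a : Fin n → Γ(C.X, U.ι ''ᵁ W),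
        p = ∑ i, (Y.freeι i).app W (show Γ(Y, W) from a i) := Y.exists_eq_sum_freeι W p
    have h := (main W a).symm.trans hp
    rw [← germ_res M hWV hyW]
    refine mem_of_eq_of_mem (congrArg (germ M hyW) h.symm) ?_
    rw [germ_sum_smul]
    refine Submodule.sum_mem _ fun i _ ↦ Submodule.smul_mem _ _ (Submodule.subset_span ⟨i, ?_⟩)
    simp only [germ_res]

/-- A frame defines a map from a free sheaf; `IsFrame.eq_zero` and `IsFrame.exists_coeff` make it
bijective on sections over every open subset. -/
lemma isVectorBundle_of_exists_frame {M : C.X.Modules}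
    (h : ∀ x : C.X, ∃ (U : C.X.Opens) (_ : x ∈ U) (n : ℕ) (s : Fin n → Γ(M, U)), IsFrame M s) :
    IsVectorBundle M := by
  intro x
  obtain ⟨U, hx, n, s, hs⟩ := h x
  refine ⟨U, hx, n, ⟨?_⟩⟩
  let Y : Scheme.{0} := U
  have hUtop : U.ι ''ᵁ ⊤ ≤ U := by simp
  choose f hf using fun i ↦ Scheme.exists_unit_hom (Y := Y) (M := M.restrict U.ι)
    (show Γ(M.restrict U.ι, ⊤) from res M hUtop (s i))
  have : IsIso (Scheme.freeDesc f) := by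
    rw [Scheme.Modules.Hom.isIso_iff_isIso_app]
    intro W
    have hWU : U.ι ''ᵁ W ≤ U := (U.ι.image_mono le_top).trans hUtop
    have key : ∀ a : Fin n → Γ(C.X, U.ι ''ᵁ W),
        ((Scheme.freeDesc f).app W (∑ i, (Y.freeι i).app W (show Γ(Y, W) from a i)) :
          Γ(M, U.ι ''ᵁ W)) = ∑ i, a i • res M hWU (s i) := by
      intro a
      rw [map_sum]
      refine Finset.sum_congr rfl fun i _ ↦ ?_
      have h1 : (Scheme.freeDesc f).app W ((Y.freeι i).app W (show Γ(Y, W) from a i)) =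
          (f i).app W (show Γ(Y, W) from a i) := by
        rw [← Scheme.freeι_freeDesc f i]; rfl
      rw [h1, hf, smul_restrict]
      congr 1
      refine sec_ext M _ _ fun z hz ↦ ?_
      rw [germ_res]
      exact (germ_res M (U.ι.image_mono le_top : U.ι ''ᵁ W ≤ U.ι ''ᵁ ⊤) hz _).trans
        (germ_res M hUtop _ _)
    rw [ConcreteCategory.isIso_iff_bijective]
    constructor
    · refine (injective_iff_map_eq_zero ((Scheme.freeDesc f).app W).hom).mpr fun p hp ↦ ?_
      obtain ⟨a, rfl⟩ := Y.exists_eq_sum_freeι W p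
      have h0 := (hs.res hWU).eq_zero a ((key a).symm.trans hp)
      rw [h0]
      refine Finset.sum_eq_zero fun i _ ↦ map_zero ((Y.freeι i).app W).hom
    · intro m
      obtain ⟨a, ha⟩ := (hs.res hWU).exists_coeff (show Γ(M, U.ι ''ᵁ W) from m)
      exact ⟨_, (key a).trans ha.symm⟩
  exact (asIso (Scheme.freeDesc f)).symm

end SmoothProjectiveCurve

/-! ### Local algebra -/

/-- Differentials commute with localisation: a multiple of each one comes from `A`, and the
multiplier is a unit of `B`. -/
lemma KaehlerDifferential.exists_span_eq_top_of_isLocalization (k A B : Type*) [CommRing k]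
    [CommRing A] [CommRing B] [Algebra k A] [Algebra k B] [Algebra A B] [IsScalarTower k A B]
    (S : Submonoid A) [IsLocalization S B] {ω : Ω[A⁄k]} (hω : Submodule.span A {ω} = ⊤) :
    Submodule.span B {KaehlerDifferential.map k k A B ω} = ⊤ := by
  rw [eq_top_iff]
  rintro z -
  obtain ⟨⟨w, s⟩, hw⟩ := IsLocalizedModule.surj S (KaehlerDifferential.map k k A B) z
  obtain ⟨a, rfl⟩ := Submodule.mem_span_singleton.mp (hω.ge (Submodule.mem_top (x := w)))
  obtain ⟨u, hu⟩ := IsLocalization.map_units B s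
  have h1 : algebraMap A B s • z = algebraMap A B a • KaehlerDifferential.map k k A B ω := by
    rw [algebraMap_smul, algebraMap_smul]
    simpa [Submonoid.smul_def] using hw
  refine Submodule.mem_span_singleton.mpr ⟨↑u⁻¹ * algebraMap A B a, ?_⟩
  rw [mul_smul, ← h1, ← hu, smul_smul, Units.inv_mul, one_smul]

/-- If `R` is a local `k`-algebra with residue field `k` and cyclic module of differentials, then
the cotangent space has dimension at most one. -/
lemma IsLocalRing.finrank_cotangentSpace_le_one (k R : Type*) [Field k] [CommRing R] [IsLocalRing R]
    [Algebra k R] (σ : R →+* k) (hσ : ∀ c, σ (algebraMap k R c) = c) {ω : Ω[R⁄k]}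
    (hω : Submodule.span R {ω} = ⊤) :
    Module.finrank (IsLocalRing.ResidueField R) (IsLocalRing.CotangentSpace R) ≤ 1 := by
  have hker : ∀ a, a - algebraMap k R (σ a) ∈ IsLocalRing.maximalIdeal R := by
    intro a
    rw [IsLocalRing.mem_maximalIdeal, mem_nonunits_iff]
    intro h
    have := h.map σ
    rw [map_sub, hσ, sub_self] at this
    exact not_isUnit_zero this
  have hσm : ∀ a ∈ IsLocalRing.maximalIdeal R, σ a = 0 := by
    intro a ha
    by_contra h
    have h1 := (IsLocalRing.maximalIdeal R).sub_mem ha (hker a)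
    rw [sub_sub_cancel] at h1
    exact (IsLocalRing.mem_maximalIdeal _).mp h1 ((IsUnit.mk0 _ h).map (algebraMap k R))
  let m := IsLocalRing.maximalIdeal R
  -- The map `a ↦ a - σ a` modulo `m²` is a derivation, because `(a - σ a)(b - σ b)` lies in `m²`.
  -- It is onto `m / m²`, which is therefore a quotient of the cyclic module of differentials.
  let δ : Derivation k R m.Cotangent :=
    { toFun := fun a ↦ m.toCotangent ⟨a - algebraMap k R (σ a), hker a⟩
      map_add' := fun a b ↦ by
        rw [← map_add]
        congr 1
        ext
        simp
        ring
      map_smul' := fun c a ↦ by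
        change m.toCotangent _ = c • m.toCotangent _
        rw [← algebraMap_smul R c (m.toCotangent _), ← map_smul]
        congr 1
        ext
        simp [Algebra.smul_def, hσ]
        ring
      map_one_eq_zero' := by
        change m.toCotangent _ = 0
        rw [Ideal.toCotangent_eq_zero]
        simp
      leibniz' := fun a b ↦ by
        change m.toCotangent _ = a • m.toCotangent _ + b • m.toCotangent _
        rw [← map_smul, ← map_smul, ← map_add, Ideal.toCotangent_eq]
        have := Ideal.mul_mem_mul (hker a) (hker b)
        rw [← pow_two] at this
        rw [← neg_mem_iff]
        convert this using 1
        simp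
        ring }
  have hsurj : Function.Surjective δ.liftKaehlerDifferential := by
    intro z
    obtain ⟨⟨a, ha⟩, rfl⟩ := m.toCotangent_surjective z
    refine ⟨KaehlerDifferential.D k R a, ?_⟩
    rw [Derivation.liftKaehlerDifferential_comp_D]
    change m.toCotangent _ = _
    congr 1
    ext
    simp [hσm a ha]
  refine finrank_le_one (δ.liftKaehlerDifferential ω : IsLocalRing.CotangentSpace R) fun z ↦ ?_
  obtain ⟨w, rfl⟩ := hsurj z
  obtain ⟨a, rfl⟩ := Submodule.mem_span_singleton.mp (hω.ge (Submodule.mem_top (x := w)))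
  exact ⟨IsLocalRing.residue R a, (map_smul δ.liftKaehlerDifferential a ω).symm⟩

open scoped IntermediateField.algebraAdjoinAdjoin in
/-- A finitely generated extension field in characteristic zero with cyclic module of differentials
is finite over the subfield generated by any transcendental element. -/
lemma finite_adjoin_of_transcendental (k K : Type*) [Field k] [CharZero k] [Field K] [Algebra k K]
    [Algebra.EssFiniteType k K] {ω : Ω[K⁄k]} (hω : Submodule.span K {ω} = ⊤) {f : K}
    (hf : Transcendental k f) : Module.Finite (IntermediateField.adjoin k {f}) K := by
  -- Any nonzero exact differential generates; if all exact differentials vanish the module is zero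
  -- and `t = 0` will do.
  obtain ⟨t, ht⟩ : ∃ t : K, Submodule.span K {KaehlerDifferential.D k K t} = ⊤ := by
    by_cases h : ∀ t : K, KaehlerDifferential.D k K t = 0
    · refine ⟨0, ?_⟩
      rw [← KaehlerDifferential.span_range_derivation]
      apply le_antisymm
      · rw [Submodule.span_le]; rintro _ rfl; simp
      · rw [Submodule.span_le]; rintro _ ⟨a, rfl⟩; simp [h a]
    · push Not at h
      obtain ⟨t, ht⟩ := h
      refine ⟨t, ?_⟩
      obtain ⟨a, ha⟩ := Submodule.mem_span_singleton.mp
        (hω.ge (Submodule.mem_top (x := KaehlerDifferential.D k K t)))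
      rw [← hω, ← ha]
      refine Submodule.span_singleton_smul_eq (IsUnit.mk0 a ?_) ω
      rintro rfl
      exact ht (by rw [← ha, zero_smul])
  -- Since `dt` generates and dies over `k(t)`, the extension `K / k(t)` is unramified, hence
  -- finite.
  have hfin : Module.Finite (IntermediateField.adjoin k {t}) K := by
    let L := IntermediateField.adjoin k {t}
    have : Algebra.EssFiniteType L K := .of_comp k L K
    have : Algebra.FormallyUnramified L K := by
      rw [Algebra.formallyUnramified_iff]
      refine ⟨fun x y ↦ ?_⟩
      have key : ∀ x : Ω[K⁄L], x = 0 := by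
        intro x
        obtain ⟨y, rfl⟩ := KaehlerDifferential.map_surjective k L K x
        obtain ⟨a, rfl⟩ := Submodule.mem_span_singleton.mp (ht.ge (Submodule.mem_top (x := y)))
        rw [map_smul, KaehlerDifferential.map_D]
        have : algebraMap K K t = algebraMap L K
            ⟨t, IntermediateField.mem_adjoin_simple_self k t⟩ := rfl
        rw [this, Derivation.map_algebraMap, smul_zero]
      rw [key x, key y]
    exact Algebra.FormallyUnramified.finite_of_free L K
  have halg : Algebra.IsAlgebraic (IntermediateField.adjoin k {t}) K := inferInstance
  -- Transcendence degree at most one makes `f` a transcendence basis too; in characteristic zero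
  -- the algebraic extension `K / k(f)` is separable, so unramified and finite.
  have htr : Algebra.trdeg k K ≤ 1 := by
    have : Algebra.IsAlgebraic (Algebra.adjoin k {t}) K :=
      .trans _ (IntermediateField.adjoin k {t}) _
    simpa using Algebra.IsAlgebraic.trdeg_le_cardinalMk k ({t} : Set K)
  have hind : AlgebraicIndependent k (fun _ : Unit ↦ f) :=
    algebraicIndependent_unique_type_iff.mpr hf
  have hb := hind.isTranscendenceBasis_of_lift_trdeg_le_of_finite (by simpa using htr)
  have halg' : Algebra.IsAlgebraic (IntermediateField.adjoin k {f}) K := by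
    have := hb.isAlgebraic_field
    rwa [Set.range_const] at this
  have : Algebra.EssFiniteType (IntermediateField.adjoin k {f}) K := .of_comp k _ K
  have : Algebra.FormallyUnramified (IntermediateField.adjoin k {f}) K :=
    (Algebra.FormallyUnramified.iff_isSeparable _ _).mpr inferInstance
  exact Algebra.FormallyUnramified.finite_of_free _ K

/-! ### Points and local rings of the curve. -/

namespace SmoothProjectiveCurve

variable (C : SmoothProjectiveCurve)

lemma fromSpecStalk_str (x : C.X) :
    C.X.fromSpecStalk x ≫ C.str =
      Spec.map (CommRingCat.ofHom (algebraMap ℂ (C.X.presheaf.stalk x))) := by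
  have h : C.str = C.X.toSpecΓ ≫ Spec.map C.str.appTop ≫
      Spec.map (Scheme.ΓSpecIso (CommRingCat.of ℂ)).inv := by
    rw [← Scheme.toSpecΓ_naturality_assoc, toSpecΓ_SpecMap_ΓSpecIso_inv, Category.comp_id]
  rw [h, Scheme.fromSpecStalk_toSpecΓ_assoc, ← Spec.map_comp, ← Spec.map_comp]
  rfl

/-- The value of a function at a closed point. -/
lemma exists_evaluation {x : C.X} (hx : IsClosed {x}) :
    ∃ σ : C.X.presheaf.stalk x →+* ℂ, ∀ c, σ (algebraMap ℂ _ c) = c := by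
  refine ⟨(C.X.residue x ≫ (residueFieldIsoBase C.str x hx).hom).hom, fun c ↦ ?_⟩
  have h : (residueFieldIsoBase C.str x hx).inv =
      CommRingCat.ofHom (algebraMap ℂ (C.X.presheaf.stalk x)) ≫ C.X.residue x := by
    apply Spec.map_injective
    rw [SpecMap_residueFieldIsoBase_inv, Spec.map_comp, ← fromSpecStalk_str]
    rfl
  have h2 := (residueFieldIsoBase C.str x hx).inv_hom_id
  rw [h] at h2
  exact congr($h2 c)

/-- An affine neighbourhood with standard smooth ring of functions. -/
lemma exists_standardSmooth (x : C.X) : ∃ (V : C.X.Opens) (_ : IsAffineOpen V) (_ : x ∈ V),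
    RingHom.IsStandardSmoothOfRelativeDimension 1
      ((Scheme.ΓSpecIso (CommRingCat.of ℂ)).inv ≫ C.str.appLE ⊤ V le_top).hom := by
  have := C.smooth
  obtain ⟨U, hU, V, hV, hx, e, hf⟩ :=
    SmoothOfRelativeDimension.exists_isStandardSmoothOfRelativeDimension (n := 1) (f := C.str) x
  -- The spectrum of `ℂ` has one point, so a nonempty open subset is everything.
  have hUtop : U = ⊤ := by
    rw [eq_top_iff]
    intro y _
    rw [Subsingleton.elim y (C.str x)]
    exact e hx
  subst hUtop
  refine ⟨V, hV, hx, ?_⟩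
  rw [CommRingCat.hom_comp]
  exact RingHom.isStandardSmoothOfRelativeDimension_respectsIso.2 _
    (Scheme.ΓSpecIso (CommRingCat.of ℂ)).symm.commRingCatIsoToRingEquiv hf

/-- On a standard smooth affine neighbourhood the differentials are free of rank one, and both
properties pass to the localisation at `x`. -/
lemma exists_local (x : C.X) : (∃ ω : Ω[C.X.presheaf.stalk x⁄ℂ],
      Submodule.span (C.X.presheaf.stalk x) {ω} = ⊤) ∧
      Algebra.EssFiniteType ℂ (C.X.presheaf.stalk x) := by
  obtain ⟨V, hV, hx, hf⟩ := C.exists_standardSmooth x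
  algebraize [((Scheme.ΓSpecIso (CommRingCat.of ℂ)).inv ≫ C.str.appLE ⊤ V le_top).hom]
  let : Algebra Γ(C.X, V) (C.X.presheaf.stalk x) := (C.X.presheaf.germ V x hx).hom.toAlgebra
  have : IsScalarTower ℂ Γ(C.X, V) (C.X.presheaf.stalk x) := by
    apply IsScalarTower.of_algebraMap_eq'
    change ((Scheme.ΓSpecIso (CommRingCat.of ℂ)).inv ≫ C.str.appTop ≫
      C.X.presheaf.germ ⊤ x trivial).hom = (((Scheme.ΓSpecIso (CommRingCat.of ℂ)).inv ≫
        C.str.appLE ⊤ V le_top) ≫ C.X.presheaf.germ V x hx).hom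
    have h : C.str.appLE ⊤ V le_top =
        C.str.appTop ≫ C.X.presheaf.map (homOfLE (le_top : V ≤ ⊤)).op := rfl
    rw [h, Category.assoc, Category.assoc, TopCat.Presheaf.germ_res]
  have hloc : IsLocalization.AtPrime (C.X.presheaf.stalk x)
    (hV.primeIdealOf ⟨x, hx⟩).asIdeal := hV.isLocalization_stalk ⟨x, hx⟩
  have : Nonempty V := ⟨⟨x, hx⟩⟩
  have hrank := Algebra.IsStandardSmoothOfRelativeDimension.rank_kaehlerDifferential
    (R := ℂ) (S := Γ(C.X, V)) 1
  have : Algebra.IsStandardSmooth ℂ Γ(C.X, V) :=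
    Algebra.IsStandardSmoothOfRelativeDimension.isStandardSmooth 1
  obtain ⟨ω, hω⟩ : ∃ ω : Ω[Γ(C.X, V)⁄ℂ], Submodule.span Γ(C.X, V) {ω} = ⊤ := by
    let b := Module.finBasisOfFinrankEq Γ(C.X, V) Ω[Γ(C.X, V)⁄ℂ] (n := 1)
      (by rw [Module.finrank, hrank]; simp)
    exact ⟨b 0, by rw [← b.span_eq]; congr 1; ext; simp [Fin.exists_fin_one, eq_comm]⟩
  exact ⟨⟨_, KaehlerDifferential.exists_span_eq_top_of_isLocalization ℂ Γ(C.X, V) _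
    (hV.primeIdealOf ⟨x, hx⟩).asIdeal.primeCompl hω⟩,
    .comp ℂ Γ(C.X, V) _ (h₂ := .of_isLocalization _ (hV.primeIdealOf ⟨x, hx⟩).asIdeal.primeCompl)⟩

instance : CompactSpace C.X := by
  refine ⟨?_⟩
  rw [← Set.preimage_univ (f := C.str)]
  exact QuasiCompact.isCompact_preimage _ isOpen_univ CompactSpace.isCompact_univ

/-- The residue field is `ℂ` and the differentials are cyclic, so the cotangent space is at most a
line; a noetherian local domain with this property is principal. -/
lemma isPrincipalIdealRing_stalk_of_isClosed {x : C.X} (hx : IsClosed {x}) :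
    IsPrincipalIdealRing (C.X.presheaf.stalk x) := by
  obtain ⟨σ, hσ⟩ := C.exists_evaluation hx
  obtain ⟨ω, hω⟩ := (C.exists_local x).1
  exact ((tfae_of_isNoetherianRing_of_isLocalRing_of_isDomain (C.X.presheaf.stalk x)).out 0 5).mpr
    (IsLocalRing.finrank_cotangentSpace_le_one ℂ _ σ hσ hω)

variable {C}

lemma eq_genericPoint_of_specializes {x : C.X} (h : x ⤳ genericPoint C.X) :
    x = genericPoint C.X :=
  (((genericPoint_spec C.X).specializes trivial).antisymm h).eq.symm

/-- Generisations of `y` are primes of its local ring, and a local principal ideal domain has only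
the zero and the maximal ideal. -/
lemma eq_genericPoint_or_eq_of_specializes {x y : C.X} (hy : IsClosed {y}) (h : x ⤳ y) :
    x = genericPoint C.X ∨ x = y := by
  have := C.isPrincipalIdealRing_stalk_of_isClosed hy
  have hx : x ∈ Set.range (C.X.fromSpecStalk y) := by rw [Scheme.range_fromSpecStalk]; exact h
  obtain ⟨q, rfl⟩ := hx
  by_cases hq : q.asIdeal = ⊥
  · left
    apply eq_genericPoint_of_specializes
    have hη : genericPoint C.X ∈ Set.range (C.X.fromSpecStalk y) := by
      rw [Scheme.range_fromSpecStalk]; exact (genericPoint_spec C.X).specializes trivial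
    obtain ⟨q', hq'⟩ := hη
    rw [← hq']
    refine Specializes.map ?_ (C.X.fromSpecStalk y).continuous
    exact (PrimeSpectrum.le_iff_specializes q q').mp (by
      change q.asIdeal ≤ q'.asIdeal
      rw [hq]; exact bot_le)
  · right
    have hmax : q.asIdeal.IsMaximal := Ideal.IsPrime.isMaximal q.2 hq
    have : q = IsLocalRing.closedPoint _ := PrimeSpectrum.ext (IsLocalRing.eq_maximalIdeal hmax)
    rw [this, Scheme.fromSpecStalk_closedPoint]

/-- By quasi-compactness the closure of `x` contains a closed point, of which `x` is a generisation.
-/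
lemma isClosed_singleton {x : C.X} (hx : x ≠ genericPoint C.X) : IsClosed {x} := by
  obtain ⟨y, hy, hyc⟩ := (isClosed_closure (s := {x})).exists_closed_singleton
    ⟨x, subset_closure rfl⟩
  rcases eq_genericPoint_or_eq_of_specializes hyc (specializes_iff_mem_closure.mpr hy) with h | rfl
  · exact absurd h hx
  · exact hyc

lemma isDiscreteValuationRing_stalk {x : C.X} (hx : x ≠ genericPoint C.X) :
    IsDiscreteValuationRing (C.X.presheaf.stalk x) := by
  have := C.isPrincipalIdealRing_stalk_of_isClosed (isClosed_singleton hx)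
  refine { not_a_field' := fun h ↦ hx ?_ }
  -- If the local ring were a field, its spectrum would be one point, and the generic point, which
  -- lies in its image, would be `x`.
  have hη : genericPoint C.X ∈ Set.range (C.X.fromSpecStalk x) := by
    rw [Scheme.range_fromSpecStalk]; exact (genericPoint_spec C.X).specializes trivial
  obtain ⟨q, hq⟩ := hη
  have : q = IsLocalRing.closedPoint _ := by
    apply PrimeSpectrum.ext
    change q.asIdeal = IsLocalRing.maximalIdeal _
    rw [h]
    exact le_bot_iff.mp (h ▸ IsLocalRing.le_maximalIdeal q.2.ne_top)
  rw [← hq, this, Scheme.fromSpecStalk_closedPoint]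

instance (x : C.X) : IsPrincipalIdealRing (C.X.presheaf.stalk x) := by
  by_cases hx : x = genericPoint C.X
  · subst hx
    have : IsPrincipalIdealRing C.X.functionField := inferInstance
    exact this
  · have := isDiscreteValuationRing_stalk hx
    infer_instance

/-- `Scheme.ord` is zero except at points of coheight one, so this is what makes it compute orders
at closed points. -/
lemma coheight_eq_one {x : C.X} (hx : x ≠ genericPoint C.X) : Order.coheight x = 1 := by
  have := isDiscreteValuationRing_stalk hx
  have h := ringKrullDim_stalk_eq_coheight x
  rw [IsPrincipalIdealRing.ringKrullDim_eq_one _ (IsDiscreteValuationRing.not_isField _)] at h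
  exact_mod_cast h.symm

lemma coheight_genericPoint : Order.coheight (genericPoint C.X) = 0 := by
  have h := ringKrullDim_stalk_eq_coheight (genericPoint C.X)
  have : ringKrullDim C.X.functionField = 0 := ringKrullDim_eq_zero_of_field _
  rw [this] at h
  exact_mod_cast h.symm

lemma ord_genericPoint (f : C.X.functionField) : Scheme.ord f (genericPoint C.X) = 0 :=
  Scheme.ord_eq_zero_of_coheight_neq_one (by rw [coheight_genericPoint]; simp) f

lemma finite_adjoin_functionField {f : C.X.functionField} (hf : Transcendental ℂ f) :
    Module.Finite (IntermediateField.adjoin ℂ {f}) C.X.functionField := by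
  obtain ⟨⟨ω, hω⟩, h⟩ := C.exists_local (genericPoint C.X)
  exact finite_adjoin_of_transcendental ℂ C.X.functionField hω hf

end SmoothProjectiveCurve

/-! ### The polynomial ring `k[f]` inside `K` and its integral closure. -/

open scoped IntermediateField.algebraAdjoinAdjoin

lemma finrank_eq_one_of_bijective {R B : Type*} [CommRing R] [Nontrivial R] [CommRing B]
    [Algebra R B] (h : Function.Bijective (algebraMap R B)) : Module.finrank R B = 1 :=
  (LinearEquiv.ofBijective (Algebra.linearMap R B) h).finrank_eq.symm.trans (Module.finrank_self R)

section Adjoin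

variable {k K : Type*} [Field k] [Field K] [Algebra k K]

instance (f : K) : IsPrincipalIdealRing (Algebra.adjoin k {f}) := by
  have h : (Polynomial.aeval (R := k) f).range = Algebra.adjoin k {f} :=
    (Algebra.adjoin_singleton_eq_range_aeval k f).symm
  rw [← h]
  exact IsPrincipalIdealRing.of_surjective (Polynomial.aeval (R := k) f).rangeRestrict
    (Polynomial.aeval (R := k) f).rangeRestrict_surjective

/-- The generator of `k[f]`. -/
def adjoinSelf (k : Type*) {K : Type*} [Field k] [Field K] [Algebra k K] (f : K) :
    Algebra.adjoin k {f} := ⟨f, Algebra.self_mem_adjoin_singleton k f⟩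

lemma exists_adjoin_eq (f : K) (a : Algebra.adjoin k {f}) :
    ∃ (c : k) (b : Algebra.adjoin k {f}), a = algebraMap k _ c + adjoinSelf k f * b := by
  obtain ⟨a, ha⟩ := a
  obtain ⟨g, rfl⟩ : ∃ g : Polynomial k, Polynomial.aeval f g = a := by
    rwa [Algebra.adjoin_singleton_eq_range_aeval] at ha
  refine ⟨g.coeff 0, ⟨Polynomial.aeval f g.divX, Polynomial.aeval_mem_adjoin_singleton k f⟩, ?_⟩
  ext
  have := congrArg (Polynomial.aeval f) (Polynomial.X_mul_divX_add g)
  simp only [map_add, map_mul, Polynomial.aeval_X, Polynomial.aeval_C] at this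
  change Polynomial.aeval f g = algebraMap k K (g.coeff 0) + f * Polynomial.aeval f g.divX
  rw [← this, add_comm]

lemma adjoinSelf_mul_ne_one {f : K} (hf : Transcendental k f) (b : Algebra.adjoin k {f}) :
    adjoinSelf k f * b ≠ 1 := by
  intro h
  obtain ⟨b, hb⟩ := b
  obtain ⟨g, rfl⟩ : ∃ g : Polynomial k, Polynomial.aeval f g = b := by
    rwa [Algebra.adjoin_singleton_eq_range_aeval] at hb
  have h2 : Polynomial.aeval f (Polynomial.X * g) = Polynomial.aeval f (1 : Polynomial k) := by
    simpa [adjoinSelf] using congrArg Subtype.val h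
  have h3 := transcendental_iff_injective.mp hf h2
  exact Polynomial.not_isUnit_X (IsUnit.of_mul_eq_one _ h3)

lemma isMaximal_span_adjoinSelf {f : K} (hf : Transcendental k f) :
    (Ideal.span {adjoinSelf k f}).IsMaximal := by
  rw [Ideal.isMaximal_iff]
  refine ⟨fun h ↦ ?_, fun J a hJ ha haJ ↦ ?_⟩
  · obtain ⟨b, hb⟩ := Ideal.mem_span_singleton.mp h
    exact adjoinSelf_mul_ne_one hf b hb.symm
  · obtain ⟨c, b, rfl⟩ := exists_adjoin_eq f a
    have hm : adjoinSelf k f * b ∈ Ideal.span {adjoinSelf k f} :=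
      Ideal.mul_mem_right _ _ (Ideal.mem_span_singleton_self _)
    have hc : c ≠ 0 := by rintro rfl; exact ha (by simpa using hm)
    have := J.mul_mem_left (algebraMap k _ c⁻¹) ((Ideal.add_mem_iff_left J (hJ hm)).mp haJ)
    rwa [← map_mul, inv_mul_cancel₀ hc, map_one] at this

/-- The residue field of `k[f]` at `(f)` is `k`, which is algebraically closed, and the residue
field at `q` is finite over it. -/
lemma inertiaDeg_eq_one_of_adjoin [IsAlgClosed k] {f : K} (hf : Transcendental k f)
    {A : Type*} [CommRing A]
    [Algebra (Algebra.adjoin k {f}) A] [Module.Finite (Algebra.adjoin k {f}) A]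
    (q : Ideal A) [q.IsPrime] [q.LiesOver (Ideal.span {adjoinSelf k f})] :
    q.inertiaDeg (Algebra.adjoin k {f}) = 1 := by
  set p := Ideal.span {adjoinSelf k f}
  have hp : p.IsMaximal := isMaximal_span_adjoinSelf hf
  have hq : q.IsMaximal := Ideal.IsMaximal.of_liesOver_isMaximal q p
  rw [Ideal.inertiaDeg_eq_of_isMaximal p q]
  let : Field (Algebra.adjoin k {f} ⧸ p) := Ideal.Quotient.field p
  let : Field (A ⧸ q) := Ideal.Quotient.field q
  have hs : Function.Surjective (algebraMap k (Algebra.adjoin k {f} ⧸ p)) := by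
    intro a
    obtain ⟨a, rfl⟩ := Ideal.Quotient.mk_surjective a
    obtain ⟨c, b, rfl⟩ := exists_adjoin_eq f a
    refine ⟨c, ?_⟩
    rw [map_add, Ideal.Quotient.eq_zero_iff_mem.mpr
      (Ideal.mul_mem_right b p (Ideal.mem_span_singleton_self (adjoinSelf k f))), add_zero]
    rfl
  have : Module.Finite (Algebra.adjoin k {f} ⧸ p) (A ⧸ q) := inferInstance
  have hi : ((algebraMap (Algebra.adjoin k {f} ⧸ p) (A ⧸ q)).comp (algebraMap k _)).IsIntegral :=
    (RingHom.isIntegral_of_surjective _ hs).trans _ _ (algebraMap_isIntegral_iff.mpr inferInstance)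
  have hb : Function.Bijective (algebraMap (Algebra.adjoin k {f} ⧸ p) (A ⧸ q)) :=
    ⟨(algebraMap (Algebra.adjoin k {f} ⧸ p) (A ⧸ q)).injective,
      .of_comp (g := algebraMap k _) (IsAlgClosed.ringHom_bijective_of_isIntegral _ hi).surjective⟩
  exact finrank_eq_one_of_bijective hb

variable [CharZero k] {f : K} [Module.Finite (IntermediateField.adjoin k {f}) K]

instance : IsDedekindDomain (integralClosure (Algebra.adjoin k {f}) K) :=
  integralClosure.isDedekindDomain _ (IntermediateField.adjoin k {f}) _

instance : IsFractionRing (integralClosure (Algebra.adjoin k {f}) K) K :=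
  integralClosure.isFractionRing_of_finite_extension (IntermediateField.adjoin k {f}) K

instance : Module.Finite (Algebra.adjoin k {f}) (integralClosure (Algebra.adjoin k {f}) K) :=
  IsIntegralClosure.finite _ (IntermediateField.adjoin k {f}) K _

lemma finrank_integralClosure_adjoin :
    Module.finrank (Algebra.adjoin k {f}) (integralClosure (Algebra.adjoin k {f}) K) =
      Module.finrank (IntermediateField.adjoin k {f}) K :=
  IsIntegralClosure.rank _ (IntermediateField.adjoin k {f}) K _

variable (f) in
/-- The ideal of the zeros of `f` in `k[f]`. -/
abbrev zeroIdeal (k : Type*) {K : Type*} [Field k] [Field K] [Algebra k K] (f : K) :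
    Ideal (Algebra.adjoin k {f}) := Ideal.span {adjoinSelf k f}

lemma finite_primesOver_zeroIdeal (hf : Transcendental k f) :
    Finite ((zeroIdeal k f).primesOver (integralClosure (Algebra.adjoin k {f}) K)) := by
  have := isMaximal_span_adjoinSelf hf
  have := Ideal.IsMaximal.isPrime this
  infer_instance

/-- This is the fundamental identity `∑ e f = n` with all inertia degrees equal to one. -/
lemma sum_ramificationIdx_zeroIdeal [IsAlgClosed k] (hf : Transcendental k f)
    [Fintype ((zeroIdeal k f).primesOver (integralClosure (Algebra.adjoin k {f}) K))] :
    ∑ q : (zeroIdeal k f).primesOver (integralClosure (Algebra.adjoin k {f}) K),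
      q.1.ramificationIdx (Algebra.adjoin k {f}) =
      Module.finrank (IntermediateField.adjoin k {f}) K := by
  have := isMaximal_span_adjoinSelf hf
  have := Ideal.IsMaximal.isPrime this
  rw [← finrank_integralClosure_adjoin, ← Ideal.sum_ramification_inertia_eq_finrank (zeroIdeal k f)]
  refine Finset.sum_congr rfl fun q _ ↦ ?_
  have := q.2.1
  have := q.2.2
  rw [inertiaDeg_eq_one_of_adjoin hf, mul_one]

end Adjoin

lemma Ring.ord_ringEquiv {R S : Type*} [CommRing R] [CommRing S] (e : R ≃+* S) (x : R) :
    Ring.ord S (e x) = Ring.ord R x := by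
  let : Algebra R S := e.toRingHom.toAlgebra
  have he : algebraMap R S = e.toRingHom := rfl
  have hI : Ideal.span {e x} = (Ideal.span {x}).map e.toRingHom := by
    rw [Ideal.map_span, Set.image_singleton]; rfl
  have h1 := Module.length_eq_of_surjective (R := S) (S := R) (M := S ⧸ Ideal.span {e x})
    e.surjective
  rw [Ring.ord, Ring.ord, ← h1]
  refine (LinearEquiv.length_eq (R := R) (Submodule.Quotient.equiv _
    ((Ideal.span {e x}).restrictScalars R)
    (AlgEquiv.ofRingEquiv (f := e) fun _ ↦ rfl).toLinearEquiv ?_)).symm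
  ext y
  simp only [Submodule.mem_map, Submodule.restrictScalars_mem, hI]
  exact (Ideal.mem_map_iff_of_surjective e.toRingHom e.surjective).symm

/-! ### Valuation rings centred at a prime of a Dedekind domain. -/

namespace ValuationSubring

lemma mem_of_eq_div {K : Type*} [Field K] {A : Type*} [CommRing A] [Algebra A K]
    (V : ValuationSubring K) (q : Ideal A)
    (hA : ∀ a, algebraMap A K a ∈ V) (hq : ∀ a, a ∈ q ↔ algebraMap A K a ∈ V.nonunits)
    (a : A) {s : A} (hs : s ∉ q) : algebraMap A K a / algebraMap A K s ∈ V := by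
  rw [hq, mem_nonunits_iff, not_lt] at hs
  rw [← V.valuation_le_one_iff, map_div₀]
  have h1 := (V.valuation_le_one_iff _).mpr (hA a)
  have h2 := (V.valuation_le_one_iff _).mpr (hA s)
  rw [le_antisymm h2 hs, div_one]
  exact h1

variable {K : Type*} [Field K] {A : Type*} [CommRing A] [IsDedekindDomain A] [Algebra A K]
  [IsFractionRing A K]

/-- The localisation at `q` is a valuation ring, so `z` or `z⁻¹` is a fraction `a / s` with `s ∉ q`.
In the second case `s = z a`, so `a ∈ q` would make `s` a nonunit of `V` and put it in `q`. Together
with `mem_of_eq_div` this shows that `V` is that localisation. -/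
lemma exists_eq_div (V : ValuationSubring K) (q : Ideal A) [q.IsPrime] (hq0 : q ≠ ⊥)
    (hq : ∀ a, a ∈ q ↔ algebraMap A K a ∈ V.nonunits) {z : K}
    (hz : z ∈ V) : ∃ a s : A, s ∉ q ∧ z = algebraMap A K a / algebraMap A K s := by
  have : IsDiscreteValuationRing (Localization.AtPrime q) :=
    IsLocalization.AtPrime.isDiscreteValuationRing_of_dedekind_domain A hq0 _
  let : Algebra (Localization.AtPrime q) K := (IsLocalization.lift (M := q.primeCompl)
    (g := algebraMap A K) (fun y ↦ by
      rw [isUnit_iff_ne_zero, Ne, IsFractionRing.to_map_eq_zero_iff]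
      rintro h; exact y.2 (by rw [h]; exact q.zero_mem))).toAlgebra
  have : IsScalarTower A (Localization.AtPrime q) K := .of_algebraMap_eq fun a ↦
    (IsLocalization.lift_eq _ a).symm
  have : IsFractionRing (Localization.AtPrime q) K :=
    IsFractionRing.isFractionRing_of_isDomain_of_isLocalization q.primeCompl _ _
  have key : ∀ l : Localization.AtPrime q, ∃ a s : A, s ∉ q ∧
      algebraMap _ K l = algebraMap A K a / algebraMap A K s := by
    intro l
    obtain ⟨⟨a, s⟩, rfl⟩ := IsLocalization.mk'_surjective q.primeCompl l
    refine ⟨a, s, s.2, ?_⟩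
    have hs : algebraMap A K s ≠ 0 := by
      rw [Ne, IsFractionRing.to_map_eq_zero_iff]
      intro h; exact s.2 (by rw [h]; exact q.zero_mem)
    rw [eq_div_iff hs, IsScalarTower.algebraMap_apply A (Localization.AtPrime q) K s, ← map_mul,
      IsLocalization.mk'_spec, ← IsScalarTower.algebraMap_apply]
  rcases ValuationRing.isInteger_or_isInteger (Localization.AtPrime q) z with ⟨l, hl⟩ | ⟨l, hl⟩
  · obtain ⟨a, s, hs, h⟩ := key l
    exact ⟨a, s, hs, by rw [← hl, h]⟩
  · obtain ⟨a, s, hs, h⟩ := key l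
    by_cases hz0 : z = 0
    · exact ⟨0, 1, (Ideal.ne_top_iff_one q).mp ‹q.IsPrime›.ne_top, by simp [hz0]⟩
    refine ⟨s, a, fun ha ↦ ?_, by rw [← inv_inv z, ← hl, h, inv_div]⟩
    have hs0 : algebraMap A K s ≠ 0 := by
      rw [Ne, IsFractionRing.to_map_eq_zero_iff]
      intro h; exact hs (by rw [h]; exact q.zero_mem)
    have : algebraMap A K s = z * algebraMap A K a := by
      rw [eq_div_iff hs0, hl] at h
      rw [← h, mul_inv_cancel_left₀ hz0]
    refine hs ((hq s).mpr ?_)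
    rw [this, mem_nonunits_iff_exists_mem_maximalIdeal]
    obtain ⟨h1, h2⟩ := mem_nonunits_iff_exists_mem_maximalIdeal.mp ((hq a).mp ha)
    exact ⟨V.mul_mem _ _ hz h1, Ideal.mul_mem_left _ (⟨z, hz⟩ : V) h2⟩

lemma eq_of_forall_mem_iff (V W : ValuationSubring K) (q : Ideal A) [q.IsPrime] (hq0 : q ≠ ⊥)
    (hV : ∀ a, algebraMap A K a ∈ V) (hqV : ∀ a, a ∈ q ↔ algebraMap A K a ∈ V.nonunits)
    (hW : ∀ a, algebraMap A K a ∈ W) (hqW : ∀ a, a ∈ q ↔ algebraMap A K a ∈ W.nonunits) :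
    V = W := by
  ext z
  constructor
  · intro hz
    obtain ⟨a, s, hs, rfl⟩ := V.exists_eq_div q hq0 hqV hz
    exact W.mem_of_eq_div q hW hqW a hs
  · intro hz
    obtain ⟨a, s, hs, rfl⟩ := W.exists_eq_div q hq0 hqW hz
    exact V.mem_of_eq_div q hV hqV a hs

/-- `V` is the localisation of `A` at `q`, and both sides are the length of its quotient by `t`. -/
lemma ord_eq_ramificationIdx {R : Type*} [CommRing R] [Algebra R A] (V : ValuationSubring K)
    (q : Ideal A) [q.IsPrime] (hq0 : q ≠ ⊥)
    (hA : ∀ a, algebraMap A K a ∈ V) (hq : ∀ a, a ∈ q ↔ algebraMap A K a ∈ V.nonunits)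
    (t : R) [q.LiesOver (Ideal.span {t})] :
    (Ring.ord V ⟨_, hA (algebraMap R A t)⟩).toNat = q.ramificationIdx R := by
  let : Algebra A V := ((algebraMap A K).codRestrict V.toSubring hA).toAlgebra
  have hcoe (a : A) : (algebraMap A V a : K) = algebraMap A K a := rfl
  have : IsLocalization.AtPrime V q := by
    refine ⟨fun s ↦ ?_, fun z ↦ ?_, fun {a b} h ↦ ?_⟩
    · by_contra h
      refine s.2 ((hq s).mpr ?_)
      rw [mem_nonunits_iff_exists_mem_maximalIdeal]
      exact ⟨hA s, h⟩
    · obtain ⟨a, s, hs, h⟩ := V.exists_eq_div q hq0 hq z.2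
      refine ⟨(a, ⟨s, hs⟩), Subtype.ext ?_⟩
      have hs0 : algebraMap A K s ≠ 0 := by
        rw [Ne, IsFractionRing.to_map_eq_zero_iff]
        intro h; exact hs (by rw [h]; exact q.zero_mem)
      change z.1 * algebraMap A K s = algebraMap A K a
      rw [h, div_mul_cancel₀ _ hs0]
    · refine ⟨1, ?_⟩
      have h' : algebraMap A K a = algebraMap A K b := congrArg Subtype.val h
      rw [IsFractionRing.injective A K h']
  rw [Ideal.ramificationIdx_eq (Ideal.span {t}) q, Ideal.map_span, Set.image_singleton]
  let e := IsLocalization.algEquiv q.primeCompl (Localization.AtPrime q) V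
  have he : e (algebraMap R _ t) = ⟨_, hA (algebraMap R A t)⟩ := by
    rw [IsScalarTower.algebraMap_apply R A]
    exact e.commutes _
  rw [← he]
  exact congrArg ENat.toNat (Ring.ord_ringEquiv e.toRingEquiv _)

end ValuationSubring

/-! ### Counting the zeros of an element of `K` over valuation rings. -/

section Zeros

variable {k K : Type*} [Field k] [Field K] [Algebra k K]

/-- The valuation rings of `K` over `k` whose maximal ideal contains `f`. -/
abbrev ZeroPlace (k : Type*) {K : Type*} [Field k] [Field K] [Algebra k K] (f : K) : Type _ :=
  {V : ValuationSubring K // (∀ c, algebraMap k K c ∈ V) ∧ f ∈ V.nonunits}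

/-- Valuation rings are integrally closed, and `V` contains `k[f]`. -/
lemma ValuationSubring.algebraMap_mem_of_adjoin (f : K) (V : ValuationSubring K)
    (hV : ∀ c, algebraMap k K c ∈ V) (hf : f ∈ V)
    (a : integralClosure (Algebra.adjoin k {f}) K) : (a : K) ∈ V := by
  have hle : ∀ x : Algebra.adjoin k {f}, (x : K) ∈ V.toSubring := fun x ↦ by
    obtain ⟨x, hx⟩ := x
    refine Algebra.adjoin_induction ?_ hV (fun _ _ _ _ ↦ V.add_mem _ _)
      (fun _ _ _ _ ↦ V.mul_mem _ _) hx
    rintro _ rfl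
    exact hf
  let : Algebra (Algebra.adjoin k {f}) V :=
    ((algebraMap (Algebra.adjoin k {f}) K).codRestrict V.toSubring hle).toAlgebra
  have : IsScalarTower (Algebra.adjoin k {f}) V K := .of_algebraMap_eq fun _ ↦ rfl
  obtain ⟨y, hy⟩ := IsIntegrallyClosed.isIntegral_iff.mp (a.2.tower_top (A := V))
  rw [← hy]
  exact y.2

variable {f : K}

lemma ZeroPlace.coe_mem (V : ZeroPlace k f) (a : integralClosure (Algebra.adjoin k {f}) K) :
    (a : K) ∈ V.1 :=
  V.1.algebraMap_mem_of_adjoin f V.2.1 (V.1.nonunits_subset V.2.2) a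

/-- The prime ideal of the integral closure of `k[f]` that belongs to a zero of `f`. -/
def ZeroPlace.ideal (V : ZeroPlace k f) : Ideal (integralClosure (Algebra.adjoin k {f}) K) :=
  (IsLocalRing.maximalIdeal V.1).comap
    ((algebraMap (integralClosure (Algebra.adjoin k {f}) K) K).codRestrict V.1.toSubring V.coe_mem)

instance (V : ZeroPlace k f) : V.ideal.IsPrime := by
  unfold ZeroPlace.ideal; infer_instance

lemma ZeroPlace.mem_ideal (V : ZeroPlace k f) (a : integralClosure (Algebra.adjoin k {f}) K) :
    a ∈ V.ideal ↔ (a : K) ∈ V.1.nonunits := by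
  rw [ValuationSubring.mem_nonunits_iff_exists_mem_maximalIdeal]
  exact ⟨fun h ↦ ⟨V.coe_mem a, h⟩, fun h ↦ h.2⟩

lemma ZeroPlace.liesOver (hf : Transcendental k f) (V : ZeroPlace k f) :
    V.ideal.LiesOver (zeroIdeal k f) := by
  refine ⟨(isMaximal_span_adjoinSelf hf).eq_of_le (Ideal.IsPrime.under _ _).ne_top ?_⟩
  rw [Ideal.span_singleton_le_iff_mem, Ideal.mem_comap, V.mem_ideal]
  exact V.2.2

lemma ZeroPlace.ideal_ne_bot (hf : Transcendental k f) (V : ZeroPlace k f) : V.ideal ≠ ⊥ := by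
  have := V.liesOver hf
  intro h
  have h2 : algebraMap _ (integralClosure (Algebra.adjoin k {f}) K) (adjoinSelf k f) ∈ V.ideal := by
    rw [V.mem_ideal]
    exact V.2.2
  rw [h, Ideal.mem_bot] at h2
  exact hf (by rw [show f = 0 from congrArg Subtype.val h2]; exact isAlgebraic_zero)

variable [CharZero k] [Module.Finite (IntermediateField.adjoin k {f}) K]

/-- Injectivity: a place is determined by its prime, being the localisation there. Surjectivity: a
prime over `(f)` is the centre of its adic valuation. -/
lemma bijective_zeroPlace_ideal (hf : Transcendental k f) :
    Function.Bijective (fun V : ZeroPlace k f ↦ (⟨V.ideal, inferInstance, V.liesOver hf⟩ :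
      (zeroIdeal k f).primesOver (integralClosure (Algebra.adjoin k {f}) K))) := by
  constructor
  · intro V W h
    have h' : V.ideal = W.ideal := congrArg Subtype.val h
    exact Subtype.ext (V.1.eq_of_forall_mem_iff W.1 V.ideal (V.ideal_ne_bot hf) V.coe_mem
      V.mem_ideal W.coe_mem (by rw [h']; exact W.mem_ideal))
  · rintro ⟨q, hq, hql⟩
    have hfq : algebraMap _ (integralClosure (Algebra.adjoin k {f}) K) (adjoinSelf k f) ∈ q := by
      have := Ideal.mem_span_singleton_self (adjoinSelf k f)
      rw [show Ideal.span {adjoinSelf k f} = q.under _ from hql.over] at this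
      exact this
    let v : IsDedekindDomain.HeightOneSpectrum (integralClosure (Algebra.adjoin k {f}) K) :=
      ⟨q, hq, by
        rintro rfl
        rw [Ideal.mem_bot] at hfq
        exact hf (by rw [show f = 0 from congrArg Subtype.val hfq]; exact isAlgebraic_zero)⟩
    have hmem (a : integralClosure (Algebra.adjoin k {f}) K) :
        a ∈ q ↔ (a : K) ∈ (v.valuation K).valuationSubring.nonunits := by
      rw [ValuationSubring.mem_nonunits_iff,
        ← (Valuation.isEquiv_valuation_valuationSubring (v.valuation K)).lt_one_iff_lt_one]
      exact (v.valuation_lt_one_iff_mem a).symm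
    let V : ZeroPlace k f := ⟨(v.valuation K).valuationSubring, fun c ↦
      v.valuation_le_one (K := K) (algebraMap k (integralClosure (Algebra.adjoin k {f}) K) c),
      (hmem _).mp hfq⟩
    refine ⟨V, Subtype.ext ?_⟩
    ext a
    rw [V.mem_ideal, hmem]

lemma finite_zeroPlace (hf : Transcendental k f) : Finite (ZeroPlace k f) := by
  have := finite_primesOver_zeroIdeal hf
  exact Finite.of_injective _ (bijective_zeroPlace_ideal hf).injective

/-- The number of zeros of `f`, counted with multiplicity, is the degree `[K : k(f)]`. -/
theorem finsum_ord_zeroPlace [IsAlgClosed k] (hf : Transcendental k f) :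
    ∑ᶠ V : ZeroPlace k f, (Ring.ord V.1 ⟨f, V.1.nonunits_subset V.2.2⟩).toNat =
      Module.finrank (IntermediateField.adjoin k {f}) K := by
  have := finite_primesOver_zeroIdeal hf
  have := Fintype.ofFinite ((zeroIdeal k f).primesOver (integralClosure (Algebra.adjoin k {f}) K))
  rw [← sum_ramificationIdx_zeroIdeal hf, ← finsum_eq_sum_of_fintype]
  refine finsum_eq_of_bijective _ (bijective_zeroPlace_ideal hf) fun V ↦ ?_
  have := V.liesOver hf
  exact V.1.ord_eq_ramificationIdx V.ideal (V.ideal_ne_bot hf) V.coe_mem V.mem_ideal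
    (adjoinSelf k f)

end Zeros

/-! ### Points as valuation rings of the function field, and principal divisors. -/

namespace SmoothProjectiveCurve

variable {C : SmoothProjectiveCurve}

lemma algebraMap_algebraMap_stalk (x : C.X) (c : ℂ) :
    algebraMap (C.X.presheaf.stalk x) C.X.functionField (algebraMap ℂ _ c) =
      algebraMap ℂ C.X.functionField c :=
  congr($(C.X.presheaf.germ_stalkSpecializes (U := ⊤) trivial
    ((genericPoint_spec C.X).specializes (Set.mem_univ x))) _)

lemma ord_algebraMap {x : C.X} (hx : x ≠ genericPoint C.X) {a : C.X.presheaf.stalk x} (ha : a ≠ 0) :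
    Scheme.ord (algebraMap _ C.X.functionField a) x =
      (Ring.ord (C.X.presheaf.stalk x) a).toNat := by
  have := isDiscreteValuationRing_stalk hx
  have hc := coheight_eq_one hx
  have h0 : algebraMap _ C.X.functionField a ≠ 0 := by
    rwa [Ne, IsFractionRing.to_map_eq_zero_iff]
  have : Ring.KrullDimLE 1 (C.X.presheaf.stalk x) := krullDimLE_of_coheight_le hc.le
  rw [Scheme.ord_eq_iff hc h0]
  change Ring.ordFrac (C.X.presheaf.stalk x) _ = _
  rw [Ring.ordFrac_eq_ord _ ha]
  exact Ring.ordMonoidWithZeroHom_eq_coe _ (mem_nonZeroDivisors_of_ne_zero ha)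
    (ENat.natCast_toNat (Ring.ord_ne_top (mem_nonZeroDivisors_of_ne_zero ha))).symm

lemma ord_algebraMap_nonneg {x : C.X} (a : C.X.presheaf.stalk x) :
    0 ≤ Scheme.ord (algebraMap _ C.X.functionField a) x := by
  by_cases hx : x = genericPoint C.X
  · subst hx; rw [ord_genericPoint]
  · by_cases ha : a = 0
    · simp [ha]
    · rw [ord_algebraMap hx ha]; positivity

lemma ord_algebraMap_isUnit {x : C.X} {a : C.X.presheaf.stalk x} (ha : IsUnit a) :
    Scheme.ord (algebraMap _ C.X.functionField a) x = 0 := by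
  by_cases hx : x = genericPoint C.X
  · subst hx; rw [ord_genericPoint]
  · rw [ord_algebraMap hx ha.ne_zero, Ring.ord_of_isUnit ha]; rfl

lemma isUnit_of_ord_algebraMap_eq_zero {x : C.X} (hx : x ≠ genericPoint C.X)
    {a : C.X.presheaf.stalk x} (ha : a ≠ 0)
    (h : Scheme.ord (algebraMap _ C.X.functionField a) x = 0) : IsUnit a := by
  have := isDiscreteValuationRing_stalk hx
  rw [ord_algebraMap hx ha, Nat.cast_eq_zero, ENat.toNat_eq_zero] at h
  rcases h with h | h
  · by_contra hu
    rw [Ring.ord, Module.length_eq_zero_iff, Submodule.Quotient.subsingleton_iff] at h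
    exact hu (Ideal.span_singleton_eq_top.mp h)
  · have : Ring.KrullDimLE 1 (C.X.presheaf.stalk x) :=
      krullDimLE_of_coheight_le (coheight_eq_one hx).le
    exact absurd h (Ring.ord_ne_top (mem_nonZeroDivisors_of_ne_zero ha))

lemma ord_inv (f : C.X.functionField) (x : C.X) : Scheme.ord f⁻¹ x = - Scheme.ord f x := by
  by_cases hf : f = 0
  · simp [hf]
  have h1 := Scheme.ord_mul (x := x) hf (inv_ne_zero hf)
  have h2 : Scheme.ord (1 : C.X.functionField) x = 0 := by
    have := ord_algebraMap_isUnit (x := x) isUnit_one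
    rwa [map_one] at this
  rw [mul_inv_cancel₀ hf, h2] at h1
  omega

/-- The valuation ring of a point. -/
def place (x : C.X) : ValuationSubring C.X.functionField :=
  .ofSubring (algebraMap (C.X.presheaf.stalk x) C.X.functionField).range fun z ↦
    (ValuationRing.isInteger_or_isInteger (C.X.presheaf.stalk x) z).imp id id

/-- The local ring of a point is isomorphic to its valuation ring. -/
def stalkEquivPlace (x : C.X) : C.X.presheaf.stalk x ≃+* place x :=
  RingEquiv.ofBijective
    ((algebraMap (C.X.presheaf.stalk x) C.X.functionField).codRestrict (place x).toSubring
      fun a ↦ ⟨a, rfl⟩)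
    ⟨fun _ _ h ↦ IsFractionRing.injective _ C.X.functionField (congrArg Subtype.val h),
      fun ⟨_, a, ha⟩ ↦ ⟨a, Subtype.ext ha⟩⟩

lemma algebraMap_mem_place (x : C.X) (c : ℂ) : algebraMap ℂ C.X.functionField c ∈ place x :=
  ⟨algebraMap ℂ _ c, algebraMap_algebraMap_stalk x c⟩

lemma specMap_algebraMap_fromSpecStalk (x : C.X) :
    Spec.map (CommRingCat.ofHom (algebraMap (C.X.presheaf.stalk x) C.X.functionField)) ≫
      C.X.fromSpecStalk x = C.X.fromSpecStalk (genericPoint C.X) :=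
  Scheme.SpecMap_stalkSpecializes_fromSpecStalk
    ((genericPoint_spec C.X).specializes (Set.mem_univ x))

/-- The valuative square of a valuation ring of the function field over `ℂ`. -/
def valuativeCommSq (V : ValuationSubring C.X.functionField)
    (hV : ∀ c, algebraMap ℂ C.X.functionField c ∈ V) : ValuativeCommSq C.str where
  R := V
  K := C.X.functionField
  i₁ := C.X.fromSpecStalk (genericPoint C.X)
  i₂ := Spec.map (CommRingCat.ofHom
    ((algebraMap ℂ C.X.functionField).codRestrict V.toSubring hV))
  commSq := ⟨by
    rw [fromSpecStalk_str, ← Spec.map_comp]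
    rfl⟩

/-- A point with valuation ring `V` solves the lifting problem of the valuative criterion, and the
lift remembers the point as the image of the closed point. -/
lemma exists_liftStruct (V : ValuationSubring C.X.functionField)
    (hV : ∀ c, algebraMap ℂ C.X.functionField c ∈ V) (z : C.X) (hz : place z = V) :
    ∃ l : (valuativeCommSq V hV).commSq.LiftStruct,
      l.l (IsLocalRing.closedPoint (CommRingCat.of V)) = z := by
  subst hz
  let φ : C.X.presheaf.stalk z ⟶ CommRingCat.of (place z) :=
    CommRingCat.ofHom (stalkEquivPlace z : C.X.presheaf.stalk z →+* place z)
  have hloc : IsLocalHom φ.hom := ⟨fun _ h ↦ (MulEquiv.isUnit_map (stalkEquivPlace z)).mp h⟩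
  refine ⟨⟨Spec.map φ ≫ C.X.fromSpecStalk z, ?_, ?_⟩, ?_⟩
  · rw [← Category.assoc]
    change (Spec.map (CommRingCat.ofHom (algebraMap (place z) C.X.functionField)) ≫
      Spec.map φ) ≫ _ = C.X.fromSpecStalk (genericPoint C.X)
    rw [← specMap_algebraMap_fromSpecStalk z, ← Spec.map_comp]
    rfl
  · rw [Category.assoc, fromSpecStalk_str]
    refine (Spec.map_comp (CommRingCat.ofHom (algebraMap ℂ (C.X.presheaf.stalk z))) φ).symm.trans
      (congrArg (fun g : CommRingCat.of ℂ ⟶ CommRingCat.of (place z) ↦ Spec.map g) ?_)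
    refine CommRingCat.hom_ext (RingHom.ext fun c ↦ ?_)
    exact Subtype.ext (algebraMap_algebraMap_stalk z c)
  · change C.X.fromSpecStalk z (Spec.map φ (IsLocalRing.closedPoint (CommRingCat.of (place z)))) = z
    refine Eq.trans (congrArg _ ?_) Scheme.fromSpecStalk_closedPoint
    exact IsLocalRing.comap_closedPoint φ.hom

/-- Two points with the same valuation ring give two lifts in one valuative square; separatedness
identifies them. -/
lemma place_injective : Function.Injective (place : C.X → ValuationSubring C.X.functionField) := by
  intro x y hxy
  have hV := algebraMap_mem_place x
  obtain ⟨l, hl⟩ := exists_liftStruct (place x) hV x rfl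
  obtain ⟨m, hm⟩ := exists_liftStruct (place x) hV y hxy.symm
  have := IsSeparated.valuativeCriterion C.str (valuativeCommSq (place x) hV)
  rw [← hl, ← hm, Subsingleton.elim l m]

/-- Properness provides a centre `x`, whose local ring is dominated by `V`. Valuation rings are
maximal for domination: if `z ∈ V` has its inverse in the local ring, that inverse is a unit in `V`,
hence already in the local ring. -/
lemma exists_place_eq (V : ValuationSubring C.X.functionField)
    (hV : ∀ c, algebraMap ℂ C.X.functionField c ∈ V) : ∃ x : C.X, place x = V := by
  let S := valuativeCommSq V hV
  have hex : ValuativeCriterion.Existence C.str := by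
    have : UniversallyClosed C.str := inferInstance
    rw [UniversallyClosed.eq_valuativeCriterion] at this
    exact this.1
  obtain ⟨⟨l⟩⟩ := hex S
  let x : C.X := l.l (IsLocalRing.closedPoint V)
  let φ : C.X.presheaf.stalk x ⟶ CommRingCat.of V := Scheme.stalkClosedPointTo (R := .of V) l.l
  have hloc : IsLocalHom φ.hom := Scheme.isLocalHom_stalkClosedPointTo (R := .of V) l.l
  have hφ : Spec.map φ ≫ C.X.fromSpecStalk x = l.l :=
    Scheme.Spec_stalkClosedPointTo_fromSpecStalk (R := .of V) l.l
  have hcomp (a) : (φ.hom a : C.X.functionField) = algebraMap _ C.X.functionField a := by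
    have h := l.fac_left
    rw [← hφ] at h
    change Spec.map (CommRingCat.ofHom (algebraMap V C.X.functionField)) ≫ _ =
        C.X.fromSpecStalk (genericPoint C.X) at h
    rw [← specMap_algebraMap_fromSpecStalk x, ← Spec.map_comp_assoc, cancel_mono] at h
    exact congr($(Spec.map_injective h) a)
  refine ⟨x, le_antisymm ?_ ?_⟩
  · rintro _ ⟨a, rfl⟩
    change algebraMap _ C.X.functionField a ∈ V
    rw [← hcomp]
    exact (φ.hom a).2
  · intro z hz
    rcases (place x).mem_or_inv_mem z with h | ⟨a, ha⟩
    · exact h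
    · change algebraMap _ C.X.functionField a = z⁻¹ at ha
      by_cases hz0 : z = 0
      · rw [hz0]; exact (place x).zero_mem
      have : IsUnit (φ.hom a) := by
        refine IsUnit.of_mul_eq_one ⟨z, hz⟩ (Subtype.ext ?_)
        change (φ.hom a : C.X.functionField) * z = 1
        rw [hcomp, ha, inv_mul_cancel₀ hz0]
      obtain ⟨b, hb⟩ := (isUnit_of_map_unit φ.hom a this).exists_right_inv
      refine ⟨b, ?_⟩
      change algebraMap _ C.X.functionField b = z
      have h2 := congrArg (algebraMap _ C.X.functionField) hb
      rw [map_mul, ha, map_one] at h2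
      field_simp at h2
      exact h2

lemma place_eq_top_iff {x : C.X} : place x = ⊤ ↔ x = genericPoint C.X := by
  have h : place (genericPoint C.X) = ⊤ := by
    refine top_le_iff.mp fun z _ ↦ ⟨z, ?_⟩
    exact congr($(C.X.presheaf.stalkSpecializes_refl (genericPoint C.X)) z)
  exact ⟨fun hx ↦ place_injective (hx.trans h.symm), fun hx ↦ hx ▸ h⟩

/-- The points at which `f` vanishes correspond to the valuation rings at which `f` vanishes. -/
lemma bijective_zeroPlace {f : C.X.functionField} :
    Function.Bijective (fun x : {x : C.X // f ∈ (place x).nonunits} ↦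
      (⟨place x.1, algebraMap_mem_place x.1, x.2⟩ : ZeroPlace ℂ f)) := by
  refine ⟨fun x y h ↦ Subtype.ext (place_injective (congrArg Subtype.val h)), fun V ↦ ?_⟩
  obtain ⟨x, hx⟩ := exists_place_eq V.1 V.2.1
  exact ⟨⟨x, hx ▸ V.2.2⟩, Subtype.ext hx⟩

lemma max_ord_zero_eq {f : C.X.functionField} (hf : f ≠ 0) (x : C.X)
    (h : f ∈ (place x).nonunits) : max (Scheme.ord f x) 0 =
      (Ring.ord (place x) ⟨f, (place x).nonunits_subset h⟩).toNat := by
  have hx : x ≠ genericPoint C.X := by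
    intro hx
    rw [place_eq_top_iff.mpr hx, ValuationSubring.mem_nonunits_iff_exists_mem_maximalIdeal] at h
    obtain ⟨_, h⟩ := h
    refine h (IsUnit.of_mul_eq_one ⟨f⁻¹, trivial⟩ (Subtype.ext ?_))
    exact mul_inv_cancel₀ hf
  obtain ⟨a, rfl⟩ := (place x).nonunits_subset h
  have ha : a ≠ 0 := by rintro rfl; exact hf (map_zero _)
  change max (Scheme.ord (algebraMap _ C.X.functionField a) x) 0 = _
  rw [max_eq_left (ord_algebraMap_nonneg a), ord_algebraMap hx ha,
    ← Ring.ord_ringEquiv (stalkEquivPlace x)]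
  rfl

lemma max_ord_zero_eq_zero {f : C.X.functionField} {x : C.X}
    (h : f ∉ (place x).nonunits) : max (Scheme.ord f x) 0 = 0 := by
  by_cases hf : f = 0
  · simp [hf]
  rw [ValuationSubring.mem_nonunits_iff, not_lt] at h
  have : f⁻¹ ∈ place x := by
    rw [← ValuationSubring.valuation_le_one_iff, map_inv₀]
    exact inv_le_one_of_one_le₀ h
  obtain ⟨a, ha⟩ := this
  have := ord_algebraMap_nonneg a
  change algebraMap _ C.X.functionField a = f⁻¹ at ha
  rw [ha, ord_inv] at this
  exact max_eq_right (by omega)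

lemma finite_zeros {f : C.X.functionField} (hf : Transcendental ℂ f) :
    {x | max (Scheme.ord f x) 0 ≠ 0}.Finite := by
  have := finite_adjoin_functionField hf
  have := finite_zeroPlace hf
  have : Finite {x : C.X | f ∈ (place x).nonunits} :=
    .of_injective _ (bijective_zeroPlace (f := f)).injective
  refine (Set.toFinite {x : C.X | f ∈ (place x).nonunits}).subset fun x hx ↦ ?_
  by_contra h
  exact hx (max_ord_zero_eq_zero h)

lemma finsum_zeros {f : C.X.functionField} (hf : Transcendental ℂ f) :
    ∑ᶠ x, max (Scheme.ord f x) 0 =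
      (Module.finrank (IntermediateField.adjoin ℂ {f}) C.X.functionField : ℤ) := by
  have := finite_adjoin_functionField hf
  have := finite_zeroPlace hf
  have hf0 : f ≠ 0 := by rintro rfl; exact hf isAlgebraic_zero
  rw [← finsum_ord_zeroPlace hf]
  have h1 : ∑ᶠ x, max (Scheme.ord f x) 0 =
      ∑ᶠ x : {x : C.X // f ∈ (place x).nonunits}, max (Scheme.ord f x.1) 0 := by
    rw [finsum_subtype_eq_finsum_cond (f := fun x ↦ max (Scheme.ord f x) 0)
      (fun x ↦ f ∈ (place x).nonunits)]
    refine finsum_congr fun x ↦ ?_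
    by_cases h : f ∈ (place x).nonunits
    · simp [h]
    · rw [max_ord_zero_eq_zero h]; simp
  rw [h1, finsum_eq_of_bijective (g := fun V : ZeroPlace ℂ f ↦
    ((Ring.ord V.1 ⟨f, V.1.nonunits_subset V.2.2⟩).toNat : ℤ)) _ bijective_zeroPlace
    fun x ↦ max_ord_zero_eq hf0 x.1 x.2]
  exact ((Nat.castAddMonoidHom ℤ).map_finsum (Set.toFinite _)).symm

/-- Since `ℂ` is algebraically closed, an algebraic function is constant. -/
lemma ord_eq_zero_of_isAlgebraic {f : C.X.functionField} (hf : IsAlgebraic ℂ f) (x : C.X) :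
    Scheme.ord f x = 0 := by
  obtain ⟨c, rfl⟩ : ∃ c, algebraMap ℂ C.X.functionField c = f := by
    have : Algebra.IsAlgebraic ℂ (IntermediateField.adjoin ℂ {f}) :=
      IntermediateField.isAlgebraic_adjoin_simple hf.isIntegral
    have h := (IsAlgClosed.algebraMap_bijective_of_isIntegral (k := ℂ)
      (K := IntermediateField.adjoin ℂ {f})).2
      ⟨f, IntermediateField.mem_adjoin_simple_self ℂ f⟩
    exact h.imp fun c hc ↦ congrArg Subtype.val hc
  by_cases hc : c = 0
  · simp [hc]
  rw [← algebraMap_algebraMap_stalk x]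
  exact ord_algebraMap_isUnit ((isUnit_iff_ne_zero.mpr hc).map _)

lemma ord_eq_sub (f : C.X.functionField) (x : C.X) :
    Scheme.ord f x = max (Scheme.ord f x) 0 - max (Scheme.ord f⁻¹ x) 0 := by
  rw [ord_inv]
  omega

lemma transcendental_inv {f : C.X.functionField} (hf : Transcendental ℂ f) :
    Transcendental ℂ f⁻¹ := fun h ↦ hf (by simpa using h.inv)

theorem finite_ord_ne_zero (f : C.X.functionField) : {x | Scheme.ord f x ≠ 0}.Finite := by
  by_cases hf : Transcendental ℂ f
  · refine ((finite_zeros hf).union (finite_zeros (transcendental_inv hf))).subset fun x hx ↦ ?_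
    by_contra h
    simp only [Set.mem_union, Set.mem_ofPred_eq, not_or, not_not] at h
    exact hx (by rw [ord_eq_sub, h.1, h.2, sub_zero])
  · simp [ord_eq_zero_of_isAlgebraic (not_not.mp hf)]

/-- The degree of a principal divisor is zero. -/
theorem finsum_ord_eq_zero (f : C.X.functionField) : ∑ᶠ x, Scheme.ord f x = 0 := by
  by_cases hf : Transcendental ℂ f
  · rw [finsum_congr (ord_eq_sub f),
      finsum_sub_distrib (finite_zeros hf) (finite_zeros (transcendental_inv hf)),
      finsum_zeros hf, finsum_zeros (transcendental_inv hf)]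
    -- Zeros and poles are counted by the degrees over `ℂ(f)` and `ℂ(f⁻¹)`, which are the same
    -- field.
    have : IntermediateField.adjoin ℂ {f⁻¹} = IntermediateField.adjoin ℂ {f} := by
      apply le_antisymm
      · rw [IntermediateField.adjoin_simple_le_iff]
        exact inv_mem (IntermediateField.mem_adjoin_simple_self ℂ f)
      · rw [IntermediateField.adjoin_simple_le_iff]
        rw [← inv_mem_iff]
        exact IntermediateField.mem_adjoin_simple_self ℂ f⁻¹
    rw [this, sub_self]
  · simp [ord_eq_zero_of_isAlgebraic (not_not.mp hf)]

/-- The stalk of a sheaf of modules. -/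
abbrev Stalk (M : C.X.Modules) (x : C.X) : Type := ↑(TopCat.Presheaf.stalk M.presheaf x)

/-- The generic stalk of a sheaf of modules, a vector space over the function field. -/
abbrev GenStalk (M : C.X.Modules) : Type := Stalk M (genericPoint C.X)

/-! ### Stalks of vector bundles -/

lemma toGen_genericPoint (M : C.X.Modules) (m : GenStalk M) : toGen M (genericPoint C.X) m = m := by
  obtain ⟨U, hx, s, rfl⟩ := exists_germ_eq M m
  exact toGen_germ M hx s

lemma IsVectorBundle.exists_basis {M : C.X.Modules} (hM : IsVectorBundle M) {ι : Type*} [Fintype ι]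
    {x : C.X} (c : Module.Basis ι (C.X.presheaf.stalk x) (Stalk M x)) :
    ∃ b : Module.Basis ι C.X.functionField (GenStalk M), ∀ i, b i = toGen M x (c i) := by
  obtain ⟨U, hx, n, s, hs⟩ := hM.exists_frame x
  obtain ⟨V, hVU, hV, t, ht, hc⟩ := hs.exists_of_basis hx c
  refine ⟨ht.basis (genericPoint_mem hV), fun i ↦ ?_⟩
  rw [ht.basis_apply, ← hc, toGen_germ]

/-- The basis of the generic stalk that comes from a basis of a stalk. -/
def IsVectorBundle.genBasis {M : C.X.Modules} (hM : IsVectorBundle M) {ι : Type*} [Fintype ι]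
    {x : C.X} (c : Module.Basis ι (C.X.presheaf.stalk x) (Stalk M x)) :
    Module.Basis ι C.X.functionField (GenStalk M) := (hM.exists_basis c).choose

lemma IsVectorBundle.genBasis_apply {M : C.X.Modules} (hM : IsVectorBundle M) {ι : Type*}
    [Fintype ι] {x : C.X} (c : Module.Basis ι (C.X.presheaf.stalk x) (Stalk M x)) (i : ι) :
    hM.genBasis c i = toGen M x (c i) := (hM.exists_basis c).choose_spec i

lemma IsVectorBundle.nonempty_basis {M : C.X.Modules} (hM : IsVectorBundle M) (x : C.X) :
    Nonempty (Module.Basis (Fin (rank M)) (C.X.presheaf.stalk x) (Stalk M x)) := by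
  obtain ⟨U, hx, n, s, hs⟩ := hM.exists_frame x
  have h : rank M = n := by
    have := Module.finrank_eq_card_basis (hM.genBasis (hs.basis hx))
    rwa [Fintype.card_fin] at this
  rw [h]
  exact ⟨hs.basis hx⟩

lemma IsVectorBundle.free {M : C.X.Modules} (hM : IsVectorBundle M) (x : C.X) :
    Module.Free (C.X.presheaf.stalk x) (Stalk M x) :=
  .of_basis (hM.nonempty_basis x).some

lemma IsVectorBundle.finite {M : C.X.Modules} (hM : IsVectorBundle M) (x : C.X) :
    Module.Finite (C.X.presheaf.stalk x) (Stalk M x) :=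
  .of_basis (hM.nonempty_basis x).some

lemma IsVectorBundle.finite_genStalk {M : C.X.Modules} (hM : IsVectorBundle M) :
    Module.Finite C.X.functionField (GenStalk M) :=
  hM.finite _

lemma IsVectorBundle.toGen_eq_sum {M : C.X.Modules} (hM : IsVectorBundle M) {ι : Type*} [Fintype ι]
    {x : C.X} (c : Module.Basis ι (C.X.presheaf.stalk x) (Stalk M x)) (m : Stalk M x) :
    toGen M x m = ∑ i, algebraMap _ C.X.functionField (c.repr m i) • hM.genBasis c i := by
  conv_lhs => rw [← c.sum_repr m]
  rw [map_sum]
  refine Finset.sum_congr rfl fun i _ ↦ ?_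
  rw [map_smulₛₗ, hM.genBasis_apply]

lemma IsVectorBundle.genBasis_repr {M : C.X.Modules} (hM : IsVectorBundle M) {ι : Type*} [Fintype ι]
    {x : C.X} (c : Module.Basis ι (C.X.presheaf.stalk x) (Stalk M x)) (m : Stalk M x) (i : ι) :
    (hM.genBasis c).repr (toGen M x m) i = algebraMap _ C.X.functionField (c.repr m i) := by
  rw [hM.toGen_eq_sum c, Module.Basis.repr_sum_self]

lemma IsVectorBundle.toGen_injective {M : C.X.Modules} (hM : IsVectorBundle M) (x : C.X) :
    Function.Injective (toGen M x) := by
  obtain ⟨c⟩ := hM.nonempty_basis x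
  intro m n h
  refine c.ext_elem fun i ↦ IsFractionRing.injective _ C.X.functionField ?_
  rw [← hM.genBasis_repr c, h, hM.genBasis_repr]

lemma IsVectorBundle.exists_smul_eq {M : C.X.Modules} (hM : IsVectorBundle M) (x : C.X)
    (w : GenStalk M) : ∃ (a : C.X.presheaf.stalk x) (m : Stalk M x), a ≠ 0 ∧
      toGen M x m = algebraMap _ C.X.functionField a • w := by
  obtain ⟨c⟩ := hM.nonempty_basis x
  classical
  let b := hM.genBasis c
  obtain ⟨a, ha⟩ := IsLocalization.exist_integer_multiples_of_finset
    (nonZeroDivisors (C.X.presheaf.stalk x)) (Finset.univ.image fun i ↦ b.repr w i)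
  choose d hd using fun i ↦ ha (b.repr w i) (Finset.mem_image_of_mem _ (Finset.mem_univ i))
  refine ⟨a, ∑ i, d i • c i, nonZeroDivisors.ne_zero a.2, ?_⟩
  conv_rhs => rw [← b.sum_repr w, Finset.smul_sum]
  rw [map_sum]
  refine Finset.sum_congr rfl fun i _ ↦ ?_
  rw [map_smulₛₗ, hd, ← hM.genBasis_apply, smul_smul, Algebra.smul_def]

lemma rank_eq_card {M : C.X.Modules} {ι : Type*} [Fintype ι]
    (b : Module.Basis ι C.X.functionField (GenStalk M)) : rank M = Fintype.card ι :=
  Module.finrank_eq_card_basis b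

/-! ### Saturated subsheaves -/

section Saturation

variable {M : C.X.Modules} (W : Submodule C.X.functionField (GenStalk M))

/-- The germs that lie generically in a given subspace. -/
def satStalk (W : Submodule C.X.functionField (GenStalk M)) (x : C.X) :
    Submodule (C.X.presheaf.stalk x) (Stalk M x) := W.comap (toGen M x)

lemma mem_satStalk {x : C.X} {m : Stalk M x} : m ∈ satStalk W x ↔ toGen M x m ∈ W := Iff.rfl

/-- The quotient by the saturated submodule is torsion free, hence free over a principal ideal
domain, so bases of the submodule and of the quotient combine. -/
lemma exists_adapted_basis (hM : IsVectorBundle M) (x : C.X) :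
    ∃ (k l : ℕ) (c : Module.Basis (Fin k ⊕ Fin l) (C.X.presheaf.stalk x) (Stalk M x)),
      ∀ m, m ∈ satStalk W x ↔ ∀ j, c.repr m (.inr j) = 0 := by
  have := hM.finite x
  have := hM.free x
  have : Module.IsTorsionFree (C.X.presheaf.stalk x) (Stalk M x ⧸ satStalk W x) := by
    refine Module.IsTorsionFree.of_smul_eq_zero fun a m h ↦ or_iff_not_imp_left.mpr fun ha ↦ ?_
    obtain ⟨m, rfl⟩ := Submodule.Quotient.mk_surjective _ m
    rw [← Submodule.Quotient.mk_smul, Submodule.Quotient.mk_eq_zero, mem_satStalk, map_smulₛₗ] at h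
    rw [Submodule.Quotient.mk_eq_zero, mem_satStalk]
    refine (W.smul_mem_iff ?_).mp h
    rwa [Ne, IsFractionRing.to_map_eq_zero_iff]
  have : Module.Free (C.X.presheaf.stalk x) (Stalk M x ⧸ satStalk W x) :=
    Module.free_of_finite_type_torsion_free'
  let bW := (Module.Free.chooseBasis (C.X.presheaf.stalk x) (satStalk W x)).reindex
    (Fintype.equivFin _)
  let bQ := (Module.Free.chooseBasis (C.X.presheaf.stalk x) (Stalk M x ⧸ satStalk W x)).reindex
    (Fintype.equivFin _)
  refine ⟨_, _, Module.Basis.sumQuot bW bQ, fun m ↦ ?_⟩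
  simp only [Module.Basis.sumQuot_repr_inr]
  rw [← Submodule.Quotient.mk_eq_zero, ← bQ.forall_coord_eq_zero_iff]
  rfl

lemma exists_adapted_frame (hM : IsVectorBundle M) (x : C.X) :
    ∃ (V : C.X.Opens) (_ : x ∈ V) (k l : ℕ) (t : Fin k ⊕ Fin l → Γ(M, V)) (ht : IsFrame M t),
      ∀ (y : C.X) (hy : y ∈ V) (m : Stalk M y), m ∈ satStalk W y ↔
        ∀ j, (ht.basis hy).repr m (.inr j) = 0 := by
  obtain ⟨k, l, c, hc⟩ := exists_adapted_basis W hM x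
  obtain ⟨U, hx, n, s, hs⟩ := hM.exists_frame x
  obtain ⟨V, hVU, hV, t, ht, hct⟩ := hs.exists_of_basis hx c
  -- The equations for `W` are read off in the generic stalk. The frame induces the same generic
  -- basis from every point `y` of `V`, so the adapted description at `x` holds at `y`.
  have hW : ∀ w, w ∈ W ↔ ∀ j, (hM.genBasis c).repr w (.inr j) = 0 := by
    intro w
    obtain ⟨a, m, ha, h⟩ := hM.exists_smul_eq x w
    have ha' : algebraMap _ C.X.functionField a ≠ 0 := by
      rwa [Ne, IsFractionRing.to_map_eq_zero_iff]
    rw [← W.smul_mem_iff ha', ← h, ← mem_satStalk, hc]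
    refine forall_congr' fun j ↦ ?_
    rw [← IsFractionRing.to_map_eq_zero_iff (K := C.X.functionField), ← hM.genBasis_repr, h,
      map_smul, Finsupp.smul_apply, smul_eq_mul, mul_eq_zero, or_iff_right ha']
  refine ⟨V, hV, k, l, t, ht, fun y hy m ↦ ?_⟩
  have hb : hM.genBasis (ht.basis hy) = hM.genBasis c := by
    ext i
    rw [hM.genBasis_apply, hM.genBasis_apply, ht.basis_apply, ← hct, toGen_germ, toGen_germ]
  rw [mem_satStalk, hW, ← hb]
  refine forall_congr' fun j ↦ ?_
  rw [hM.genBasis_repr, IsFractionRing.to_map_eq_zero_iff]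

variable (M) in
/-- The largest subsheaf with a given generic stalk. -/
def satSheaf (W : Submodule C.X.functionField (GenStalk M)) : C.X.Modules :=
  subsheaf M (satStalk W)

/-- The inclusion of a saturated subsheaf. -/
def satι (W : Submodule C.X.functionField (GenStalk M)) : satSheaf M W ⟶ M :=
  subsheafι M (satStalk W)

instance : Mono (satι W) := mono_subsheafι _ _

lemma stalkMap_satι_mem {x : C.X} (m : Stalk (satSheaf M W) x) :
    stalkMap (satι W) x m ∈ satStalk W x := by
  obtain ⟨U, hx, s, rfl⟩ := exists_germ_eq _ m
  rw [stalkMap_germ]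
  exact germ_sec_subsheafι_mem _ _ s hx

lemma exists_satSheaf_frame (hM : IsVectorBundle M) (x : C.X) :
    ∃ (V : C.X.Opens) (_ : x ∈ V) (k l : ℕ) (s : Fin k → Γ(satSheaf M W, V))
      (t : Fin k ⊕ Fin l → Γ(M, V)) (_ : IsFrame M t), IsFrame (satSheaf M W) s ∧
      (∀ i, sec (satι W) V (s i) = t (.inl i)) ∧
      ∀ (y : C.X) (hy : y ∈ V) (m : Stalk M y), m ∈ satStalk W y →
        m ∈ Submodule.span (C.X.presheaf.stalk y) (Set.range fun i ↦ germ M hy (t (.inl i))) := by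
  obtain ⟨V, hV, k, l, t, ht, h⟩ := exists_adapted_frame W hM x
  have hspan : ∀ (y : C.X) (hy : y ∈ V) (m : Stalk M y), m ∈ satStalk W y →
        m ∈ Submodule.span (C.X.presheaf.stalk y) (Set.range fun i ↦ germ M hy (t (.inl i))) := by
    intro y hy m hm
    rw [← (ht.basis hy).sum_repr m, Fintype.sum_sum_type]
    refine add_mem (sum_mem fun i _ ↦ Submodule.smul_mem _ _ (Submodule.subset_span ⟨i, ?_⟩))
      (sum_mem fun j _ ↦ ?_)
    · rw [ht.basis_apply]
    · rw [(h y hy m).mp hm j, zero_smul]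
      exact zero_mem _
  have hmem : ∀ i (y : C.X) (hy : y ∈ V), germ M hy (t (.inl i)) ∈ satStalk W y := by
    intro i y hy
    rw [h y hy, ← ht.basis_apply]
    simp
  have hsec : ∀ i, ∃ s : Γ(satSheaf M W, V), sec (satι W) V s = t (.inl i) := fun i ↦
    exists_sec_subsheafι_eq M (satStalk W) (t (.inl i)) (hmem i)
  choose s hs using hsec
  have hs' : ∀ i (y : C.X) (hy : y ∈ V), stalkMap (satι W) y (germ (satSheaf M W) hy (s i)) =
      germ M hy (t (.inl i)) := fun i y hy ↦ by
    rw [stalkMap_germ, hs i]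
  refine ⟨V, hV, k, l, s, t, ht, fun y hy ↦ ⟨?_, ?_⟩, hs, hspan⟩
  · refine LinearIndependent.of_comp (stalkMap (satι W) y) ?_
    rw [show stalkMap (satι W) y ∘ (fun i ↦ germ (satSheaf M W) hy (s i)) =
      (fun i ↦ germ M hy (t i)) ∘ Sum.inl from funext fun i ↦ hs' i y hy]
    exact (ht y hy).1.comp _ Sum.inl_injective
  · rw [eq_top_iff]
    rintro m -
    have h1 := hspan y hy _ (stalkMap_satι_mem W m)
    rw [show (fun i ↦ germ M hy (t (.inl i))) =
      stalkMap (satι W) y ∘ (fun i ↦ germ (satSheaf M W) hy (s i)) from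
      (funext fun i ↦ hs' i y hy).symm, Set.range_comp, ← Submodule.map_span] at h1
    obtain ⟨m', hm', e⟩ := h1
    rwa [← stalkMap_injective (satι W) y e]

lemma isVectorBundle_satSheaf (hM : IsVectorBundle M) : IsVectorBundle (satSheaf M W) :=
  isVectorBundle_of_exists_frame fun x ↦ by
    obtain ⟨V, hV, k, l, s, t, ht, hs, -⟩ := exists_satSheaf_frame W hM x
    exact ⟨V, hV, k, s, hs⟩

lemma range_stalkMap_satι (hM : IsVectorBundle M) (x : C.X) :
    LinearMap.range (stalkMap (satι W) x) = satStalk W x := by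
  apply le_antisymm
  · rintro _ ⟨m, rfl⟩
    exact stalkMap_satι_mem W m
  · intro m hm
    obtain ⟨V, hV, k, l, s, t, ht, hs, hst, h⟩ := exists_satSheaf_frame W hM x
    refine Submodule.span_le.mpr ?_ (h x hV m hm)
    rintro _ ⟨i, rfl⟩
    exact ⟨germ _ hV (s i), by rw [stalkMap_germ, hst]⟩

/-- When the first block of a frame spans the subsheaf on stalks, the second block maps to a frame
of the quotient. -/
lemma isFrame_of_shortExact {S : ShortComplex C.X.Modules} (hS : S.ShortExact) {κ ν : Type*}
    [Fintype κ] [Fintype ν] {V : C.X.Opens} {t : κ ⊕ ν → Γ(S.X₂, V)} (ht : IsFrame S.X₂ t)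
    (h : ∀ (y : C.X) (hy : y ∈ V), LinearMap.range (stalkMap S.f y) =
      Submodule.span (C.X.presheaf.stalk y) (Set.range fun i ↦ germ S.X₂ hy (t (.inl i)))) :
    IsFrame S.X₃ fun j ↦ sec S.g V (t (.inr j)) := by
  intro y hy
  have hker := (range_stalkMap_eq_ker hS y).symm.trans (h y hy)
  simp only [← stalkMap_germ]
  constructor
  · have h1 := (ht y hy).1
    rw [linearIndependent_sum] at h1
    refine h1.2.1.map (f := stalkMap S.g y) ?_
    rw [hker]
    exact h1.2.2.symm
  · have := hS.epi_g
    rw [eq_top_iff]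
    rintro m -
    obtain ⟨m, rfl⟩ := stalkMap_surjective S.g y m
    rw [← (ht.basis hy).sum_repr m, Fintype.sum_sum_type, map_add, map_sum, map_sum]
    refine add_mem (sum_mem fun i _ ↦ ?_) (sum_mem fun j _ ↦ ?_)
    · have : stalkMap S.g y (germ S.X₂ hy (t (.inl i))) = 0 := by
        rw [← LinearMap.mem_ker, hker]
        exact Submodule.subset_span ⟨i, rfl⟩
      rw [map_smul, ht.basis_apply, this, smul_zero]
      exact zero_mem _
    · rw [map_smul, ht.basis_apply]
      exact Submodule.smul_mem _ _ (Submodule.subset_span ⟨j, rfl⟩)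

lemma isVectorBundle_of_range_eq_satStalk {S : ShortComplex C.X.Modules} (hS : S.ShortExact)
    (h₂ : IsVectorBundle S.X₂) (W : Submodule C.X.functionField (GenStalk S.X₂))
    (hW : ∀ x, LinearMap.range (stalkMap S.f x) = satStalk W x) : IsVectorBundle S.X₃ :=
  isVectorBundle_of_exists_frame fun x ↦ by
    obtain ⟨V, hV, k, l, s, t, ht, hs, hst, h⟩ := exists_satSheaf_frame W h₂ x
    refine ⟨V, hV, l, _, isFrame_of_shortExact hS ht fun y hy ↦ (hW y).trans ?_⟩
    refine le_antisymm (h y hy) (Submodule.span_le.mpr ?_)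
    rintro _ ⟨i, rfl⟩
    change germ _ hy (t (.inl i)) ∈ satStalk W y
    rw [← hst, ← stalkMap_germ]
    exact stalkMap_satι_mem W _

lemma isVectorBundle_cokernel_satι (hM : IsVectorBundle M) : IsVectorBundle (cokernel (satι W)) :=
  isVectorBundle_of_range_eq_satStalk (shortExact_cokernel (satι W)) hM W
    (range_stalkMap_satι W hM)

lemma rank_satSheaf (hM : IsVectorBundle M) :
    rank (satSheaf M W) = Module.finrank C.X.functionField W := by
  have h1 := LinearMap.finrank_range_of_inj (stalkMap_injective (satι W) (genericPoint C.X))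
  rw [range_stalkMap_satι W hM] at h1
  have h2 : satStalk W (genericPoint C.X) = W := by
    ext m
    rw [mem_satStalk, toGen_genericPoint]
  rw [h2] at h1
  exact h1.symm

end Saturation

/-- The constant section `1` of the structure sheaf. -/
def oneSection (C : SmoothProjectiveCurve) (U : C.X.Opens) : Γ(C.structureSheaf, U) :=
  (1 : Γ(C.X, U))

lemma smul_oneSection {U : C.X.Opens} (a : Γ(C.X, U)) :
    a • oneSection C U = (show Γ(C.structureSheaf, U) from a) :=
  mul_one a

lemma res_oneSection {U V : C.X.Opens} (h : V ≤ U) :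
    res C.structureSheaf h (oneSection C U) = oneSection C V :=
  map_one (ringRes h)

lemma isFrame_structureSheaf :
    IsFrame C.structureSheaf fun _ : Fin 1 ↦ oneSection C ⊤ := by
  intro y hy
  constructor
  · rw [Fintype.linearIndependent_iff]
    intro g hg i
    obtain ⟨V, hV, b, hb⟩ := exists_ringGerm_eq (g i)
    rw [Fin.sum_univ_one, show (0 : Fin 1) = i from Subsingleton.elim _ _, ← hb,
      ← germ_res C.structureSheaf (le_top : V ≤ ⊤) hV, res_oneSection, ← germ_smul,
      smul_oneSection] at hg
    obtain ⟨W, hyW, hWV, h⟩ := exists_res_eq_zero C.structureSheaf hV _ hg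
    have h' : ringRes hWV b = 0 := h
    rw [← hb, ← ringGerm_res hWV hyW, h', map_zero]
  · rw [eq_top_iff]
    rintro m -
    obtain ⟨V, hV, b, rfl⟩ := exists_germ_eq C.structureSheaf m
    have h : germ C.structureSheaf hV b = ringGerm hV (show Γ(C.X, V) from b) •
        germ C.structureSheaf hy (oneSection C ⊤) := by
      rw [← germ_res C.structureSheaf (le_top : V ≤ ⊤) hV, res_oneSection, ← germ_smul,
        smul_oneSection]
    rw [h]
    exact Submodule.smul_mem _ _ (Submodule.subset_span ⟨0, rfl⟩)

lemma isVectorBundle_structureSheaf : IsVectorBundle C.structureSheaf :=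
  isVectorBundle_of_exists_frame fun _ ↦ ⟨⊤, trivial, 1, _, isFrame_structureSheaf⟩

lemma rank_structureSheaf : rank C.structureSheaf = 1 := by
  rw [rank_eq_card (isFrame_structureSheaf.basis trivial), Fintype.card_fin]

end SmoothProjectiveCurve

/-! ### Determinants and exact sequences. -/

/-- A basis of the middle term of a short exact sequence that is adapted to bases of the ends. -/
lemma exists_basis_of_exact {R A B Q : Type*} [CommRing R] [AddCommGroup A] [AddCommGroup B]
    [AddCommGroup Q] [Module R A] [Module R B] [Module R Q] {f : A →ₗ[R] B} {g : B →ₗ[R] Q}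
    (hf : Function.Injective f) (hfg : LinearMap.range f = LinearMap.ker g)
    (hg : Function.Surjective g) {ι κ : Type*} (a : Module.Basis ι R A) (q : Module.Basis κ R Q) :
    ∃ b : Module.Basis (ι ⊕ κ) R B, (∀ i, b (.inl i) = f (a i)) ∧ ∀ j, g (b (.inr j)) = q j := by
  let bW := a.map (LinearEquiv.ofInjective f hf)
  let e : (B ⧸ LinearMap.range f) ≃ₗ[R] Q :=
    (Submodule.quotEquivOfEq _ _ hfg).trans (g.quotKerEquivOfSurjective hg)
  let bQ := q.map e.symm
  refine ⟨Module.Basis.sumQuot bW bQ, fun i ↦ ?_, fun j ↦ ?_⟩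
  · rw [Module.Basis.sumQuot_inl]; rfl
  · have h := congrArg e (Module.Basis.sumQuot_inr bW bQ j)
    rw [Module.Basis.map_apply, e.apply_symm_apply] at h
    exact h

lemma Module.Basis.det_eq_det_mul {R M ι : Type*} [CommRing R] [AddCommGroup M] [Module R M]
    [Fintype ι] [DecidableEq ι] (b b' : Module.Basis ι R M) (v : ι → M) :
    b.det v = b.det b' * b'.det v :=
  congr($(b.det.eq_smul_basis_det b') v)

/-- The determinant of a family that is block triangular with respect to an exact sequence. -/
lemma Module.Basis.det_of_exact {R A B Q ι κ : Type*} [CommRing R] [AddCommGroup A]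
    [AddCommGroup B] [AddCommGroup Q] [Module R A] [Module R B] [Module R Q] [Fintype ι] [Fintype κ]
    [DecidableEq ι] [DecidableEq κ] {f : A →ₗ[R] B} {g : B →ₗ[R] Q} (hgf : ∀ m, g (f m) = 0)
    {a : Module.Basis ι R A} {q : Module.Basis κ R Q} {b : Module.Basis (ι ⊕ κ) R B}
    (ha : ∀ i, b (.inl i) = f (a i)) (hq : ∀ j, g (b (.inr j)) = q j) {u : ι → A} {v : κ → Q}
    {w : ι ⊕ κ → B} (hu : ∀ i, w (.inl i) = f (u i)) (hv : ∀ j, g (w (.inr j)) = v j) :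
    b.det w = a.det u * q.det v := by
  have hf (m : A) : b.repr (f m) = (a.repr m).sumElim 0 := by
    rw [← b.repr.apply_symm_apply ((a.repr m).sumElim 0)]
    congr 1
    rw [repr_symm_apply, Finsupp.linearCombination_apply, Finsupp.sum_fintype _ _ (by simp),
      Fintype.sum_sum_type]
    simp only [ha, Finsupp.sumElim_inl, Finsupp.sumElim_inr, Finsupp.zero_apply, zero_smul,
      Finset.sum_const_zero, add_zero]
    conv_lhs => rw [← a.sum_repr m]
    simp only [map_sum, map_smul]
  have hg (m : B) (j : κ) : b.repr m (.inr j) = q.repr (g m) j := by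
    have h : g m = ∑ j, b.repr m (.inr j) • q j := by
      conv_lhs => rw [← b.sum_repr m]
      simp only [Fintype.sum_sum_type, map_add, map_sum, map_smul, ha, hgf, hq, smul_zero,
        Finset.sum_const_zero, zero_add]
    rw [h, repr_sum_self]
  rw [det_apply, det_apply, det_apply, ← Matrix.det_fromBlocks_zero₂₁ (a.toMatrix u)
    (Matrix.of fun i j ↦ b.repr (w (.inr j)) (.inl i)) (q.toMatrix v)]
  congr 1
  ext (i | i) (j | j)
  · simp [toMatrix_apply, hu, hf]
  · simp [toMatrix_apply]
  · simp [toMatrix_apply, hu, hf]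
  · simp [toMatrix_apply, hg, hv]

/-! ### The degree: independence of choices and additivity. -/

namespace SmoothProjectiveCurve

variable {C : SmoothProjectiveCurve} {M : C.X.Modules} {ι : Type*} [Fintype ι] [DecidableEq ι]

lemma IsVectorBundle.det_genBasis (hM : IsVectorBundle M) {x : C.X}
    (c : Module.Basis ι (C.X.presheaf.stalk x) (Stalk M x)) (v : ι → Stalk M x) :
    (hM.genBasis c).det (fun i ↦ toGen M x (v i)) = algebraMap _ C.X.functionField (c.det v) := by
  rw [Module.Basis.det_apply, Module.Basis.det_apply, RingHom.map_det]
  congr 1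
  ext i j
  rw [Module.Basis.toMatrix_apply, hM.genBasis_repr]
  rfl

lemma IsVectorBundle.det_toGen_ne_zero (hM : IsVectorBundle M)
    (b : Module.Basis ι C.X.functionField (GenStalk M)) {x : C.X}
    (c : Module.Basis ι (C.X.presheaf.stalk x) (Stalk M x)) :
    b.det (fun i ↦ toGen M x (c i)) ≠ 0 := by
  rw [← funext (hM.genBasis_apply c)]
  exact (b.isUnit_det _).ne_zero

/-- The divisor of the determinant of a family of stalks in terms of bases. -/
lemma IsVectorBundle.ord_det_eq_add (hM : IsVectorBundle M)
    (b : Module.Basis ι C.X.functionField (GenStalk M)) {x : C.X}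
    (c : Module.Basis ι (C.X.presheaf.stalk x) (Stalk M x)) (v : ι → Stalk M x) (hv : c.det v ≠ 0) :
    Scheme.ord (b.det fun i ↦ toGen M x (v i)) x =
      Scheme.ord (b.det fun i ↦ toGen M x (c i)) x +
        Scheme.ord (algebraMap _ C.X.functionField (c.det v)) x := by
  rw [b.det_eq_det_mul (hM.genBasis c), hM.det_genBasis, Scheme.ord_mul (b.isUnit_det _).ne_zero
    (by rwa [Ne, IsFractionRing.to_map_eq_zero_iff]), ← funext (hM.genBasis_apply c)]

lemma IsVectorBundle.ord_det_eq (hM : IsVectorBundle M)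
    (b : Module.Basis ι C.X.functionField (GenStalk M)) {x : C.X}
    (c c' : Module.Basis ι (C.X.presheaf.stalk x) (Stalk M x)) :
    Scheme.ord (b.det fun i ↦ toGen M x (c' i)) x =
      Scheme.ord (b.det fun i ↦ toGen M x (c i)) x := by
  rw [hM.ord_det_eq_add b c c' (c.isUnit_det c').ne_zero, ord_algebraMap_isUnit (c.isUnit_det c'),
    add_zero]

/-- Over the domain of a frame the orders are those of a single rational function; finitely many
such domains cover the curve. -/
lemma IsVectorBundle.finite_ord_det (hM : IsVectorBundle M)
    (b : Module.Basis ι C.X.functionField (GenStalk M))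
    (c : ∀ x, Module.Basis ι (C.X.presheaf.stalk x) (Stalk M x)) :
    {x | Scheme.ord (b.det fun i ↦ toGen M x (c x i)) x ≠ 0}.Finite := by
  have loc : ∀ x : C.X, ∃ (V : C.X.Opens), x ∈ V ∧
      ({y | Scheme.ord (b.det fun i ↦ toGen M y (c y i)) y ≠ 0} ∩ V).Finite := by
    intro x
    obtain ⟨U, hx, n, s, hs⟩ := hM.exists_frame x
    obtain ⟨V, hVU, hV, t, ht, -⟩ := hs.exists_of_basis hx (c x)
    refine ⟨V, hV, (finite_ord_ne_zero (b.det fun i ↦ germ M (genericPoint_mem hV) (t i))).subset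
      ?_⟩
    rintro y ⟨hy, hyV⟩
    have h := hM.ord_det_eq b (ht.basis hyV) (c y)
    simp only [ht.basis_apply, toGen_germ] at h
    rw [Set.mem_ofPred_eq, ← h]
    exact hy
  choose V hV hfin using loc
  obtain ⟨T, hT⟩ := isCompact_univ.elim_finite_subcover (fun x ↦ (V x : Set C.X))
    (fun x ↦ (V x).isOpen) fun x _ ↦ Set.mem_iUnion.mpr ⟨x, hV x⟩
  refine (T.finite_toSet.biUnion fun x _ ↦ hfin x).subset fun y hy ↦ ?_
  obtain ⟨x, hx, hyx⟩ := Set.mem_iUnion₂.mp (hT (Set.mem_univ y))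
  exact Set.mem_iUnion₂.mpr ⟨x, hx, hy, hyx⟩

/-- Changing the generic basis adds a principal divisor, of degree zero; changing the basis of a
stalk multiplies by a unit, of order zero. -/
lemma IsVectorBundle.finsum_ord_det_eq (hM : IsVectorBundle M)
    (b b' : Module.Basis ι C.X.functionField (GenStalk M))
    (c c' : ∀ x, Module.Basis ι (C.X.presheaf.stalk x) (Stalk M x)) :
    ∑ᶠ x, Scheme.ord (b.det fun i ↦ toGen M x (c x i)) x =
      ∑ᶠ x, Scheme.ord (b'.det fun i ↦ toGen M x (c' x i)) x := by
  have h (x : C.X) : Scheme.ord (b.det fun i ↦ toGen M x (c x i)) x =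
      Scheme.ord (b.det b') x + Scheme.ord (b'.det fun i ↦ toGen M x (c' x i)) x := by
    rw [b.det_eq_det_mul b', Scheme.ord_mul (b.isUnit_det b').ne_zero (hM.det_toGen_ne_zero b' _),
      hM.ord_det_eq b' (c' x) (c x)]
  rw [finsum_congr h, finsum_add_distrib (finite_ord_ne_zero _) (hM.finite_ord_det b' c'),
    finsum_ord_eq_zero, zero_add]

/-- The degree can be computed with any basis of the generic stalk and any bases of the stalks. -/
theorem IsVectorBundle.degree_eq (hM : IsVectorBundle M)
    (b : Module.Basis ι C.X.functionField (GenStalk M))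
    (c : ∀ x, Module.Basis ι (C.X.presheaf.stalk x) (Stalk M x)) :
    degree M = - ∑ᶠ x, Scheme.ord (b.det fun i ↦ toGen M x (c x i)) x := by
  have e : ι ≃ Fin (rank M) := Fintype.equivFinOfCardEq (rank_eq_card b).symm
  have hne (x) := hM.nonempty_basis x
  have h1 : degree M = - ∑ᶠ x, Scheme.ord ((hne (genericPoint C.X)).some.det
      fun i ↦ toGen M x ((hne x).some i)) x := by
    rw [degree, dif_pos (hne _), ← finsum_neg_distrib]
    refine finsum_congr fun x ↦ ?_
    rw [frameOrder, dif_pos (hne x)]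
    rfl
  rw [h1, hM.finsum_ord_det_eq _ (b.reindex e) _ fun x ↦ (c x).reindex e]
  congr 1
  refine finsum_congr fun x ↦ ?_
  rw [Module.Basis.det_reindex]
  congr 2
  ext i
  simp

lemma degree_eq_zero_of_rank_eq_zero (hM : IsVectorBundle M) (h : rank M = 0) : degree M = 0 := by
  have hne (x) := hM.nonempty_basis x
  rw [h] at hne
  rw [hM.degree_eq (hne _).some fun x ↦ (hne x).some, neg_eq_zero]
  refine finsum_eq_zero_of_forall_eq_zero fun x ↦ ?_
  rw [Module.Basis.det_apply, Matrix.det_isEmpty]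
  have := ord_algebraMap_isUnit (x := x) isUnit_one
  rwa [map_one] at this

lemma degree_structureSheaf : degree C.structureSheaf = 0 := by
  have ht (x : C.X) : x ∈ (⊤ : C.X.Opens) := trivial
  have h := isFrame_structureSheaf (C := C)
  rw [isVectorBundle_structureSheaf.degree_eq (h.basis (ht (genericPoint C.X)))
    fun x ↦ h.basis (ht x), neg_eq_zero]
  refine finsum_eq_zero_of_forall_eq_zero fun x ↦ ?_
  have h1 : (fun i ↦ toGen C.structureSheaf x (h.basis (ht x) i)) =
      h.basis (ht (genericPoint C.X)) := by
    ext i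
    rw [h.basis_apply, h.basis_apply, toGen_germ]
  rw [h1, Module.Basis.det_self]
  have := ord_algebraMap_isUnit (x := x) isUnit_one
  rwa [map_one] at this

/-! ### Exact sequences -/

lemma exists_basis_of_shortExact {S : ShortComplex C.X.Modules} (hS : S.ShortExact) {x : C.X}
    {ι κ : Type*} (a : Module.Basis ι (C.X.presheaf.stalk x) (Stalk S.X₁ x))
    (q : Module.Basis κ (C.X.presheaf.stalk x) (Stalk S.X₃ x)) :
    ∃ b : Module.Basis (ι ⊕ κ) (C.X.presheaf.stalk x) (Stalk S.X₂ x),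
      (∀ i, b (.inl i) = stalkMap S.f x (a i)) ∧ ∀ j, stalkMap S.g x (b (.inr j)) = q j := by
  have := hS.mono_f
  have := hS.epi_g
  exact exists_basis_of_exact (stalkMap_injective S.f x) (range_stalkMap_eq_ker hS x)
    (stalkMap_surjective S.g x) a q

lemma rank_eq_add {S : ShortComplex C.X.Modules} (hS : S.ShortExact) (h₁ : IsVectorBundle S.X₁)
    (h₃ : IsVectorBundle S.X₃) : rank S.X₂ = rank S.X₁ + rank S.X₃ := by
  obtain ⟨b, -⟩ := exists_basis_of_shortExact hS (h₁.nonempty_basis (genericPoint C.X)).some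
    (h₃.nonempty_basis (genericPoint C.X)).some
  rw [rank_eq_card b]
  simp

/-- In adapted bases the transition matrix is block triangular, so its determinant is the product of
those of the two ends, and orders add. -/
lemma degree_eq_add {S : ShortComplex C.X.Modules} (hS : S.ShortExact) (h₁ : IsVectorBundle S.X₁)
    (h₂ : IsVectorBundle S.X₂) (h₃ : IsVectorBundle S.X₃) :
    degree S.X₂ = degree S.X₁ + degree S.X₃ := by
  have a (x) := (h₁.nonempty_basis x).some
  have q (x) := (h₃.nonempty_basis x).some
  choose b hba hbq using fun x ↦ exists_basis_of_shortExact hS (a x) (q x)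
  have key (x : C.X) : Scheme.ord ((b (genericPoint C.X)).det fun i ↦ toGen S.X₂ x (b x i)) x =
      Scheme.ord ((a (genericPoint C.X)).det fun i ↦ toGen S.X₁ x (a x i)) x +
      Scheme.ord ((q (genericPoint C.X)).det fun i ↦ toGen S.X₃ x (q x i)) x := by
    rw [← Scheme.ord_mul (h₁.det_toGen_ne_zero _ _) (h₃.det_toGen_ne_zero _ _)]
    congr 1
    refine Module.Basis.det_of_exact (f := stalkMap S.f (genericPoint C.X))
      (g := stalkMap S.g (genericPoint C.X)) (fun m ↦ ?_) (hba _) (hbq _) (fun i ↦ ?_) fun j ↦ ?_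
    · rw [← stalkMap_comp, S.zero, stalkMap_zero]
    · rw [hba, stalkMap_toGen]
    · rw [stalkMap_toGen, hbq]
  rw [h₂.degree_eq (b _) b, finsum_congr key, finsum_add_distrib (h₁.finite_ord_det _ a)
    (h₃.finite_ord_det _ q), h₁.degree_eq (a _) a, h₃.degree_eq (q _) q, neg_add]

/-! ### Monomorphisms between bundles of the same rank -/

/-- The degree difference of vector bundles of the same rank is the sum of the orders of vanishing
of the determinant of a monomorphism between them. -/
lemma degree_sub_degree {G F : C.X.Modules} (hG : IsVectorBundle G) (hF : IsVectorBundle F)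
    (ψ : G ⟶ F) [Mono ψ] (c : ∀ x, Module.Basis ι (C.X.presheaf.stalk x) (Stalk G x))
    (d : ∀ x, Module.Basis ι (C.X.presheaf.stalk x) (Stalk F x)) :
    (∀ x, (d x).det (fun i ↦ stalkMap ψ x (c x i)) ≠ 0) ∧
    {x | Scheme.ord (algebraMap _ C.X.functionField
      ((d x).det fun i ↦ stalkMap ψ x (c x i))) x ≠ 0}.Finite ∧
    degree F - degree G = ∑ᶠ x, Scheme.ord (algebraMap _ C.X.functionField
      ((d x).det fun i ↦ stalkMap ψ x (c x i))) x := by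
  have := hG.finite_genStalk
  have := hF.finite_genStalk
  -- Generically `ψ` is an isomorphism; transporting the generic basis along it makes the two
  -- divisors differ exactly by the determinants of `ψ` on stalks.
  let e : GenStalk G ≃ₗ[C.X.functionField] GenStalk F :=
    LinearEquiv.ofInjectiveOfFinrankEq (stalkMap ψ (genericPoint C.X)) (stalkMap_injective ψ _)
      ((rank_eq_card (c _)).trans (rank_eq_card (d _)).symm)
  let b := c (genericPoint C.X)
  have hdet (x) : (b.map e).det (fun i ↦ toGen F x (stalkMap ψ x (c x i))) =
      b.det (fun i ↦ toGen G x (c x i)) := by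
    rw [Module.Basis.det_map]
    congr 1
    ext i
    exact e.symm_apply_eq.mpr (stalkMap_toGen ψ x (c x i)).symm
  have hne (x) : (d x).det (fun i ↦ stalkMap ψ x (c x i)) ≠ 0 := by
    intro h
    refine hG.det_toGen_ne_zero b (c x) ?_
    rw [← hdet, (b.map e).det_eq_det_mul (hF.genBasis (d x)), hF.det_genBasis, h, map_zero,
      mul_zero]
  have key (x) := hF.ord_det_eq_add (b.map e) (d x) _ (hne x)
  simp only [hdet] at key
  have key' (x) : Scheme.ord (algebraMap _ C.X.functionField
      ((d x).det fun i ↦ stalkMap ψ x (c x i))) x = Scheme.ord (b.det fun i ↦ toGen G x (c x i)) x -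
      Scheme.ord ((b.map e).det fun i ↦ toGen F x (d x i)) x := by
    rw [key, add_sub_cancel_left]
  have h1 := hG.finite_ord_det b c
  have h2 := hF.finite_ord_det (b.map e) d
  refine ⟨hne, (h1.union h2).subset fun x hx ↦ ?_, ?_⟩
  · by_contra h
    simp only [Set.mem_union, Set.mem_ofPred_eq, not_or, not_not] at h
    exact hx (by rw [key', h.1, h.2, sub_zero])
  · rw [finsum_congr key', finsum_sub_distrib h1 h2, hG.degree_eq b c, hF.degree_eq (b.map e) d]
    ring

end SmoothProjectiveCurve

lemma bijective_of_isUnit_det {R A B ι : Type*} [CommRing R] [AddCommGroup A] [AddCommGroup B]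
    [Module R A] [Module R B] [Fintype ι] [DecidableEq ι] (f : A →ₗ[R] B) (a : Module.Basis ι R A)
    (b : Module.Basis ι R B) (h : IsUnit (b.det fun i ↦ f (a i))) : Function.Bijective f := by
  have h' : IsUnit (LinearMap.toMatrix a b f).det := by
    have h2 : LinearMap.toMatrix a b f = b.toMatrix fun i ↦ f (a i) := by
      ext i j
      rw [LinearMap.toMatrix_apply, Module.Basis.toMatrix_apply]
    rwa [h2, ← Module.Basis.det_apply]
  exact (LinearEquiv.ofIsUnitDet h').bijective

lemma isUnit_det_of_surjective {R A B ι : Type*} [CommRing R] [AddCommGroup A] [AddCommGroup B]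
    [Module R A] [Module R B] [Fintype ι] [DecidableEq ι] (f : A →ₗ[R] B) (a : Module.Basis ι R A)
    (b : Module.Basis ι R B) (h : Function.Bijective f) : IsUnit (b.det fun i ↦ f (a i)) :=
  b.isUnit_det (a.map (LinearEquiv.ofBijective f h))

namespace SmoothProjectiveCurve

variable {C : SmoothProjectiveCurve}

lemma mono_of_stalkMap_genericPoint_injective {G F : C.X.Modules} (hG : IsVectorBundle G)
    (ψ : G ⟶ F) (h : Function.Injective (stalkMap ψ (genericPoint C.X))) : Mono ψ := by
  refine mono_of_stalkMap_injective ψ fun x m n e ↦ hG.toGen_injective x (h ?_)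
  rw [stalkMap_toGen, stalkMap_toGen, e]

lemma rank_le_of_mono {G F : C.X.Modules} (hF : IsVectorBundle F) (ψ : G ⟶ F) [Mono ψ] :
    rank G ≤ rank F := by
  have := hF.finite_genStalk
  exact LinearMap.finrank_le_finrank_of_injective (stalkMap_injective ψ (genericPoint C.X))

lemma degree_le_of_mono {G F : C.X.Modules} (hG : IsVectorBundle G) (hF : IsVectorBundle F)
    (ψ : G ⟶ F) [Mono ψ] (hr : rank G = rank F) : degree G ≤ degree F := by
  have c (x) := (hG.nonempty_basis x).some
  have d (x) := (hF.nonempty_basis x).some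
  obtain ⟨-, -, h⟩ := degree_sub_degree hG hF ψ c fun x ↦ (d x).reindex (finCongr hr.symm)
  rw [← sub_nonneg, h]
  exact finsum_nonneg fun x ↦ ord_algebraMap_nonneg _

/-- The orders of the determinant are nonnegative with sum at most zero, so all vanish and the
determinant is a unit on every stalk. -/
lemma isIso_of_degree_eq {G F : C.X.Modules} (hG : IsVectorBundle G) (hF : IsVectorBundle F)
    (ψ : G ⟶ F) [Mono ψ] (hr : rank G = rank F) (hd : degree F ≤ degree G) : IsIso ψ := by
  have c (x) := (hG.nonempty_basis x).some
  have d (x) := ((hF.nonempty_basis x).some).reindex (finCongr hr.symm)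
  obtain ⟨hne, hfin, h⟩ := degree_sub_degree hG hF ψ c d
  have h0 (x) : Scheme.ord (algebraMap _ C.X.functionField
      ((d x).det fun i ↦ stalkMap ψ x (c x i))) x = 0 := by
    have := single_le_finsum x hfin fun y ↦ ord_algebraMap_nonneg _
    have := ord_algebraMap_nonneg ((d x).det fun i ↦ stalkMap ψ x (c x i))
    omega
  refine isIso_of_stalkMap_bijective ψ fun x ↦ bijective_of_isUnit_det _ (c x) (d x) ?_
  -- At the generic point `Scheme.ord` is identically zero and carries no information; there
  -- nonvanishing suffices.
  by_cases hx : x = genericPoint C.X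
  · subst hx
    exact isUnit_iff_ne_zero.mpr (hne _)
  · exact isUnit_of_ord_algebraMap_eq_zero hx (hne x) (h0 x)

/-- Stalks of `F` embed in the generic stalk, so the kernel of `ψ` is the saturated subsheaf cut out
by the generic kernel; kernel and image are then vector bundles. -/
lemma exists_generic_kernel {S F : C.X.Modules} (hS : IsVectorBundle S) (hF : IsVectorBundle F)
    (ψ : S ⟶ F) : ∃ (K Q : C.X.Modules) (κ : K ⟶ S) (π : S ⟶ Q) (θ : Q ⟶ F) (w : κ ≫ π = 0),
      IsVectorBundle K ∧ IsVectorBundle Q ∧ (ShortComplex.mk κ π w).ShortExact ∧ Mono θ ∧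
      κ ≫ ψ = 0 ∧ (rank K = 0 → Mono ψ) := by
  let W : Submodule C.X.functionField (GenStalk S) :=
    LinearMap.ker (stalkMap ψ (genericPoint C.X))
  have hW (x) (m : Stalk S x) : m ∈ satStalk W x ↔ stalkMap ψ x m = 0 := by
    rw [mem_satStalk]
    change stalkMap ψ (genericPoint C.X) _ = 0 ↔ _
    rw [stalkMap_toGen, ← (hF.toGen_injective x).eq_iff, map_zero]
  have hκ : satι W ≫ ψ = 0 := by
    refine hom_ext_of_stalkMap _ _ fun x m ↦ ?_
    rw [stalkMap_comp, stalkMap_zero]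
    exact (hW x _).mp (stalkMap_satι_mem W m)
  have hex := shortExact_cokernel (satι W)
  have hπθ : cokernel.π (satι W) ≫ cokernel.desc (satι W) ψ hκ = ψ := cokernel.π_desc _ _ _
  refine ⟨satSheaf S W, cokernel (satι W), satι W, cokernel.π _, cokernel.desc _ ψ hκ,
    cokernel.condition _, isVectorBundle_satSheaf W hS, isVectorBundle_cokernel_satι W hS, hex,
    ?_, hκ, fun h ↦ ?_⟩
  · refine mono_of_stalkMap_injective _ fun x ↦ (injective_iff_map_eq_zero _).mpr fun q hq ↦ ?_
    obtain ⟨m, rfl⟩ := stalkMap_surjective (cokernel.π (satι W)) x q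
    rw [← stalkMap_comp, hπθ, ← hW, ← range_stalkMap_satι W hS] at hq
    have := (range_stalkMap_eq_ker hex x).le hq
    exact this
  · rw [rank_satSheaf W hS] at h
    have := hS.finite_genStalk
    have h0 : W = ⊥ := Submodule.finrank_eq_zero.mp h
    exact mono_of_stalkMap_genericPoint_injective hS ψ (LinearMap.ker_eq_bot.mp h0)

/-! ### Extensions by the structure sheaf -/

/-- Semistability gives `deg S ≤ rk S + rk S / (r - 1)`, and the fraction is less than one. Rank
zero is treated apart because semistability tests only subsheaves of positive rank. -/
lemma degree_le_rank_of_mono {F : C.X.Modules} {r : ℕ} (hF : IsSemistable F)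
    (hr : rank F + 1 = r) (hd : degree F = r) {S : C.X.Modules} (hS : IsVectorBundle S)
    (ψ : S ⟶ F) [hψ : Mono ψ] (h : rank S < rank F) : degree S ≤ rank S := by
  rcases Nat.eq_zero_or_pos (rank S) with h0 | h0
  · rw [degree_eq_zero_of_rank_eq_zero hS h0, h0]; rfl
  have hs := hF.2.2 S ψ hS hψ h0
  rw [slope, slope, div_le_div_iff₀ (by exact_mod_cast h0) (by exact_mod_cast hF.2.1), hd] at hs
  have hs' : degree S * (rank F : ℤ) ≤ (r : ℤ) * (rank S : ℤ) := by exact_mod_cast hs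
  by_contra hlt
  push Not at hlt
  have h2 : ((rank S : ℤ) + 1) * (rank F : ℤ) ≤ degree S * (rank F : ℤ) :=
    mul_le_mul_of_nonneg_right hlt (by positivity)
  subst hr
  push_cast at hs'
  have : (rank S : ℤ) < rank F := by exact_mod_cast h
  nlinarith

/-- The class becomes zero when pulled back along `S.g`; pulling back further along the section
returns the class itself. -/
lemma extClass_eq_zero_of_section {S : ShortComplex C.X.Modules} (hS : S.ShortExact)
    (σ : S.X₃ ⟶ S.X₂) (hσ : σ ≫ S.g = 𝟙 _) : hS.extClass = 0 := by
  have h := congrArg (fun z ↦ (Ext.mk₀ σ).comp z (zero_add 1)) hS.comp_extClass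
  simp only [Ext.comp_zero, Ext.mk₀_comp_mk₀_assoc, hσ, Ext.mk₀_id_comp] at h
  exact h

/-- The nonsplit hypothesis enters only when `S` has the rank of `F` and embeds in it: degree at
least `deg F` would give a section of `φ`. -/
theorem degree_le_rank {F E : C.X.Modules} {r : ℕ} (hF : IsSemistable F)
    (hr : rank F + 1 = r) (hd : degree F = r) {ι : C.structureSheaf ⟶ E} {φ : E ⟶ F}
    {w : ι ≫ φ = 0} (hE : (ShortComplex.mk ι φ w).ShortExact) (hv : hE.extClass ≠ 0)
    {S : C.X.Modules} (hS : IsVectorBundle S) (j : S ⟶ E) [Mono j]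
    (h : rank S < r) : degree S ≤ rank S ∧ (degree S = rank S → Mono (j ≫ φ)) := by
  obtain ⟨K, Q, κ, π, θ, w', hK, hQ, hex, hθ, hκ, hKψ⟩ := exists_generic_kernel hS hF.1 (j ≫ φ)
  by_cases hK0 : rank K = 0
  · have hψ := hKψ hK0
    refine ⟨?_, fun _ ↦ hψ⟩
    by_cases hlt : rank S < rank F
    · exact degree_le_rank_of_mono hF hr hd hS (j ≫ φ) hlt
    · by_contra hlt'
      have hr' : rank S = rank F := by omega
      have := isIso_of_degree_eq hS hF.1 (j ≫ φ) hr' (by omega)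
      refine hv (extClass_eq_zero_of_section hE (inv (j ≫ φ) ≫ j) ?_)
      change (inv (j ≫ φ) ≫ j) ≫ φ = 𝟙 F
      rw [Category.assoc, IsIso.inv_hom_id]
  · have hκ' : (κ ≫ j) ≫ φ = 0 := by rw [Category.assoc, hκ]
    have := hE.mono_f
    have hκm : Mono κ := hex.mono_f
    -- The kernel lies in the structure sheaf, so it has rank one and degree at most `0`, while the
    -- image has rank `rk S - 1`; the bound becomes strict.
    let l : K ⟶ C.structureSheaf := hE.exact.lift (κ ≫ j) hκ'
    have hl : l ≫ ι = κ ≫ j := hE.exact.lift_f (κ ≫ j) hκ'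
    have hml : Mono l := by
      have : Mono (l ≫ ι) := by rw [hl]; infer_instance
      exact mono_of_mono l ι
    have hK1 := rank_le_of_mono isVectorBundle_structureSheaf l
    rw [rank_structureSheaf] at hK1
    have hKd := degree_le_of_mono hK isVectorBundle_structureSheaf l
      (by rw [rank_structureSheaf]; omega)
    rw [degree_structureSheaf] at hKd
    have hrank := rank_eq_add hex hK hQ
    have hdeg := degree_eq_add hex hK hS hQ
    dsimp only at hrank hdeg
    have hQd := degree_le_rank_of_mono hF hr hd hQ θ (by omega)
    constructor
    · omega
    · intro h'
      omega

/-- With equal ranks the quotient bundle has rank zero, hence zero stalks, and `i` is an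
isomorphism. -/
lemma rank_lt_of_isProperSubbundle {G E : C.X.Modules} {i : G ⟶ E} (hi : IsProperSubbundle i) :
    rank G < rank E := by
  obtain ⟨⟨hG, hm, hQ⟩, hiso⟩ := hi
  have hrank : rank E = rank G + rank (cokernel i) := rank_eq_add (shortExact_cokernel i) hG hQ
  by_contra h
  have h0 : rank (cokernel i) = 0 := by omega
  refine hiso (isIso_of_stalkMap_bijective i fun x ↦ ⟨stalkMap_injective i x, fun m ↦ ?_⟩)
  have hb := (hQ.nonempty_basis x).some
  rw [h0] at hb
  have hsub := hb.repr.toEquiv.subsingleton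
  exact (range_stalkMap_eq_ker (shortExact_cokernel i) x).ge (Subsingleton.elim _ _)

/-- The saturation of `G` in `F` has the same rank, so by maximality its degree is no larger and `G`
equals it; saturated subsheaves have locally free quotient. -/
lemma isVectorBundle_cokernel_of_degree_le {G F : C.X.Modules} (hG : IsVectorBundle G)
    (hF : IsVectorBundle F) (ψ : G ⟶ F) [Mono ψ]
    (h : ∀ (H : C.X.Modules) (k : H ⟶ F), IsVectorBundle H → Mono k → rank H = rank G →
      degree H ≤ degree G) : IsVectorBundle (cokernel ψ) := by
  let W : Submodule C.X.functionField (GenStalk F) :=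
    LinearMap.range (stalkMap ψ (genericPoint C.X))
  obtain ⟨l, hl⟩ : ∃ l, l ≫ satι W = ψ := exists_lift_of_subsheaf (satStalk W) ψ fun x p ↦ by
    rw [mem_satStalk, ← stalkMap_toGen]
    exact ⟨_, rfl⟩
  have hml : Mono l := by
    have : Mono (l ≫ satι W) := by rw [hl]; infer_instance
    exact mono_of_mono l (satι W)
  have hH := isVectorBundle_satSheaf W hF
  have hr : rank G = rank (satSheaf F W) := by
    rw [rank_satSheaf W hF]
    exact (LinearMap.finrank_range_of_inj (stalkMap_injective ψ _)).symm
  have := isIso_of_degree_eq hG hH l hr (h _ (satι W) hH inferInstance hr.symm)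
  refine isVectorBundle_of_range_eq_satStalk (shortExact_cokernel ψ) hF W fun x ↦ ?_
  rw [← range_stalkMap_satι W hF x]
  apply le_antisymm
  · rintro _ ⟨m, rfl⟩
    exact ⟨stalkMap l x m, by rw [← stalkMap_comp, hl]⟩
  · rintro _ ⟨m, rfl⟩
    exact ⟨stalkMap (inv l) x m, by
      change stalkMap ψ x _ = _
      rw [← stalkMap_comp, ← hl, IsIso.inv_hom_id_assoc]⟩

end SmoothProjectiveCurve

/-! ### Maps with irreducible determinant. -/

/-- If the determinant of an injective map is irreducible, then every proper
submodule that contains the image equals the image. -/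
lemma range_eq_of_irreducible_det {R A B ι : Type*} [CommRing R] [IsDomain R]
    [IsPrincipalIdealRing R] [AddCommGroup A] [AddCommGroup B] [Module R A] [Module R B] [Fintype ι]
    [DecidableEq ι] (f : A →ₗ[R] B) (hf : Function.Injective f) (a : Module.Basis ι R A)
    (b : Module.Basis ι R B) (h : Irreducible (b.det fun i ↦ f (a i))) (N : Submodule R B)
    (hN : N ≠ ⊤) (hfN : LinearMap.range f ≤ N) : LinearMap.range f = N := by
  have : Module.Free R B := .of_basis b
  have : Module.Finite R B := .of_basis b
  let g : A →ₗ[R] N := f.codRestrict N fun m ↦ hfN ⟨m, rfl⟩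
  have hg : Function.Injective g := fun m n e ↦ hf (congrArg Subtype.val e)
  have hr : Module.finrank R N = Fintype.card ι := by
    apply le_antisymm
    · rw [← Module.finrank_eq_card_basis b]
      exact Submodule.finrank_le N
    · rw [← Module.finrank_eq_card_basis a]
      exact LinearMap.finrank_le_finrank_of_injective hg
  let e : Module.Basis ι R N :=
    (Module.finBasis R N).reindex (Fintype.equivFinOfCardEq hr.symm).symm
  -- `N` is free of full rank, so the determinant factors through it. The first factor is not a unit
  -- since `N` is proper; irreducibility makes the second one a unit, and `A → N` is bijective.
  have hdet : b.det (fun i ↦ f (a i)) = b.det (fun i ↦ (e i : B)) * e.det fun i ↦ g (a i) := by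
    rw [Module.Basis.det_apply, Module.Basis.det_apply, Module.Basis.det_apply, ← Matrix.det_mul]
    congr 1
    ext i j
    have h1 : f (a j) = ∑ k, e.repr (g (a j)) k • (e k : B) := by
      have := congrArg N.subtype (e.sum_repr (g (a j)))
      rw [map_sum] at this
      exact this.symm
    rw [Module.Basis.toMatrix_apply, h1, Matrix.mul_apply, map_sum, Finset.sum_apply']
    refine Finset.sum_congr rfl fun k _ ↦ ?_
    rw [map_smul, Finsupp.smul_apply, smul_eq_mul, mul_comm]
    rfl
  rw [hdet] at h
  have hnu : ¬ IsUnit (b.det fun i ↦ (e i : B)) := by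
    intro hu
    have := bijective_of_isUnit_det N.subtype e b hu
    exact hN (by rw [← N.range_subtype]; exact LinearMap.range_eq_top.mpr this.2)
  have hu := bijective_of_isUnit_det g a e ((h.isUnit_or_isUnit rfl).resolve_left hnu)
  refine le_antisymm hfN fun n hn ↦ ?_
  obtain ⟨m, hm⟩ := hu.2 ⟨n, hn⟩
  exact ⟨m, congrArg Subtype.val hm⟩

/-- Over a local principal ideal domain the cokernel of a map with irreducible determinant is the
residue field. -/
lemma exists_residue_of_irreducible_det {R A B ι : Type*} [CommRing R] [IsDomain R] [IsLocalRing R]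
    [IsPrincipalIdealRing R] [AddCommGroup A] [AddCommGroup B] [Module R A] [Module R B] [Fintype ι]
    [DecidableEq ι] (f : A →ₗ[R] B) (hf : Function.Injective f) (a : Module.Basis ι R A)
    (b : Module.Basis ι R B) (h : Irreducible (b.det fun i ↦ f (a i))) :
    ∃ g : B →ₗ[R] IsLocalRing.ResidueField R, Function.Surjective g ∧
      LinearMap.ker g = LinearMap.range f := by
  -- A maximal proper image makes the cokernel a simple module, and over a local ring this is the
  -- residue field.
  have hc : IsCoatom (LinearMap.range f) := by
    refine ⟨fun ht ↦ h.not_isUnit (isUnit_det_of_surjective f a b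
      ⟨hf, LinearMap.range_eq_top.mp ht⟩), fun N hN ↦ ?_⟩
    by_contra hN'
    exact hN.ne (range_eq_of_irreducible_det f hf a b h N hN' hN.le)
  have hs : IsSimpleModule R (B ⧸ LinearMap.range f) := isSimpleModule_iff_isCoatom.mpr hc
  obtain ⟨I, hI, ⟨e⟩⟩ := isSimpleModule_iff_quot_maximal.mp hs
  obtain rfl := IsLocalRing.eq_maximalIdeal hI
  refine ⟨e.toLinearMap ∘ₗ (LinearMap.range f).mkQ, e.surjective.comp
    (Submodule.mkQ_surjective _), ?_⟩
  ext n
  exact e.map_eq_zero_iff.trans (Submodule.Quotient.mk_eq_zero _)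

namespace SmoothProjectiveCurve

variable {C : SmoothProjectiveCurve}

/-! ### Skyscraper sheaves -/

section Skyscraper

variable (p : C.X)

/-- The sections of the skyscraper sheaf, as elements of the residue field. -/
def skyscraperConst (U : C.X.Opens) :
    C.X.residueField p →+* Γ(Spec (C.X.residueField p), C.X.fromSpecResidueField p ⁻¹ᵁ U) :=
  ((Scheme.ΓSpecIso (C.X.residueField p)).inv ≫
    (Spec (C.X.residueField p)).presheaf.map (homOfLE le_top).op).hom

lemma skyscraperConst_map {U V : C.X.Opens} (h : V ≤ U) (z : C.X.residueField p) :
    (Spec (C.X.residueField p)).presheaf.map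
      ((Opens.map (C.X.fromSpecResidueField p).base).map (homOfLE h)).op
      (skyscraperConst p U z) = skyscraperConst p V z := by
  have : ((Scheme.ΓSpecIso (C.X.residueField p)).inv ≫
    (Spec (C.X.residueField p)).presheaf.map (homOfLE le_top).op) ≫
      (Spec (C.X.residueField p)).presheaf.map
      ((Opens.map (C.X.fromSpecResidueField p).base).map (homOfLE h)).op =
      (Scheme.ΓSpecIso (C.X.residueField p)).inv ≫
    (Spec (C.X.residueField p)).presheaf.map (homOfLE le_top).op := by
    rw [Category.assoc, ← Functor.map_comp]
    rfl
  exact congr($this z)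

/-- Functions act on the skyscraper through their value at `p`; this is what makes the map built
from `lam` linear. -/
lemma fromSpecResidueField_app {U : C.X.Opens} (hp : p ∈ U) (a : Γ(C.X, U)) :
    (C.X.fromSpecResidueField p).app U a =
      skyscraperConst p U ((C.X.residue p).hom (ringGerm hp a)) := by
  have : (C.X.fromSpecResidueField p).app U = C.X.presheaf.germ U p hp ≫ C.X.residue p ≫
      (Scheme.ΓSpecIso (C.X.residueField p)).inv ≫
      (Spec (C.X.residueField p)).presheaf.map (homOfLE le_top).op := by
    rw [Scheme.fromSpecResidueField, Scheme.Hom.comp_app, Scheme.fromSpecStalk_app hp]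
    simp only [Category.assoc, Scheme.Hom.naturality, Scheme.ΓSpecIso_inv_naturality_assoc]
    rfl
  exact congr($this a)

lemma skyscraperConst_bijective {U : C.X.Opens} (hp : p ∈ U) :
    Function.Bijective (skyscraperConst p U) := by
  have h : C.X.fromSpecResidueField p ⁻¹ᵁ U = ⊤ := by
    ext y
    simp [hp]
  have : IsIso ((Spec (C.X.residueField p)).presheaf.map
      (homOfLE (le_top : C.X.fromSpecResidueField p ⁻¹ᵁ U ≤ ⊤)).op) := by
    have : IsIso (homOfLE (le_top : C.X.fromSpecResidueField p ⁻¹ᵁ U ≤ ⊤)) :=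
      ⟨homOfLE h.ge, rfl, rfl⟩
    infer_instance
  exact ConcreteCategory.bijective_of_isIso ((Scheme.ΓSpecIso (C.X.residueField p)).inv ≫
    (Spec (C.X.residueField p)).presheaf.map (homOfLE le_top).op)

lemma subsingleton_skyscraper {U : C.X.Opens} (hp : p ∉ U) :
    Subsingleton Γ(Spec (C.X.residueField p), C.X.fromSpecResidueField p ⁻¹ᵁ U) := by
  have h : C.X.fromSpecResidueField p ⁻¹ᵁ U = ⊥ := by
    ext y
    simp [hp]
  rw [h]
  infer_instance

variable {p}

open Classical in
/-- The map to the skyscraper sheaf on sections. -/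
def toSkyscraperSec {F : C.X.Modules} (lam : Stalk F p →+ C.X.residueField p) (U : C.X.Opens) :
    Γ(F, U) →+ Γ(Spec (C.X.residueField p), C.X.fromSpecResidueField p ⁻¹ᵁ U) :=
  if hp : p ∈ U then (skyscraperConst p U).toAddMonoidHom.comp (lam.comp (germ F hp)) else 0

lemma toSkyscraperSec_apply {F : C.X.Modules} (lam : Stalk F p →+ C.X.residueField p)
    {U : C.X.Opens} (hp : p ∈ U) (s : Γ(F, U)) :
    toSkyscraperSec lam U s = skyscraperConst p U (lam (germ F hp s)) := by
  rw [toSkyscraperSec, dif_pos hp]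
  rfl

lemma toSkyscraperSec_res {F : C.X.Modules} (lam : Stalk F p →+ C.X.residueField p)
    {U V : C.X.Opens} (h : V ≤ U) (s : Γ(F, U)) :
    toSkyscraperSec lam V (res F h s) = (Spec (C.X.residueField p)).presheaf.map
      ((Opens.map (C.X.fromSpecResidueField p).base).map (homOfLE h)).op
      (toSkyscraperSec lam U s) := by
  by_cases hp : p ∈ V
  · rw [toSkyscraperSec_apply lam hp, toSkyscraperSec_apply lam (h hp), germ_res,
      skyscraperConst_map p h]
  · exact (subsingleton_skyscraper p hp).elim _ _

lemma toSkyscraperSec_smul {F : C.X.Modules} (lam : Stalk F p →+ C.X.residueField p)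
    (hlam : ∀ (a : C.X.presheaf.stalk p) m, lam (a • m) = (C.X.residue p).hom a * lam m)
    {U : C.X.Opens} (a : Γ(C.X, U)) (s : Γ(F, U)) :
    toSkyscraperSec lam U (a • s) =
      (C.X.fromSpecResidueField p).app U a * toSkyscraperSec lam U s := by
  by_cases hp : p ∈ U
  · rw [toSkyscraperSec_apply lam hp, toSkyscraperSec_apply lam hp, germ_smul, hlam, map_mul,
      fromSpecResidueField_app p hp]
  · exact (subsingleton_skyscraper p hp).elim _ _

lemma exists_toSkyscraper {F : C.X.Modules} (lam : Stalk F p →+ C.X.residueField p)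
    (hlam : ∀ (a : C.X.presheaf.stalk p) m, lam (a • m) = (C.X.residue p).hom a * lam m) :
    ∃ γ : F ⟶ C.skyscraper p, ∀ U s, sec γ U s = toSkyscraperSec lam U s := by
  let app : ∀ U : (C.X.Opens)ᵒᵖ, F.val.presheaf.obj U →+ (C.skyscraper p).val.presheaf.obj U :=
    fun U ↦ toSkyscraperSec lam U.unop
  let g : F.val ⟶ (C.skyscraper p).val := PresheafOfModules.homMk
    { app := fun U ↦ AddCommGrpCat.ofHom (app U)
      naturality := fun U V i ↦ by
        ext s
        exact toSkyscraperSec_res lam i.unop.le s }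
    (fun U a s ↦ toSkyscraperSec_smul lam hlam (U := U.unop) a s)
  exact ⟨⟨g⟩, fun U s ↦ rfl⟩

end Skyscraper

/-! ### Elementary transformations -/

lemma irreducible_of_ord_algebraMap_eq_one {x : C.X} (hx : x ≠ genericPoint C.X)
    {a : C.X.presheaf.stalk x} (ha : a ≠ 0)
    (h : Scheme.ord (algebraMap _ C.X.functionField a) x = 1) : Irreducible a := by
  have := isDiscreteValuationRing_stalk hx
  rw [ord_algebraMap hx ha, Nat.cast_eq_one, ENat.toNat_eq_iff one_ne_zero] at h
  obtain ⟨ϖ, hϖ⟩ := IsDiscreteValuationRing.exists_irreducible (C.X.presheaf.stalk x)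
  have h1 : Ring.ord (C.X.presheaf.stalk x) ϖ = Ring.ord (C.X.presheaf.stalk x) a := by
    rw [Ring.ord_of_irreducible hϖ, h]; rfl
  exact ((Ring.ord_eq_iff_associated _ _).mp h1).irreducible hϖ

/-- A monomorphism that is an isomorphism away from `p` and has cokernel `κ(p)` at `p` is an
elementary transformation. -/
lemma isElementaryTransformation_of_stalkMap {G F : C.X.Modules} (ψ : G ⟶ F) [Mono ψ] {p : C.X}
    (hp : IsClosed {p}) (hψ : ∀ x ≠ p, Function.Surjective (stalkMap ψ x))
    (lam : Stalk F p →+ C.X.residueField p) (hs : Function.Surjective lam)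
    (hlam : ∀ (a : C.X.presheaf.stalk p) m, lam (a • m) = (C.X.residue p).hom a * lam m)
    (hker : ∀ m, lam m = 0 ↔ m ∈ LinearMap.range (stalkMap ψ p)) :
    IsElementaryTransformation ψ := by
  obtain ⟨γ, hγ⟩ := exists_toSkyscraper lam hlam
  -- Since `p` is closed, any germ at `x` can be restricted to a neighbourhood missing `p`, where
  -- the skyscraper has only the zero section.
  have hstalk (x) (hx : x ≠ p) : Subsingleton (Stalk (C.skyscraper p) x) := by
    refine subsingleton_of_forall_eq 0 fun n ↦ ?_
    obtain ⟨U, hxU, s, rfl⟩ := exists_germ_eq (C.skyscraper p) n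
    let V : C.X.Opens := ⟨{p}ᶜ, hp.isOpen_compl⟩
    have hxV : x ∈ U ⊓ V := ⟨hxU, hx⟩
    have hpV : p ∉ U ⊓ V := fun h ↦ h.2 rfl
    rw [← germ_res (C.skyscraper p) (inf_le_left : U ⊓ V ≤ U) hxV]
    have h0 : res (C.skyscraper p) (inf_le_left : U ⊓ V ≤ U) s = 0 :=
      (subsingleton_skyscraper p hpV).elim _ _
    rw [h0, map_zero]
  have hgerm (m) : stalkMap γ p m = 0 ↔ lam m = 0 := by
    obtain ⟨U, hpU, s, rfl⟩ := exists_germ_eq F m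
    rw [stalkMap_germ]
    constructor
    · intro h
      obtain ⟨V, hpV, hVU, h0⟩ := exists_res_eq_zero (C.skyscraper p) hpU _ h
      rw [← sec_res, hγ, toSkyscraperSec_apply lam hpV, germ_res] at h0
      exact (skyscraperConst_bijective p hpV).1 (h0.trans (map_zero (skyscraperConst p V)).symm)
    · intro h
      have h0 : sec γ U s = 0 := by
        rw [hγ, toSkyscraperSec_apply lam hpU, h]
        exact map_zero (skyscraperConst p U)
      rw [h0, map_zero]
  have w : ψ ≫ γ = 0 := by
    refine hom_ext_of_stalkMap _ _ fun x m ↦ ?_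
    by_cases hx : x = p
    · subst hx
      rw [stalkMap_comp, stalkMap_zero, hgerm, hker]
      exact ⟨m, rfl⟩
    · exact (hstalk x hx).elim _ _
  refine ⟨p, hp, γ, w, shortExact_of_stalkMap (stalkMap_injective ψ) (fun x m hm ↦ ?_)
    fun x n ↦ ?_⟩
  · by_cases hx : x = p
    · subst hx
      exact (hker m).mp ((hgerm m).mp hm)
    · exact hψ x hx m
  · by_cases hx : x = p
    · subst hx
      obtain ⟨U, hpU, t, rfl⟩ := exists_germ_eq (C.skyscraper x) n
      obtain ⟨z, hz⟩ := (skyscraperConst_bijective x hpU).2 t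
      obtain ⟨m, hm⟩ := hs z
      obtain ⟨V, hpV, s, rfl⟩ := exists_germ_eq F m
      refine ⟨germ F hpV s, ?_⟩
      have hpW : x ∈ U ⊓ V := ⟨hpU, hpV⟩
      refine (stalkMap_germ γ hpV s).trans ?_
      rw [← germ_res (C.skyscraper x) (inf_le_left : U ⊓ V ≤ U) hpW t,
        ← germ_res (C.skyscraper x) (inf_le_right : U ⊓ V ≤ V) hpW, ← sec_res, hγ,
        toSkyscraperSec_apply lam hpW, germ_res, hm]
      congr 1
      refine (skyscraperConst_map x inf_le_left z).symm.trans ?_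
      rw [hz]
      rfl
    · exact ⟨0, (hstalk x hx).elim _ _⟩

/-- Nonnegative integers with sum one: the determinant vanishes at a single point, to order one.
There it is a uniformiser, so the cokernel is the residue field; elsewhere it is a unit. -/
lemma isElementaryTransformation_of_degree {G F : C.X.Modules} (hG : IsVectorBundle G)
    (hF : IsVectorBundle F) (ψ : G ⟶ F) [Mono ψ] (hr : rank G = rank F)
    (hd : degree F - degree G = 1) : IsElementaryTransformation ψ := by
  have c (x) := (hG.nonempty_basis x).some
  have d (x) := ((hF.nonempty_basis x).some).reindex (finCongr hr.symm)
  obtain ⟨hne, hfin, h⟩ := degree_sub_degree hG hF ψ c d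
  rw [hd] at h
  let D : C.X → ℤ := fun x ↦ Scheme.ord (algebraMap _ C.X.functionField
    ((d x).det fun i ↦ stalkMap ψ x (c x i))) x
  have hD (x) : 0 ≤ D x := ord_algebraMap_nonneg _
  change D.support.Finite at hfin
  change 1 = ∑ᶠ x, D x at h
  obtain ⟨p, hp⟩ : ∃ p, D p ≠ 0 := by
    by_contra! h0
    rw [finsum_congr h0, finsum_zero] at h
    exact one_ne_zero h
  have hsum := add_finsum_cond_ne p hfin
  have hrest : 0 ≤ ∑ᶠ x ≠ p, D x := finsum_nonneg fun x ↦ finsum_nonneg fun _ ↦ hD x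
  have hDp := hD p
  have hp1 : D p = 1 := by omega
  have hother (x) (hx : x ≠ p) : D x = 0 := by
    rw [finsum_eq_sum_of_support_subset D (s := hfin.toFinset) (by simp)] at h
    by_contra hx0
    classical
    have := Finset.sum_le_sum_of_subset_of_nonneg (s := {x, p}) (t := hfin.toFinset) (f := D)
      (by intro y hy; rcases Finset.mem_insert.mp hy with rfl | hy
          · simpa using hx0
          · rw [Finset.mem_singleton.mp hy]; simpa using hp) fun y _ _ ↦ hD y
    rw [Finset.sum_pair hx, ← h, hp1] at this
    have := hD x
    omega
  have hpη : p ≠ genericPoint C.X := by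
    intro h
    refine hp ?_
    subst h
    exact ord_genericPoint _
  obtain ⟨g, hg, hgker⟩ := exists_residue_of_irreducible_det (stalkMap ψ p)
    (stalkMap_injective ψ p) (c p) (d p) (irreducible_of_ord_algebraMap_eq_one hpη (hne p) hp1)
  refine isElementaryTransformation_of_stalkMap ψ (isClosed_singleton hpη) (fun x hx ↦ ?_)
    g.toAddMonoidHom hg (fun a m ↦ ?_) fun m ↦ by rw [← hgker]; rfl
  · refine (bijective_of_isUnit_det _ (c x) (d x) ?_).2
    by_cases hxη : x = genericPoint C.X
    · subst hxη
      exact isUnit_iff_ne_zero.mpr (hne _)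
    · exact isUnit_of_ord_algebraMap_eq_zero hxη (hne x) (hother x hx)
  · exact (map_smul g a m).trans (Algebra.smul_def _ _)

end SmoothProjectiveCurve

theorem proposition2p4 (C : SmoothProjectiveCurve) (hC : C.genus = 2) (r : ℕ) (hr : 3 ≤ r)
    (F : C.X.Modules) (hF : SmoothProjectiveCurve.IsSemistable F)
    (hFrank : SmoothProjectiveCurve.rank F = r - 1)
    (hFdeg : SmoothProjectiveCurve.degree F = (r : ℤ))
    (v : Ext.{1} F C.structureSheaf 1) (hv : v ≠ 0)
    (E : C.X.Modules) (ι : C.structureSheaf ⟶ E) (φ : E ⟶ F) (w : ι ≫ φ = 0)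
    (hE : (ShortComplex.mk ι φ w).ShortExact) (hEv : hE.extClass = v)
    (G : C.X.Modules) (i : G ⟶ E) (hi : SmoothProjectiveCurve.IsProperSubbundle i)
    (hG : SmoothProjectiveCurve.slope G = 1) :
    SmoothProjectiveCurve.IsSemistable G ∧
      ((1 ≤ SmoothProjectiveCurve.rank G ∧ SmoothProjectiveCurve.rank G ≤ r - 2 ∧
          SmoothProjectiveCurve.IsMaximalSubbundle (i ≫ φ)) ∨
        (SmoothProjectiveCurve.rank G = r - 1 ∧
          SmoothProjectiveCurve.IsElementaryTransformation (i ≫ φ))) := by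
  obtain rfl := hEv
  have hr' : SmoothProjectiveCurve.rank F + 1 = r := by omega
  have hGv := hi.1.1
  have := hi.1.2.1
  -- In rank zero the slope is `0` by the convention for division by zero, not `1`.
  have hG0 : SmoothProjectiveCurve.rank G ≠ 0 := fun h ↦ by
    simp [SmoothProjectiveCurve.slope, h] at hG
  have hGd : SmoothProjectiveCurve.degree G = SmoothProjectiveCurve.rank G := by
    rw [SmoothProjectiveCurve.slope, div_eq_one_iff_eq (by exact_mod_cast hG0)] at hG
    exact_mod_cast hG
  have hEr := SmoothProjectiveCurve.rank_eq_add hE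
    SmoothProjectiveCurve.isVectorBundle_structureSheaf hF.1
  dsimp only at hEr
  rw [SmoothProjectiveCurve.rank_structureSheaf] at hEr
  have hGr := SmoothProjectiveCurve.rank_lt_of_isProperSubbundle hi
  have hmono : Mono (i ≫ φ) := (SmoothProjectiveCurve.degree_le_rank hF hr' hFdeg hE hv hGv i
    (by omega)).2 hGd
  refine ⟨⟨hGv, Nat.pos_of_ne_zero hG0, fun S j hS hj hS0 ↦ ?_⟩, ?_⟩
  -- A subsheaf of `G` is also one of `E`, so the same degree bound gives slope at most one.
  · have hSr := SmoothProjectiveCurve.rank_le_of_mono hGv j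
    have hSd := (SmoothProjectiveCurve.degree_le_rank hF hr' hFdeg hE hv hS (j ≫ i)
      (by omega)).1
    rw [hG, SmoothProjectiveCurve.slope, div_le_one (by exact_mod_cast hS0)]
    exact_mod_cast hSd
  · by_cases h : SmoothProjectiveCurve.rank G = r - 1
    -- Here `deg F - deg G = r - (r - 1) = 1`.
    · exact .inr ⟨h, SmoothProjectiveCurve.isElementaryTransformation_of_degree hGv hF.1 _
        (by omega) (by omega)⟩
    · have hlt : SmoothProjectiveCurve.rank G < SmoothProjectiveCurve.rank F := by omega
      -- Maximality is shown for all locally free subsheaves, not only subbundles, because the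
      -- saturation argument for the cokernel needs this form.
      have hmax : ∀ (H : C.X.Modules) (k : H ⟶ F), SmoothProjectiveCurve.IsVectorBundle H →
          Mono k → SmoothProjectiveCurve.rank H = SmoothProjectiveCurve.rank G →
          SmoothProjectiveCurve.degree H ≤ SmoothProjectiveCurve.degree G :=
        fun H k hH hk hHr ↦ by
          have := SmoothProjectiveCurve.degree_le_rank_of_mono hF hr' hFdeg hH k (by omega)
          omega
      refine .inl ⟨by omega, by omega, ⟨⟨hGv, hmono,
        SmoothProjectiveCurve.isVectorBundle_cokernel_of_degree_le hGv hF.1 (i ≫ φ) hmax⟩,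
        fun hiso ↦ ?_⟩, hG, fun H k hk hHr ↦ hmax H k hk.1 hk.2.1 hHr⟩
      have := SmoothProjectiveCurve.rank_le_of_mono hGv (inv (i ≫ φ))
      omega
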